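/- Let $n\ge 2$ and use the Fourier transform $\widehat g(\xi)=\int_{\mathbb R^n}g(x)e^{-ix\cdot\xi}\,dx$. Let $w:(0,\infty)\to(0,\infty)$ be measurable and such that $w(|\cdot|)$ is a tempered distribution on $\mathbb R^n$ (i.e. $\int_{\mathbb R^n} w(|\xi|)(1+|\xi|)^{-N}\,d\xi<\infty$ for some $N$) whose Fourier transform coincides on $\mathbb R^n\setminus\{0\}$ with a positive locally integrable function. For $k\ge 0$ put $$\lambda_k(w)=\int_0^\infty J_{k+\frac{n-2}{2}}(r)^2\,r\,w(r)\,dr,$$ where $J_\nu$ is the Bessel function of the first kind, and assume $\lambda_0(w)<\infty$. Then all $\lambda_k(w)$ are finite and $\lambda_*(w):=\sup_{k\ge1}\lambda_k(w)$ is finite. Let $\mathcal K$ be the (possibly empty) set of $k\ge1$ with $\lambda_k(w)=\lambda_*(w)$, and let $C'(w)=\lambda_0(w)-\lambda_*(w)$. There is a unique bounded operator $\mathcal S_w=\mathcal R\circ w(\sqrt{-\Delta})^{1/2}:L^2(\mathbb R^n)\to L^2(\mathbb S^{n-1})$ (with $\mathcal R$ the restriction to $\mathbb S^{n-1}$) such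 that $\mathcal S_wg(\theta)=(2\pi)^{-n}\int_{\mathbb R^n} w(|\xi|)^{1/2}\widehat g(\xi)e^{i\theta\cdot\xi}\,d\xi$ for a.e. $\theta\in\mathbb S^{n-1}$ whenever $w(|\cdot|)^{1/2}\widehat g\in L^1(\mathbb R^n)$. Let $C(w)=\|\mathcal S_w\|$ be the sharp constant in $\|\mathcal S_wg\|_{L^2(\mathbb S^{n-1})}\le C(w)\|g\|_{L^2(\mathbb R^n)}$, and let $M(\mathcal S_w)$ be the set of extremisers, i.e. of the $g\neq0$ for which equality holds; it is non-empty. Consider, for a constant $C$, the inequality $$C(w)^2\|g\|_{L^2(\mathbb R^n)}^2-\|\mathcal S_wg\|_{L^2(\mathbb S^{n-1})}^2\;\ge\; C\inf_{g_*\in M(\mathcal S_w)}\|g-g_*\|_{L^2(\mathbb R^n)}^2\qquad\text{for all } g\in L^2(\mathbb R^n).\tag{1}$$ 1. Inequality (1) holds with $C=C'(w)$. 2. Suppose $C'(w)>0$. Then $C'(w)$ is optimal: if (1) holds with a constant $C$, then $C\le C'(w)$. Moreover, (1) with $C=C'(w)$ has an extremiser (a $g$ for which equality holds and $\inf_{g_*\in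 M(\mathcal S_w)}\|g-g_*\|_{L^2}>0$) if and only if $\mathcal K\ne\emptyset$. If $\mathcal K\neq\emptyset$, then $g\in L^2(\mathbb R^n)$ satisfies equality in (1) with $C=C'(w)$ if and only if there exist $c\in\mathbb C$ and, for each $k\in\mathcal K$, a spherical harmonic $Y_k$ of degree $k$ (the restriction to $\mathbb S^{n-1}$ of a complex homogeneous harmonic polynomial of degree $k$ on $\mathbb R^n$) such that $$\frac{|\xi|^{\frac{n-2}{2}}}{w(|\xi|)^{1/2}}\,\widehat g(\xi)=c\,J_{\frac{n-2}{2}}(|\xi|)+\sum_{k\in\mathcal K}Y_k\!\left(\tfrac{\xi}{|\xi|}\right)J_{\frac{n-2}{2}+k}(|\xi|),$$ where, after multiplication of both sides by $w(|\xi|)^{1/2}|\xi|^{-\frac{n-2}{2}}$, the series converges unconditionally to $\widehat g$ in $L^2(\mathbb R^n)$ (for finite $\mathcal K$: the identity holds for almost every $\xi$). 3. If $C'(w)=0$, then (1) is false for every $C>0$. -/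

import Mathlib

open MeasureTheory Filter Topology
open scoped SchwartzMap

noncomputable section

/-- The Euclidean space `ℝⁿ`. -/
abbrev Rn (n : ℕ) : Type := EuclideanSpace ℝ (Fin n)

/-- The unit sphere `𝕊ⁿ⁻¹ ⊆ ℝⁿ`, as a type. -/
abbrev UnitSphere (n : ℕ) : Type := Metric.sphere (0 : Rn n) 1

/-- The Hilbert space `L²(ℝⁿ)` of complex-valued functions. -/
abbrev L2Space (n : ℕ) : Type := Lp ℂ 2 (volume : Measure (Rn n))

/-- The Hilbert space `L²(𝕊ⁿ⁻¹)` with respect to the surface measure induced by Lebesgue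
measure. -/
abbrev L2Sphere (n : ℕ) : Type := Lp ℂ 2 (volume : Measure (Rn n)).toSphere

/-- The Bessel function of the first kind of order `ν ≥ 0`, at a point `r ≥ 0`:
`J_ν(r) = ∑_{m ≥ 0} (-1)^m / (m! Γ(m + ν + 1)) (r / 2)^(2 m + ν)`. -/
def besselJ (ν r : ℝ) : ℝ :=
  ∑' m : ℕ, (-1 : ℝ) ^ m / ((m.factorial : ℝ) * Real.Gamma (m + ν + 1)) *
    (r / 2) ^ (2 * (m : ℝ) + ν)

/-- The order `k + (n - 2) / 2`. -/
def besselOrder (n k : ℕ) : ℝ := (k : ℝ) + ((n : ℝ) - 2) / 2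

/-- The integrand `J_{k + (n-2)/2}(r)² r w(r)`. -/
def lambdaIntegrand (n : ℕ) (w : ℝ → ℝ) (k : ℕ) (r : ℝ) : ℝ :=
  besselJ (besselOrder n k) r ^ 2 * r * w r

/-- `λ_k(w) = ∫₀^∞ J_{k + (n-2)/2}(r)² r w(r) dr`. -/
def lambdaCoeff (n : ℕ) (w : ℝ → ℝ) (k : ℕ) : ℝ :=
  ∫ r in Set.Ioi (0 : ℝ), lambdaIntegrand n w k r

/-- `λ_*(w) = sup_{k ≥ 1} λ_k(w)`. -/
def lambdaStar (n : ℕ) (w : ℝ → ℝ) : ℝ := sSup (lambdaCoeff n w '' Set.Ici 1)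

/-- The set `𝒦(w)` of those `k ≥ 1` at which the supremum defining `λ_*(w)` is attained. -/
def attainingSet (n : ℕ) (w : ℝ → ℝ) : Set ℕ := {k | 1 ≤ k ∧ lambdaCoeff n w k = lambdaStar n w}

/-- `C'(w) = λ_0(w) - λ_*(w)`. -/
def stabilityConst (n : ℕ) (w : ℝ → ℝ) : ℝ := lambdaCoeff n w 0 - lambdaStar n w

/-- The Fourier integral `∫ f(x) e^{-i x·ξ} dx`. -/
def fourierInt {n : ℕ} (f : Rn n → ℂ) (ξ : Rn n) : ℂ :=
  ∫ x, f x * Complex.exp (-Complex.I * ((inner ℝ x ξ : ℝ) : ℂ))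

/-- The Fourier transform of `g ∈ L²(ℝⁿ)` with the normalization
`ĝ(ξ) = ∫ g(x) e^{-i x·ξ} dx`, i.e. the `L²` Fourier transform of Mathlib
(which uses `e^{-2π i x·ξ}`) evaluated at `ξ / (2π)`. -/
def fourierL2 {n : ℕ} (g : L2Space n) (ξ : Rn n) : ℂ :=
  (Lp.fourierTransformₗᵢ (Rn n) ℂ g : L2Space n) ((2 * Real.pi)⁻¹ • ξ)

/-- The radial function `w(|·|)` is a tempered distribution whose Fourier transform is, away from
the origin, given by a positive locally integrable function. -/
def HasPositiveFourierTransform (n : ℕ) (w : ℝ → ℝ) : Prop :=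
  (∃ N : ℕ, Integrable (fun ξ : Rn n => w ‖ξ‖ * ((1 + ‖ξ‖) ^ N)⁻¹)) ∧
  ∃ Φ : Rn n → ℝ, (∀ x, x ≠ 0 → 0 < Φ x) ∧
    LocallyIntegrableOn Φ {x : Rn n | x ≠ 0} ∧
    ∀ φ : 𝓢(Rn n, ℂ), HasCompactSupport φ → (0 : Rn n) ∉ tsupport φ →
      ∫ ξ, (w ‖ξ‖ : ℂ) * fourierInt φ ξ = ∫ x, (Φ x : ℂ) * φ x

/-- The symbol side of `w(√-Δ)^{1/2} g`: the function `ξ ↦ w(|ξ|)^{1/2} ĝ(ξ)`. -/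
def symbolMul {n : ℕ} (w : ℝ → ℝ) (g : L2Space n) (ξ : Rn n) : ℂ :=
  (Real.sqrt (w ‖ξ‖) : ℂ) * fourierL2 g ξ

/-- `w(√-Δ)^{1/2} g (x) = (2π)^{-n} ∫ w(|ξ|)^{1/2} ĝ(ξ) e^{i x·ξ} dξ`, a continuous function
of `x` as soon as `w(|·|)^{1/2} ĝ` is integrable. -/
def multiplierOp {n : ℕ} (w : ℝ → ℝ) (g : L2Space n) (x : Rn n) : ℂ :=
  ((2 * Real.pi : ℝ) ^ n : ℂ)⁻¹ *
    ∫ ξ, symbolMul w g ξ * Complex.exp (Complex.I * ((inner ℝ x ξ : ℝ) : ℂ))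

/-- `S` is the operator `𝒮_w = ℛ ∘ w(√-Δ)^{1/2}`, where `ℛ` is restriction to the sphere: a
bounded operator from `L²(ℝⁿ)` to `L²(𝕊ⁿ⁻¹)` which is given by honest restriction of the continuous
function `w(√-Δ)^{1/2} g` on the dense subspace of those `g` for which `w(|·|)^{1/2} ĝ` is
integrable. -/
def IsSphereTrace {n : ℕ} (w : ℝ → ℝ) (S : L2Space n →L[ℂ] L2Sphere n) : Prop :=
  ∀ g : L2Space n, Integrable (symbolMul w g) →
    (S g : UnitSphere n → ℂ) =ᵐ[(volume : Measure (Rn n)).toSphere]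
      fun θ => multiplierOp w g (θ : Rn n)

/-- The set of extremisers (nontrivial cases of equality) of `‖S g‖ ≤ ‖S‖ ‖g‖`. The operator norm
`‖S‖` is the sharp constant in this inequality. -/
def extremisers {n : ℕ} (S : L2Space n →L[ℂ] L2Sphere n) : Set (L2Space n) :=
  {g | g ≠ 0 ∧ ‖S g‖ = ‖S‖ * ‖g‖}

/-- The deficit `‖S‖² ‖g‖² - ‖S g‖²`. -/
def deficit {n : ℕ} (S : L2Space n →L[ℂ] L2Sphere n) (g : L2Space n) : ℝ :=
  ‖S‖ ^ 2 * ‖g‖ ^ 2 - ‖S g‖ ^ 2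

/-- The squared distance `inf_{g_* ∈ M(S)} ‖g - g_*‖²` to the set of extremisers. -/
def distSq {n : ℕ} (S : L2Space n →L[ℂ] L2Sphere n) (g : L2Space n) : ℝ :=
  Metric.infDist g (extremisers S) ^ 2

/-- The stability inequality with constant `C`, for all `g ∈ L²(ℝⁿ)`. -/
def StabilityInequality {n : ℕ} (S : L2Space n →L[ℂ] L2Sphere n) (C : ℝ) : Prop :=
  ∀ g : L2Space n, deficit S g ≥ C * distSq S g

/-- `Y` is, on the unit sphere, a spherical harmonic of degree `k`: the restriction of a
homogeneous harmonic polynomial of degree `k` on `ℝⁿ` with complex coefficients (the values of `Y`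
off the sphere are irrelevant). -/
def IsSphericalHarmonic {n : ℕ} (k : ℕ) (Y : Rn n → ℂ) : Prop :=
  ∃ p : MvPolynomial (Fin n) ℂ, p.IsHomogeneous k ∧
    ∑ i : Fin n, MvPolynomial.pderiv i (MvPolynomial.pderiv i p) = 0 ∧
    ∀ θ ∈ Metric.sphere (0 : Rn n) 1, Y θ = MvPolynomial.eval (fun i => (θ i : ℂ)) p

/-- The partial sum
`w(|ξ|)^{1/2} |ξ|^{-(n-2)/2} (c J_{(n-2)/2}(|ξ|) + ∑_{k ∈ s} Y_k(ξ/|ξ|) J_{(n-2)/2+k}(|ξ|))`. -/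
def besselExpansion {n : ℕ} (w : ℝ → ℝ) (c : ℂ) (Y : ℕ → Rn n → ℂ) (s : Finset ℕ)
    (ξ : Rn n) : ℂ :=
  ((Real.sqrt (w ‖ξ‖) / ‖ξ‖ ^ (((n : ℝ) - 2) / 2) : ℝ) : ℂ) *
    (c * (besselJ (besselOrder n 0) ‖ξ‖ : ℂ) +
      ∑ k ∈ s, Y k (‖ξ‖⁻¹ • ξ) * (besselJ (besselOrder n k) ‖ξ‖ : ℂ))

/-- The identity
`|ξ|^{(n-2)/2} w(|ξ|)^{-1/2} ĝ(ξ) = c J_{(n-2)/2}(|ξ|) + ∑_{k ∈ K} Y_k(ξ/|ξ|) J_{(n-2)/2+k}(|ξ|)`.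
The series converges unconditionally in the sense that, after multiplication by
`w(|ξ|)^{1/2} |ξ|^{-(n-2)/2}`, it converges to `ĝ` in `L²(ℝⁿ)`; if `K` is finite, this says that the
identity holds for almost every `ξ`. -/
def HasBesselExpansion {n : ℕ} (w : ℝ → ℝ) (K : Set ℕ) (g : L2Space n) (c : ℂ)
    (Y : ℕ → Rn n → ℂ) : Prop :=
  Tendsto
    (fun s : Finset K =>
      eLpNorm (fun ξ => fourierL2 g ξ -
        besselExpansion w c Y (s.map (Function.Embedding.subtype _)) ξ) 2 volume)
    atTop (𝓝 0)

end

/-!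
The operator `S = ℛ ∘ w(√-Δ)^{1/2}` is, after a Fourier transform, the adjoint of the extension
operator `T f = w(|ξ|)^{1/2} f̂(ξ)`, where `f̂` is the Fourier transform of the measure `f dσ` on the
sphere. Bochner's formula (`sphereFT_harmonic`) says that `T` maps a spherical harmonic `Y` of degree
`k` to a multiple of `w(|ξ|)^{1/2} |ξ|^{-(n-2)/2} J_{k+(n-2)/2}(|ξ|) Y(ξ/|ξ|)`. Hence `S S†` is diagonal
in spherical harmonics, with eigenvalue `λ_k` in degree `k` (`sphereTrace_adjoint`). The space `L²(ℝⁿ)`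
is then the orthogonal sum of `ker S` and of the finite-dimensional spaces `S† H_k`, on which `S† S` acts
by `λ_k`, and everything in the theorem is read off this decomposition once it is known that
`λ_k < λ₀` for all `k ≥ 1`: the extremisers are the nonzero elements of `S† H_0`, the distance to them
is the norm of the component orthogonal to `S† H_0`, and the deficit is `∑ (λ₀ - μ) ‖g_μ‖²` over the
eigencomponents (`stability_of_eigen`).

The analytic input is the positivity of `ŵ` away from the origin, used through kernels which vanish on
the diagonal of the product of two spheres. For a function `F` on this product,
`∬ F(θ, θ') ŵ(θ - θ') = ∫ w(|ξ|) F̂(ξ) dξ`, up to a regularization: smoothing `ŵ` at scale `ε` keeps it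
nonnegative beyond a fixed multiple of `ε` from the origin, while near the origin it is bounded by a
power of `ε⁻¹`, which the vanishing of `F` compensates.

* Finiteness (`exists_integrableOn_weight_mul_energy`). With `F = (1 - ⟨θ, θ'⟩)^M`, `M` large, the left
  side is bounded below. In the binomial expansion the odd powers contribute negatively to `F̂`, the
  first one exactly `-M g₁²`, where `g_k(r) = (2π)^{n/2} r^{-(n-2)/2} J_{k+(n-2)/2}(r)`; the even powers are
  dominated by `g₀²` up to lower order terms, because `J_{ν+k}` is asymptotically comparable to `J_ν` for
  even `k`. So `λ₀ < ∞` implies that `w (g₀² + g₁²)` is integrable at infinity. Since `g₀² + g₁²` controls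
  every `g_k²` and is bounded below by a multiple of `r^{-(n-1)}`, all `λ_k` are finite and
  `w (1 + |ξ|)^{-(n-1)}` is integrable.
* Strictness (`lambdaCoeff_lt_lambdaCoeff_zero`). With `F = |Y(θ) - Y(θ')|²`, `Y` of degree `k`, the right
  side is `2 (2π)^n (λ₀ - λ_k) ‖Y‖²`. The integrability just obtained is exactly what makes the
  contribution of the diagonal vanish in the limit. If `λ_k ≥ λ₀`, Fatou's lemma and Lebesgue
  differentiation force `Y` to be constant, which it is not.

The supremum defining `λ_*` need not be attained, and all of `ker S` has eigenvalue `0 < λ_*`. So equality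
in the stability inequality means that only the components of degree `0` and of degrees in `𝒦(w)` are
present.
-/


noncomputable section

/-! ### Bessel functions -/

/-- The entire function `H_ν(s) = ∑ (-s)^m / (m! Γ(m + ν + 1))`, so that
`J_ν(r) = (r / 2)^ν H_ν(r² / 4)`. -/
def besselEntire (ν s : ℝ) : ℝ :=
  ∑' m : ℕ, (-s) ^ m / ((m.factorial : ℝ) * Real.Gamma (m + ν + 1))

lemma gamma_le_gamma_nat_add {ν : ℝ} (hν : 0 ≤ ν) (m : ℕ) :
    Real.Gamma (ν + 1) ≤ Real.Gamma (m + ν + 1) := by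
  induction m with
  | zero => simp
  | succ m ih =>
    have h : ((m + 1 : ℕ) : ℝ) + ν + 1 = (m + ν + 1) + 1 := by push_cast; ring
    rw [h, Real.Gamma_add_one (s := m + ν + 1) (by positivity)]
    have hpos : 0 < Real.Gamma (m + ν + 1) := Real.Gamma_pos_of_pos (by positivity)
    have h1 : (1 : ℝ) ≤ m + ν + 1 := by have : (0 : ℝ) ≤ m := m.cast_nonneg; linarith
    nlinarith

lemma summable_besselEntire {ν : ℝ} (hν : 0 ≤ ν) (s : ℝ) :
    Summable fun m : ℕ => (-s) ^ m / ((m.factorial : ℝ) * Real.Gamma (m + ν + 1)) := by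
  have hG : 0 < Real.Gamma (ν + 1) := Real.Gamma_pos_of_pos (by positivity)
  refine Summable.of_norm_bounded
    (g := fun m : ℕ => (|s| ^ m / m.factorial) * (Real.Gamma (ν + 1))⁻¹)
    ((Real.summable_pow_div_factorial |s|).mul_right _) fun m => ?_
  have h := gamma_le_gamma_nat_add hν m
  rw [norm_div, norm_pow, norm_neg, Real.norm_eq_abs, norm_mul, Real.norm_natCast,
    Real.norm_of_nonneg (hG.le.trans h), div_mul_eq_div_div, ← div_eq_mul_inv]
  gcongr

lemma hasDerivAt_besselEntire {ν : ℝ} (hν : 0 ≤ ν) (s : ℝ) :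
    HasDerivAt (besselEntire ν) (-besselEntire (ν + 1) s) s := by
  have hG : 0 < Real.Gamma (ν + 1) := Real.Gamma_pos_of_pos (by positivity)
  set R := |s| + 1
  have hR : 0 < R := by positivity
  let g' : ℕ → ℝ → ℝ := fun m y =>
    (m * (-y) ^ (m - 1) * (-1)) / ((m.factorial : ℝ) * Real.Gamma (m + ν + 1))
  let u : ℕ → ℝ := fun m => (m * R ^ (m - 1) / m.factorial) * (Real.Gamma (ν + 1))⁻¹
  have hu : Summable u := by
    refine Summable.mul_right _ ?_
    rw [← summable_nat_add_iff 1]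
    refine (Real.summable_pow_div_factorial R).congr fun m => ?_
    rw [Nat.factorial_succ]
    push_cast
    field_simp
  have key := hasDerivAt_tsum_of_isPreconnected (𝕜 := ℝ) (u := u)
    (g := fun (m : ℕ) (y : ℝ) => (-y) ^ m / ((m.factorial : ℝ) * Real.Gamma (m + ν + 1)))
    (g' := g') (t := Metric.ball 0 R) (y₀ := 0) (y := s) hu Metric.isOpen_ball
    (convex_ball (0 : ℝ) R).isPreconnected
    (fun m y _ => by
      have h1 : HasDerivAt (fun y : ℝ => -y) (-1) y := (hasDerivAt_id y).neg
      exact (h1.pow m).div_const _)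
    (fun m y hy => by
      have h := gamma_le_gamma_nat_add hν m
      have hy' : |y| ≤ R := by
        rw [Metric.mem_ball, dist_zero_right, Real.norm_eq_abs] at hy
        exact hy.le
      simp only [g', u]
      rw [norm_div, norm_mul, norm_mul, norm_pow, norm_neg, Real.norm_eq_abs y, norm_mul,
        Real.norm_natCast, Real.norm_natCast, norm_neg, norm_one, mul_one,
        Real.norm_of_nonneg (hG.le.trans h), div_mul_eq_div_div, ← div_eq_mul_inv]
      gcongr)
    (by simpa using hR) (summable_besselEntire hν 0)
    (by simp [R])
  have h2 : ∑' m, g' m s = -besselEntire (ν + 1) s := by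
    have hs : Summable fun m => g' m s := by
      refine Summable.of_norm_bounded hu fun m => ?_
      have h := gamma_le_gamma_nat_add hν m
      have hy' : |s| ≤ R := by simp [R]
      simp only [g', u]
      rw [norm_div, norm_mul, norm_mul, norm_pow, norm_neg, Real.norm_eq_abs s, norm_mul,
        Real.norm_natCast, Real.norm_natCast, norm_neg, norm_one, mul_one,
        Real.norm_of_nonneg (hG.le.trans h), div_mul_eq_div_div, ← div_eq_mul_inv]
      gcongr
    rw [hs.tsum_eq_zero_add, besselEntire, ← tsum_neg]
    simp only [g', Nat.cast_zero, zero_mul, zero_div, zero_add]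
    refine tsum_congr fun m => ?_
    rw [Nat.factorial_succ]
    have e : ((m + 1 : ℕ) : ℝ) + ν + 1 = m + (ν + 1) + 1 := by push_cast; ring
    rw [e]
    push_cast
    have : Real.Gamma (m + (ν + 1) + 1) ≠ 0 := (Real.Gamma_pos_of_pos (by positivity)).ne'
    field_simp
  rw [← h2]
  exact key

lemma besselEntire_recurrence {ν : ℝ} (hν : 0 ≤ ν) (s : ℝ) :
    besselEntire ν s + s * besselEntire (ν + 2) s = (ν + 1) * besselEntire (ν + 1) s := by
  have h0 := summable_besselEntire hν s
  have h1 := summable_besselEntire (ν := ν + 1) (by linarith) s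
  have h2 := summable_besselEntire (ν := ν + 2) (by linarith) s
  let b : ℕ → ℝ := fun m => -(m * ((-s) ^ m / ((m.factorial : ℝ) * Real.Gamma (m + (ν + 1) + 1))))
  have hb : ∀ m, b (m + 1) =
      s * ((-s) ^ m / ((m.factorial : ℝ) * Real.Gamma (m + (ν + 2) + 1))) := fun m => by
    have e : ((m + 1 : ℕ) : ℝ) + (ν + 1) + 1 = m + (ν + 2) + 1 := by push_cast; ring
    have : Real.Gamma (m + (ν + 2) + 1) ≠ 0 := (Real.Gamma_pos_of_pos (by positivity)).ne'
    simp only [b]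
    rw [e, Nat.factorial_succ]
    push_cast
    field_simp
    ring
  have hbs : Summable b := by
    rw [← summable_nat_add_iff 1]
    simp_rw [hb]
    exact h2.mul_left s
  have hbt : ∑' m, b m = s * besselEntire (ν + 2) s := by
    rw [hbs.tsum_eq_zero_add]
    simp_rw [hb]
    rw [tsum_mul_left, besselEntire]
    simp [b]
  rw [← hbt, besselEntire, besselEntire, ← h0.tsum_add hbs, ← tsum_mul_left]
  refine tsum_congr fun m => ?_
  have e : (m : ℝ) + (ν + 1) + 1 = (m + ν + 1) + 1 := by ring
  have hp : (m : ℝ) + ν + 1 ≠ 0 := by positivity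
  have : Real.Gamma (m + ν + 1) ≠ 0 := (Real.Gamma_pos_of_pos (by positivity)).ne'
  simp only [b]
  rw [e, Real.Gamma_add_one hp]
  field_simp
  ring

lemma besselEntire_zero_pos {ν : ℝ} (hν : 0 ≤ ν) : 0 < besselEntire ν 0 := by
  have h : besselEntire ν 0 = 1 / Real.Gamma (ν + 1) := by
    rw [besselEntire, tsum_eq_single 0]
    · simp
    · intro m hm
      simp [hm]
  rw [h]
  exact one_div_pos.2 (Real.Gamma_pos_of_pos (by positivity))

lemma continuous_besselEntire {ν : ℝ} (hν : 0 ≤ ν) : Continuous (besselEntire ν) :=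
  continuous_iff_continuousAt.2 fun s => (hasDerivAt_besselEntire hν s).continuousAt

lemma besselJ_eq {ν r : ℝ} (hr : 0 < r) :
    besselJ ν r = (r / 2) ^ ν * besselEntire ν (r ^ 2 / 4) := by
  rw [besselJ, besselEntire, ← tsum_mul_left]
  refine tsum_congr fun m => ?_
  rw [Real.rpow_add (by positivity), mul_comm (2 : ℝ) (m : ℝ), mul_comm (m : ℝ) 2,
    Real.rpow_mul (by positivity), Real.rpow_natCast]
  have : (r / 2) ^ (2 : ℝ) = r ^ 2 / 4 := by
    rw [← Nat.cast_ofNat (R := ℝ), Real.rpow_natCast]; ring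
  rw [this, neg_pow (r ^ 2 / 4)]
  ring

lemma hasDerivAt_besselJ {ν r : ℝ} (hν : 0 ≤ ν) (hr : 0 < r) :
    HasDerivAt (besselJ ν) (ν / r * besselJ ν r - besselJ (ν + 1) r) r := by
  have h1 : HasDerivAt (fun r : ℝ => (r / 2) ^ ν) (1 / 2 * ν * (r / 2) ^ (ν - 1)) r :=
    ((hasDerivAt_id r).div_const 2).rpow_const (Or.inl (by simp [hr.ne']))
  have h2 : HasDerivAt (fun r : ℝ => besselEntire ν (r ^ 2 / 4))
      (-besselEntire (ν + 1) (r ^ 2 / 4) * (r / 2)) r := by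
    have h : HasDerivAt (fun r : ℝ => r ^ 2 / 4) (r / 2) r := by
      refine ((hasDerivAt_pow 2 r).div_const 4).congr_deriv ?_
      norm_num
      ring
    exact HasDerivAt.comp (h := fun r : ℝ => r ^ 2 / 4) r
      (hasDerivAt_besselEntire hν (r ^ 2 / 4)) h
  have h3 := (h1.mul h2).congr_of_eventuallyEq (f₁ := besselJ ν)
    ((eventually_gt_nhds hr).mono fun x hx => besselJ_eq hx)
  refine h3.congr_deriv ?_
  rw [besselJ_eq hr, besselJ_eq hr, Real.rpow_sub_one (by positivity),
    Real.rpow_add_one (by positivity)]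
  field_simp
  ring

lemma besselJ_recurrence {ν r : ℝ} (hν : 0 ≤ ν) (hr : 0 < r) :
    besselJ (ν + 2) r = 2 * (ν + 1) / r * besselJ (ν + 1) r - besselJ ν r := by
  have h := besselEntire_recurrence hν (r ^ 2 / 4)
  have e : (r / 2) ^ (ν + 2) = (r / 2) ^ ν * (r / 2) ^ 2 := by
    rw [Real.rpow_add (by positivity)]
    norm_num
  rw [besselJ_eq hr, besselJ_eq hr, besselJ_eq hr, e,
    Real.rpow_add_one (by positivity)]
  have h' : besselEntire ν (r ^ 2 / 4) = (ν + 1) * besselEntire (ν + 1) (r ^ 2 / 4) -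
    r ^ 2 / 4 * besselEntire (ν + 2) (r ^ 2 / 4) := by linarith
  rw [h']
  field_simp
  ring

lemma hasDerivAt_besselJ_succ {ν r : ℝ} (hν : 0 ≤ ν) (hr : 0 < r) :
    HasDerivAt (besselJ (ν + 1)) (besselJ ν r - (ν + 1) / r * besselJ (ν + 1) r) r := by
  refine (hasDerivAt_besselJ (by linarith : 0 ≤ ν + 1) hr).congr_deriv ?_
  have e : ν + 1 + 1 = ν + 2 := by ring
  rw [e, besselJ_recurrence hν hr]
  ring

/-- `J_ν > 0` on a punctured right neighbourhood of the origin. -/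
lemma exists_besselJ_pos {ν : ℝ} (hν : 0 ≤ ν) : ∃ δ > 0, ∀ r, 0 < r → r < δ → 0 < besselJ ν r := by
  have h1 : Tendsto (fun r : ℝ => besselEntire ν (r ^ 2 / 4)) (𝓝 0) (𝓝 (besselEntire ν 0)) := by
    have hc : Continuous fun r : ℝ => besselEntire ν (r ^ 2 / 4) :=
      (continuous_besselEntire hν).comp (by fun_prop)
    simpa using hc.tendsto 0
  obtain ⟨δ, hδ, h⟩ := Metric.eventually_nhds_iff.1
    (h1.eventually (lt_mem_nhds (besselEntire_zero_pos hν)))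
  refine ⟨δ, hδ, fun r hr hrδ => ?_⟩
  rw [besselJ_eq hr]
  exact mul_pos (Real.rpow_pos_of_pos (by positivity) _)
    (h (by simpa [abs_of_pos hr] using hrδ))

/-- Consecutive Bessel functions have no common zero: `r^{2ν+2} (J_ν² + J_{ν+1}²)` is
nondecreasing. -/
lemma besselJ_sq_add_sq_pos {ν r : ℝ} (hν : 0 ≤ ν) (hr : 0 < r) :
    0 < besselJ ν r ^ 2 + besselJ (ν + 1) r ^ 2 := by
  obtain ⟨δ, hδ, hpos⟩ := exists_besselJ_pos hν
  set f : ℝ → ℝ := fun x => x ^ (2 * ν + 2) * (besselJ ν x ^ 2 + besselJ (ν + 1) x ^ 2)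
  have hd : ∀ x, 0 < x → HasDerivAt f
      ((2 * ν + 2) * x ^ (2 * ν + 2 - 1) * (besselJ ν x ^ 2 + besselJ (ν + 1) x ^ 2) +
        x ^ (2 * ν + 2) * ((2 : ℕ) * besselJ ν x ^ (2 - 1) *
          (ν / x * besselJ ν x - besselJ (ν + 1) x) + (2 : ℕ) * besselJ (ν + 1) x ^ (2 - 1) *
          (besselJ ν x - (ν + 1) / x * besselJ (ν + 1) x))) x := fun x hx =>
    (Real.hasDerivAt_rpow_const (Or.inl hx.ne')).mul
      (((hasDerivAt_besselJ hν hx).pow 2).add ((hasDerivAt_besselJ_succ hν hx).pow 2))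
  have hmono : MonotoneOn f (Set.Ioi 0) := by
    refine monotoneOn_of_deriv_nonneg (convex_Ioi 0)
      (fun x hx => (hd x hx).continuousAt.continuousWithinAt) ?_ ?_
    · rw [interior_Ioi]
      exact fun x hx => (hd x hx).differentiableAt.differentiableWithinAt
    · rw [interior_Ioi]
      intro x hx
      have hx : 0 < x := hx
      rw [(hd x hx).deriv, Real.rpow_sub_one hx.ne']
      have : (2 * ν + 2) * (x ^ (2 * ν + 2) / x) * (besselJ ν x ^ 2 + besselJ (ν + 1) x ^ 2) +
        x ^ (2 * ν + 2) * ((2 : ℕ) * besselJ ν x ^ (2 - 1) *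
          (ν / x * besselJ ν x - besselJ (ν + 1) x) + (2 : ℕ) * besselJ (ν + 1) x ^ (2 - 1) *
          (besselJ ν x - (ν + 1) / x * besselJ (ν + 1) x)) =
          (4 * ν + 2) * (x ^ (2 * ν + 2) / x) * besselJ ν x ^ 2 := by
        push_cast
        field_simp
        ring
      rw [this]
      positivity
  set a := min r (δ / 2)
  have ha : 0 < a := by positivity
  have h1 : 0 < f a := by
    have := hpos a ha ((min_le_right _ _).trans_lt (by linarith))
    have : 0 < a ^ (2 * ν + 2) := Real.rpow_pos_of_pos ha _
    simp only [f]
    positivity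
  have h2 : f a ≤ f r := hmono ha hr (min_le_left _ _)
  have h3 : 0 < r ^ (2 * ν + 2) := Real.rpow_pos_of_pos hr _
  exact pos_of_mul_pos_right (h1.trans_le h2) h3.le

/-- The energy `r (J_ν² + J_{ν+1}²)` stays bounded away from zero as `r → ∞`. It is compared with
`E = r (J_ν² + J_{ν+1}²) - (2ν+1) J_ν J_{ν+1}`, for which `E' = (2ν+1) J_ν J_{ν+1} / r` is
`O(E / r²)`. -/
lemma exists_besselJ_energy_lower {ν : ℝ} (hν : 0 ≤ ν) :
    ∃ c > 0, ∃ R > 0, ∀ r, R ≤ r → c ≤ r * (besselJ ν r ^ 2 + besselJ (ν + 1) r ^ 2) := by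
  set a := 2 * ν + 1
  have ha : 0 < a := by positivity
  set E : ℝ → ℝ := fun x => x * (besselJ ν x ^ 2 + besselJ (ν + 1) x ^ 2) -
    a * (besselJ ν x * besselJ (ν + 1) x)
  have hdE : ∀ x, 0 < x → HasDerivAt E (a * (besselJ ν x * besselJ (ν + 1) x) / x) x := by
    intro x hx
    have h1 := hasDerivAt_besselJ hν hx
    have h2 := hasDerivAt_besselJ_succ hν hx
    refine (((hasDerivAt_id x).mul ((h1.pow 2).add (h2.pow 2))).sub
      ((h1.mul h2).const_mul a)).congr_deriv ?_
    simp only [a, id, Pi.add_apply, Pi.pow_apply]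
    push_cast
    field_simp
    ring
  have hEbound : ∀ x, a ≤ x → x / 2 * (besselJ ν x ^ 2 + besselJ (ν + 1) x ^ 2) ≤ E x := by
    intro x hx
    have h := sq_nonneg (besselJ ν x - besselJ (ν + 1) x)
    have h' := mul_nonneg ha.le h
    simp only [E]
    nlinarith [mul_nonneg (sub_nonneg.2 hx)
      (by positivity : 0 ≤ besselJ ν x ^ 2 + besselJ (ν + 1) x ^ 2)]
  have hEup : ∀ x, a ≤ x → E x ≤ 2 * (x * (besselJ ν x ^ 2 + besselJ (ν + 1) x ^ 2)) := by
    intro x hx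
    have h := sq_nonneg (besselJ ν x + besselJ (ν + 1) x)
    have h' := mul_nonneg ha.le h
    simp only [E]
    nlinarith [mul_nonneg (sub_nonneg.2 hx)
      (by positivity : 0 ≤ besselJ ν x ^ 2 + besselJ (ν + 1) x ^ 2)]
  set f : ℝ → ℝ := fun x => E x * Real.exp (-(a * x⁻¹))
  have hdf : ∀ x, 0 < x → HasDerivAt f
      (a * (besselJ ν x * besselJ (ν + 1) x) / x * Real.exp (-(a * x⁻¹)) +
        E x * (Real.exp (-(a * x⁻¹)) * -(a * (-(x ^ 2)⁻¹)))) x := fun x hx =>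
    (hdE x hx).mul (((hasDerivAt_inv hx.ne').const_mul a).neg.exp)
  have hmono : MonotoneOn f (Set.Ici a) := by
    refine monotoneOn_of_deriv_nonneg (convex_Ici a)
      (fun x hx => (hdf x (ha.trans_le hx)).continuousAt.continuousWithinAt) ?_ ?_
    · rw [interior_Ici]
      exact fun x hx => (hdf x (ha.trans hx)).differentiableAt.differentiableWithinAt
    · rw [interior_Ici]
      intro x hx
      have hxa : a < x := hx
      have hx0 : 0 < x := ha.trans hxa
      rw [(hdf x hx0).deriv]
      have e : a * (besselJ ν x * besselJ (ν + 1) x) / x * Real.exp (-(a * x⁻¹)) +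
        E x * (Real.exp (-(a * x⁻¹)) * -(a * (-(x ^ 2)⁻¹))) =
        a * Real.exp (-(a * x⁻¹)) / x ^ 2 * (x * (besselJ ν x * besselJ (ν + 1) x) + E x) := by
        field_simp
      rw [e]
      refine mul_nonneg (by positivity) ?_
      have := hEbound x hxa.le
      nlinarith [mul_nonneg hx0.le (sq_nonneg (besselJ ν x + besselJ (ν + 1) x))]
  have hEa : 0 < E a := lt_of_lt_of_le
    (mul_pos (by positivity) (besselJ_sq_add_sq_pos hν ha)) (hEbound a le_rfl)
  refine ⟨f a / 2, by positivity, a, ha, fun r hr => ?_⟩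
  have h1 : f a ≤ f r := hmono Set.self_mem_Ici hr hr
  have hr0 : 0 < r := ha.trans_le hr
  have hE0 : 0 ≤ E r := le_trans (by positivity) (hEbound r hr)
  have h2 : f r ≤ E r := by
    have : Real.exp (-(a * r⁻¹)) ≤ 1 := Real.exp_le_one_iff.2 (by
      have : 0 < a * r⁻¹ := by positivity
      linarith)
    simp only [f]
    nlinarith
  linarith [hEup r hr]

/-- For `k` of given parity, `J_{ν+k}` agrees with `± J_ν` or `± J_{ν+1}` up to relative
order `1/r`. -/
lemma exists_abs_besselJ_add_le {ν : ℝ} (hν : 0 ≤ ν) (k : ℕ) :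
    ∃ C, 0 ≤ C ∧ ∀ r, 1 ≤ r →
      |besselJ (ν + k) r| ≤ |besselJ (ν + (k % 2 : ℕ)) r| +
        C / r * (|besselJ ν r| + |besselJ (ν + 1) r|) := by
  induction k using Nat.twoStepInduction with
  | zero => exact ⟨0, le_rfl, fun r _ => by simp⟩
  | one => exact ⟨0, le_rfl, fun r _ => by simp⟩
  | more k ih0 ih1 =>
    obtain ⟨C0, hC0, h0⟩ := ih0
    obtain ⟨C1, hC1, h1⟩ := ih1
    refine ⟨C0 + 2 * (ν + k + 1) * (1 + C1), by positivity, fun r hr => ?_⟩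
    have hr0 : 0 < r := by linarith
    have e : ν + (k + 2 : ℕ) = ν + k + 2 := by push_cast; ring
    have e1 : ν + (k + 1 : ℕ) = ν + k + 1 := by push_cast; ring
    rw [e, besselJ_recurrence (by positivity) hr0, Nat.add_mod_right]
    specialize h0 r hr
    specialize h1 r hr
    rw [e1] at h1
    set S := |besselJ ν r| + |besselJ (ν + 1) r|
    have hS : 0 ≤ S := by positivity
    have hp : |besselJ (ν + ((k + 1) % 2 : ℕ)) r| ≤ S := by
      rcases Nat.mod_two_eq_zero_or_one (k + 1) with h | h <;> rw [h] <;> simp [S]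
    have h1' : |besselJ (ν + k + 1) r| ≤ (1 + C1) * S := by
      have : C1 / r * S ≤ C1 * S := by
        gcongr
        exact div_le_self hC1 hr
      linarith
    calc |2 * (ν + k + 1) / r * besselJ (ν + k + 1) r - besselJ (ν + k) r|
        ≤ 2 * (ν + k + 1) / r * |besselJ (ν + k + 1) r| + |besselJ (ν + k) r| := by
          refine (abs_sub _ _).trans ?_
          rw [abs_mul, abs_of_nonneg (by positivity : 0 ≤ 2 * (ν + k + 1) / r)]
      _ ≤ 2 * (ν + k + 1) / r * ((1 + C1) * S) + (|besselJ (ν + (k % 2 : ℕ)) r| + C0 / r * S) := by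
          gcongr
      _ = _ := by ring

lemma exists_besselJ_add_sq_le {ν : ℝ} (hν : 0 ≤ ν) (k : ℕ) :
    ∃ C, 0 ≤ C ∧ ∀ r, 1 ≤ r →
      besselJ (ν + k) r ^ 2 ≤ C * (besselJ ν r ^ 2 + besselJ (ν + 1) r ^ 2) := by
  obtain ⟨C, hC, h⟩ := exists_abs_besselJ_add_le hν k
  refine ⟨2 * (1 + C) ^ 2, by positivity, fun r hr => ?_⟩
  set S := |besselJ ν r| + |besselJ (ν + 1) r|
  have hp : |besselJ (ν + (k % 2 : ℕ)) r| ≤ S := by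
    rcases Nat.mod_two_eq_zero_or_one k with h | h <;> rw [h] <;> simp [S]
  have h1 : |besselJ (ν + k) r| ≤ (1 + C) * S := by
    have h2 : C / r * S ≤ C * S := by
      gcongr
      exact div_le_self hC hr
    linarith [h r hr]
  have h2 : S ^ 2 ≤ 2 * (besselJ ν r ^ 2 + besselJ (ν + 1) r ^ 2) := by
    rw [← sq_abs (besselJ ν r), ← sq_abs (besselJ (ν + 1) r)]
    simp only [S]
    nlinarith [sq_nonneg (|besselJ ν r| - |besselJ (ν + 1) r|)]
  calc besselJ (ν + k) r ^ 2 = |besselJ (ν + k) r| ^ 2 := (sq_abs _).symm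
    _ ≤ ((1 + C) * S) ^ 2 := by gcongr
    _ = (1 + C) ^ 2 * S ^ 2 := by ring
    _ ≤ (1 + C) ^ 2 * (2 * (besselJ ν r ^ 2 + besselJ (ν + 1) r ^ 2)) := by gcongr
    _ = _ := by ring

end

noncomputable section

/-! ### Polar coordinates -/

/-- The surface measure on the unit sphere. -/
abbrev sphereMeasure (n : ℕ) : Measure (UnitSphere n) := (volume : Measure (Rn n)).toSphere

lemma integral_volumeIoiPow (m : ℕ) (φ : ℝ → ℂ) :
    ∫ x : Set.Ioi (0 : ℝ), φ x ∂(Measure.volumeIoiPow m) =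
      ∫ y in Set.Ioi (0 : ℝ), (y : ℂ) ^ m * φ y := by
  simp only [Measure.volumeIoiPow, ENNReal.ofReal]
  rw [integral_withDensity_eq_integral_smul,
    integral_subtype_comap measurableSet_Ioi fun a ↦ Real.toNNReal (a ^ m) • φ a,
    setIntegral_congr_fun measurableSet_Ioi fun x hx ↦ ?_]
  · rw [NNReal.smul_def, Real.coe_toNNReal _ (pow_nonneg hx.out.le _)]
    simp
  · exact (measurable_subtype_coe.pow_const _).real_toNNReal

/-- Polar coordinates for a product of a radial and an angular function. -/
lemma integral_radial_mul_angular {n : ℕ} (hn : 1 ≤ n) (φ : ℝ → ℂ) (Y : Rn n → ℂ) :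
    ∫ x : Rn n, φ ‖x‖ * Y (‖x‖⁻¹ • x) =
      (∫ r in Set.Ioi (0 : ℝ), (r : ℂ) ^ (n - 1) * φ r) *
        ∫ θ : UnitSphere n, Y (θ : Rn n) ∂(sphereMeasure n) := by
  have : Nonempty (Fin n) := ⟨⟨0, hn⟩⟩
  calc ∫ x : Rn n, φ ‖x‖ * Y (‖x‖⁻¹ • x)
      = ∫ x : ({0}ᶜ : Set (Rn n)), φ ‖x.1‖ * Y (‖x.1‖⁻¹ • x.1) ∂(volume.comap Subtype.val) := by
        rw [integral_subtype_comap (measurableSet_singleton _).compl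
          fun x : Rn n ↦ φ ‖x‖ * Y (‖x‖⁻¹ • x), restrict_compl_singleton]
    _ = ∫ z : UnitSphere n × Set.Ioi (0 : ℝ), Y (z.1 : Rn n) * φ z.2
          ∂((sphereMeasure n).prod (.volumeIoiPow (n - 1))) := by
        have h := (volume : Measure (Rn n)).measurePreserving_homeomorphUnitSphereProd.integral_comp
          (Homeomorph.measurableEmbedding _)
          (fun z : UnitSphere n × Set.Ioi (0 : ℝ) => Y (z.1 : Rn n) * φ z.2)
        rw [finrank_euclideanSpace_fin] at h
        rw [← h]
        refine integral_congr_ae (.of_forall fun x => ?_)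
        simp [mul_comm]
    _ = (∫ θ : UnitSphere n, Y (θ : Rn n) ∂(sphereMeasure n)) *
          ∫ r : Set.Ioi (0 : ℝ), φ r ∂(Measure.volumeIoiPow (n - 1)) :=
        integral_prod_mul (fun θ : UnitSphere n => Y (θ : Rn n)) (fun r : Set.Ioi (0 : ℝ) => φ r)
    _ = _ := by rw [integral_volumeIoiPow, mul_comm]

/-! ### Polynomials and the Gaussian integral -/

/-- The value of a complex polynomial at a point of `ℝⁿ`. -/
def polyVal {n : ℕ} (p : MvPolynomial (Fin n) ℂ) (x : Rn n) : ℂ :=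
  MvPolynomial.eval (fun i => (x i : ℂ)) p

section
variable {n : ℕ}
open MvPolynomial

@[simp] lemma polyVal_add (p q : MvPolynomial (Fin n) ℂ) (x : Rn n) :
    polyVal (p + q) x = polyVal p x + polyVal q x := by simp [polyVal]
@[simp] lemma polyVal_mul (p q : MvPolynomial (Fin n) ℂ) (x : Rn n) :
    polyVal (p * q) x = polyVal p x * polyVal q x := by simp [polyVal]
@[simp] lemma polyVal_C (c : ℂ) (x : Rn n) : polyVal (C c) x = c := by simp [polyVal]
@[simp] lemma polyVal_one (x : Rn n) : polyVal (1 : MvPolynomial (Fin n) ℂ) x = 1 := by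
  simp [polyVal]
@[simp] lemma polyVal_X (i : Fin n) (x : Rn n) : polyVal (X i) x = x i := by simp [polyVal]
@[simp] lemma polyVal_smul (c : ℂ) (p : MvPolynomial (Fin n) ℂ) (x : Rn n) :
    polyVal (c • p) x = c * polyVal p x := by simp [polyVal]
@[simp] lemma polyVal_pow (p : MvPolynomial (Fin n) ℂ) (m : ℕ) (x : Rn n) :
    polyVal (p ^ m) x = polyVal p x ^ m := by simp [polyVal]

lemma continuous_polyVal (p : MvPolynomial (Fin n) ℂ) : Continuous (polyVal p) := by
  induction p using MvPolynomial.induction_on with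
  | C a => simpa [funext (polyVal_C a)] using continuous_const
  | add p q hp hq => exact (funext (polyVal_add p q)) ▸ hp.add hq
  | mul_X p i hp =>
    simp_rw [funext (polyVal_mul p (X i)), polyVal_X]
    exact hp.mul (by fun_prop)

lemma contDiff_polyVal (p : MvPolynomial (Fin n) ℂ) : ContDiff ℝ 1 (polyVal p) := by
  induction p using MvPolynomial.induction_on with
  | C a => simpa [funext (polyVal_C a)] using contDiff_const
  | add p q hp hq => exact (funext (polyVal_add p q)) ▸ hp.add hq
  | mul_X p i hp =>
    simp_rw [funext (polyVal_mul p (X i)), polyVal_X]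
    refine hp.mul (Complex.ofRealCLM.contDiff.comp ?_)
    exact (EuclideanSpace.proj (𝕜 := ℝ) i).contDiff

lemma hasLineDerivAt_polyVal (p : MvPolynomial (Fin n) ℂ) (i : Fin n) (x : Rn n) :
    HasLineDerivAt ℝ (polyVal p) (polyVal (pderiv i p) x) x (EuclideanSpace.single i 1) := by
  induction p using MvPolynomial.induction_on with
  | C a =>
    rw [pderiv_C]
    simpa [HasLineDerivAt, polyVal] using hasDerivAt_const (0 : ℝ) a
  | add p q hp hq =>
    rw [map_add, polyVal_add, funext (polyVal_add p q)]
    exact HasDerivAt.add hp hq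
  | mul_X p j hp =>
    have h1 : HasDerivAt (fun t : ℝ => (((x + t • (EuclideanSpace.single i 1 : Rn n)) j : ℝ) : ℂ))
        (polyVal (pderiv i (X j)) x) 0 := by
      have h2 : HasDerivAt (fun t : ℝ => (x + t • (EuclideanSpace.single i 1 : Rn n)) j)
          ((EuclideanSpace.single i 1 : Rn n) j) 0 := by
        simpa using ((hasDerivAt_id (0 : ℝ)).mul_const
          ((EuclideanSpace.single i 1 : Rn n) j)).const_add (x j)
      refine h2.ofReal_comp.congr_deriv ?_
      rw [pderiv_X]
      by_cases hij : i = j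
      · subst hij; simp
      · rw [Pi.single_eq_of_ne (Ne.symm hij)]
        simp [polyVal, Ne.symm hij]
    have h3 := HasDerivAt.mul hp h1
    unfold HasLineDerivAt
    have e : (fun t : ℝ => polyVal (p * X j) (x + t • (EuclideanSpace.single i 1 : Rn n))) =
        (fun t : ℝ => polyVal p (x + t • (EuclideanSpace.single i 1 : Rn n))) *
        fun t : ℝ => (((x + t • (EuclideanSpace.single i 1 : Rn n)) j : ℝ) : ℂ) := by
      ext t; rw [Pi.mul_apply, polyVal_mul, polyVal_X]
    rw [e]
    refine h3.congr_deriv ?_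
    rw [pderiv_mul, polyVal_add, polyVal_mul, polyVal_mul, polyVal_X]
    simp

lemma exists_norm_polyVal_le (p : MvPolynomial (Fin n) ℂ) :
    ∃ C : ℝ, ∃ d : ℕ, 0 ≤ C ∧ ∀ x : Rn n, ‖polyVal p x‖ ≤ C * (1 + ‖x‖) ^ d := by
  induction p using MvPolynomial.induction_on with
  | C a => exact ⟨‖a‖, 0, norm_nonneg _, fun x => by simp⟩
  | add p q hp hq =>
    obtain ⟨C, d, hC, h⟩ := hp
    obtain ⟨C', d', hC', h'⟩ := hq
    refine ⟨C + C', max d d', by positivity, fun x => ?_⟩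
    have h1 : (1 : ℝ) ≤ 1 + ‖x‖ := by linarith [norm_nonneg x]
    rw [polyVal_add]
    refine (norm_add_le _ _).trans ?_
    rw [add_mul]
    refine add_le_add ((h x).trans ?_) ((h' x).trans ?_)
    · gcongr; exact le_max_left _ _
    · gcongr; exact le_max_right _ _
  | mul_X p i hp =>
    obtain ⟨C, d, hC, h⟩ := hp
    refine ⟨C, d + 1, hC, fun x => ?_⟩
    rw [polyVal_mul, polyVal_X, norm_mul, Complex.norm_real, pow_succ, ← mul_assoc]
    have := PiLp.norm_apply_le x i
    gcongr
    · exact h x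
    · linarith

/-- The Gaussian weight `e^{-|x|²/2}`. -/
def gaussWeight (x : Rn n) : ℝ := Real.exp (-‖x‖ ^ 2 / 2)

lemma continuous_gaussWeight : Continuous (gaussWeight (n := n)) := by
  unfold gaussWeight; fun_prop

lemma integrable_polyVal_mul_gaussWeight (p : MvPolynomial (Fin n) ℂ) :
    Integrable fun x : Rn n => polyVal p x * (gaussWeight x : ℂ) := by
  obtain ⟨C, d, hC, h⟩ := exists_norm_polyVal_le p
  have hi := integrable_one_add_norm (E := Rn n) (μ := volume) (r := (n + 1 : ℕ)) (by simp)
  refine (hi.const_mul (C * ((d + (n + 1)).factorial * Real.exp (3 / 2)))).mono'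
    ((continuous_polyVal p).mul
      (Complex.continuous_ofReal.comp continuous_gaussWeight)).aestronglyMeasurable
    (.of_forall fun x => ?_)
  have hx : 0 < 1 + ‖x‖ := by positivity
  have h1 : (1 + ‖x‖) ^ (d + (n + 1)) ≤ (d + (n + 1)).factorial * Real.exp (1 + ‖x‖) := by
    have := Real.pow_div_factorial_le_exp (1 + ‖x‖) hx.le (d + (n + 1))
    rwa [div_le_iff₀' (by positivity)] at this
  have h2 : Real.exp (1 + ‖x‖) * gaussWeight x ≤ Real.exp (3 / 2) := by
    rw [gaussWeight, ← Real.exp_add]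
    gcongr
    nlinarith [sq_nonneg (‖x‖ - 1)]
  have h3 : 0 ≤ gaussWeight x := (Real.exp_pos _).le
  rw [norm_mul, Complex.norm_real, Real.norm_of_nonneg h3, Real.rpow_neg hx.le, Real.rpow_natCast,
    ← div_eq_mul_inv, le_div_iff₀ (by positivity)]
  calc ‖polyVal p x‖ * gaussWeight x * (1 + ‖x‖) ^ (n + 1)
      ≤ C * (1 + ‖x‖) ^ d * gaussWeight x * (1 + ‖x‖) ^ (n + 1) := by gcongr; exact h x
    _ = C * ((1 + ‖x‖) ^ (d + (n + 1)) * gaussWeight x) := by ring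
    _ ≤ C * (((d + (n + 1)).factorial * Real.exp (1 + ‖x‖)) * gaussWeight x) := by gcongr
    _ = C * ((d + (n + 1)).factorial * (Real.exp (1 + ‖x‖) * gaussWeight x)) := by ring
    _ ≤ _ := by gcongr

/-- The Gaussian integral `q ↦ ∫ q(x) e^{-|x|²/2} dx` on polynomials. -/
def gaussInt : MvPolynomial (Fin n) ℂ →ₗ[ℂ] ℂ where
  toFun q := ∫ x : Rn n, polyVal q x * (gaussWeight x : ℂ)
  map_add' p q := by
    rw [← integral_add (integrable_polyVal_mul_gaussWeight p)
      (integrable_polyVal_mul_gaussWeight q)]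
    simp [add_mul]
  map_smul' c p := by
    simp [mul_assoc, integral_const_mul]

lemma hasLineDerivAt_gaussWeight (i : Fin n) (x : Rn n) :
    HasLineDerivAt ℝ (fun x : Rn n => (gaussWeight x : ℂ)) (-(x i) * (gaussWeight x : ℂ)) x
      (EuclideanSpace.single i 1) := by
  have h1 : HasFDerivAt (fun x : Rn n => ‖x‖ ^ 2) (2 • innerSL ℝ x) x :=
    (hasStrictFDerivAt_norm_sq x).hasFDerivAt
  have h2 := h1.hasLineDerivAt (EuclideanSpace.single i 1)
  have h3 : HasDerivAt (fun t : ℝ => ‖x + t • (EuclideanSpace.single i 1 : Rn n)‖ ^ 2)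
      (2 * x i) 0 := by
    refine HasDerivAt.congr_deriv h2 ?_
    simp [EuclideanSpace.inner_single_right]
  have h4 := ((h3.neg.div_const 2).exp).ofReal_comp
  unfold HasLineDerivAt gaussWeight
  refine h4.congr_deriv ?_
  simp
  ring

/-- Gaussian integration by parts. -/
lemma gaussInt_X_mul (i : Fin n) (q : MvPolynomial (Fin n) ℂ) :
    gaussInt (X i * q) = gaussInt (pderiv i q) := by
  have h := integral_bilinear_hasLineDerivAt_right_eq_neg_left_of_integrable
    (μ := (volume : Measure (Rn n))) (f := polyVal q) (f' := polyVal (pderiv i q))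
    (g := fun x => (gaussWeight x : ℂ)) (g' := fun x => -(x i) * (gaussWeight x : ℂ))
    (v := EuclideanSpace.single i 1) (B := ContinuousLinearMap.mul ℝ ℂ)
    (integrable_polyVal_mul_gaussWeight _)
    (by
      refine (integrable_polyVal_mul_gaussWeight (-(X i * q))).congr (.of_forall fun x => ?_)
      simp [polyVal]
      ring)
    (integrable_polyVal_mul_gaussWeight _)
    (fun x _ => hasLineDerivAt_polyVal q i x)
    (fun x _ => hasLineDerivAt_gaussWeight i x)
  simp only [ContinuousLinearMap.mul_apply'] at h
  rw [eq_neg_iff_add_eq_zero, add_comm, ← eq_neg_iff_add_eq_zero, ← integral_neg] at h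
  change ∫ x : Rn n, polyVal (X i * q) x * (gaussWeight x : ℂ) =
    ∫ x : Rn n, polyVal (pderiv i q) x * (gaussWeight x : ℂ)
  rw [h]
  refine integral_congr_ae (.of_forall fun x => ?_)
  simp
  ring

/-- The linear form `∑ aᵢ Xᵢ`. -/
def linForm (a : Fin n → ℂ) : MvPolynomial (Fin n) ℂ := ∑ i, C (a i) * X i

/-- The derivation `∑ aᵢ ∂ᵢ`. -/
def dirDeriv (a : Fin n → ℂ) :
    Derivation ℂ (MvPolynomial (Fin n) ℂ) (MvPolynomial (Fin n) ℂ) := ∑ i, a i • pderiv i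

lemma dirDeriv_apply (a : Fin n → ℂ) (p : MvPolynomial (Fin n) ℂ) :
    dirDeriv a p = ∑ i, a i • pderiv i p := by
  change Derivation.coeFnAddMonoidHom (∑ i, a i • pderiv i) p = _
  rw [map_sum, Finset.sum_apply]
  rfl

lemma gaussInt_linForm_mul (a : Fin n → ℂ) (q : MvPolynomial (Fin n) ℂ) :
    gaussInt (linForm a * q) = gaussInt (dirDeriv a q) := by
  rw [dirDeriv_apply, linForm, Finset.sum_mul, map_sum, map_sum]
  refine Finset.sum_congr rfl fun i _ => ?_
  rw [mul_assoc, C_mul', map_smul, map_smul, gaussInt_X_mul]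

lemma dirDeriv_linForm (a : Fin n → ℂ) : dirDeriv a (linForm a) = C (∑ i, a i ^ 2) := by
  rw [dirDeriv_apply, map_sum]
  refine Finset.sum_congr rfl fun i _ => ?_
  rw [linForm, map_sum, Finset.sum_eq_single i]
  · rw [pderiv_C_mul, pderiv_X_self, smul_eq_C_mul, pow_two, C_mul, mul_one]
  · intro j _ hj
    rw [pderiv_C_mul, pderiv_X_of_ne hj, mul_zero]
  · simp

lemma pderiv_comm (i j : Fin n) (p : MvPolynomial (Fin n) ℂ) :
    pderiv i (pderiv j p) = pderiv j (pderiv i p) := by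
  let D : Fin n → Derivation ℂ (MvPolynomial (Fin n) ℂ) (MvPolynomial (Fin n) ℂ) :=
    fun l => pderiv l
  have h : ⁅D i, D j⁆ = 0 := by
    refine MvPolynomial.derivation_ext fun k => ?_
    simp only [D]
    rw [Derivation.commutator_apply, pderiv_X, pderiv_X]
    by_cases h1 : k = i <;> by_cases h2 : k = j <;> simp [Pi.single_apply, h1, h2] <;>
      split_ifs <;> simp
  have := congrArg (fun D => D p) h
  simpa [D, Derivation.commutator_apply, sub_eq_zero] using this

/-- The Laplacian on polynomials. -/
def polyLap : MvPolynomial (Fin n) ℂ →ₗ[ℂ] MvPolynomial (Fin n) ℂ :=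
  ∑ i, (pderiv i).toLinearMap ∘ₗ (pderiv i).toLinearMap

lemma polyLap_apply (p : MvPolynomial (Fin n) ℂ) :
    polyLap p = ∑ i, pderiv i (pderiv i p) := by
  simp [polyLap]

variable (n) in
/-- Harmonic homogeneous polynomials of degree `k`. -/
def harmonicPoly (k : ℕ) : Submodule ℂ (MvPolynomial (Fin n) ℂ) :=
  homogeneousSubmodule (Fin n) ℂ k ⊓ LinearMap.ker polyLap

lemma mem_harmonicPoly {k : ℕ} {p : MvPolynomial (Fin n) ℂ} :
    p ∈ harmonicPoly n k ↔ p.IsHomogeneous k ∧ polyLap p = 0 := by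
  simp [harmonicPoly]

lemma pderiv_mem_harmonicPoly {k : ℕ} {p : MvPolynomial (Fin n) ℂ} (hp : p ∈ harmonicPoly n k)
    (i : Fin n) : pderiv i p ∈ harmonicPoly n (k - 1) := by
  rw [mem_harmonicPoly] at hp ⊢
  refine ⟨hp.1.pderiv, ?_⟩
  rw [polyLap_apply]
  have : ∀ j, pderiv j (pderiv j (pderiv i p)) = pderiv i (pderiv j (pderiv j p)) := fun j => by
    rw [pderiv_comm j i, pderiv_comm j i]
  simp_rw [this]
  rw [← map_sum, ← polyLap_apply, hp.2, map_zero]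

lemma dirDeriv_mem_harmonicPoly {k : ℕ} {p : MvPolynomial (Fin n) ℂ} (hp : p ∈ harmonicPoly n k)
    (a : Fin n → ℂ) : dirDeriv a p ∈ harmonicPoly n (k - 1) := by
  rw [dirDeriv_apply]
  exact Submodule.sum_mem _ fun i _ => Submodule.smul_mem _ _ (pderiv_mem_harmonicPoly hp i)

lemma eq_C_of_isHomogeneous_zero {p : MvPolynomial (Fin n) ℂ} (hp : p.IsHomogeneous 0) :
    ∃ c, p = C c :=
  ⟨_, totalDegree_eq_zero_iff_eq_C.1 ((totalDegree_zero_iff_isHomogeneous _).2 hp)⟩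

lemma gaussInt_harmonic {k : ℕ} (hk : k ≠ 0) {p : MvPolynomial (Fin n) ℂ}
    (hp : p ∈ harmonicPoly n k) : gaussInt p = 0 := by
  rw [mem_harmonicPoly] at hp
  have h := congrArg gaussInt hp.1.sum_X_mul_pderiv
  rw [map_sum, map_nsmul] at h
  simp_rw [gaussInt_X_mul] at h
  rw [← map_sum, ← polyLap_apply, hp.2, map_zero] at h
  simpa [hk] using h.symm

/-- Under the Gaussian, a harmonic homogeneous polynomial is orthogonal to all homogeneous
polynomials of smaller degree. -/
lemma gaussInt_harmonic_mul {m : ℕ} : ∀ {k : ℕ}, m < k → ∀ {p q : MvPolynomial (Fin n) ℂ},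
    p ∈ harmonicPoly n k → q.IsHomogeneous m → gaussInt (p * q) = 0 := by
  induction m using Nat.strong_induction_on with
  | _ m ih =>
    intro k hk p q hp hq
    rcases Nat.eq_zero_or_pos m with rfl | hm
    · obtain ⟨c, rfl⟩ := eq_C_of_isHomogeneous_zero hq
      rw [mul_comm, C_mul', map_smul, gaussInt_harmonic (by omega) hp, smul_zero]
    · have h := congrArg (fun r => gaussInt (p * r)) hq.sum_X_mul_pderiv
      simp only [Finset.mul_sum, map_sum, mul_smul_comm, map_nsmul] at h
      have h0 : ∀ i, gaussInt (p * (X i * pderiv i q)) = 0 := fun i => by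
        rw [mul_left_comm, gaussInt_X_mul, pderiv_mul, map_add]
        rw [ih (m - 1) (by omega) (k := k - 1) (by omega) (pderiv_mem_harmonicPoly hp i) hq.pderiv,
          ih (m - 1 - 1) (by omega) (k := k) (by omega) hp hq.pderiv.pderiv, add_zero]
      simp_rw [h0] at h
      simpa [hm.ne'] using h.symm

/-- The moments `∫ p(x) (a·x)^m e^{-|x|²/2} dx` of a harmonic homogeneous polynomial `p` of degree
`k`. -/
lemma gaussInt_harmonic_mul_linForm_pow (a : Fin n → ℂ) (m : ℕ) :
    ∀ {k : ℕ} {p : MvPolynomial (Fin n) ℂ}, p ∈ harmonicPoly n k →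
      (∀ j, m = k + 2 * j → gaussInt (p * linForm a ^ m) =
        (m.factorial : ℂ) / (2 ^ j * j.factorial) * (∑ i, a i ^ 2) ^ j * eval a p *
          gaussInt (1 : MvPolynomial (Fin n) ℂ)) ∧
      ((∀ j, m ≠ k + 2 * j) → gaussInt (p * linForm a ^ m) = 0) := by
  induction m using Nat.strong_induction_on with
  | _ m ih =>
    intro k p hp
    rcases m with _ | m
    · rw [pow_zero, mul_one]
      rcases Nat.eq_zero_or_pos k with rfl | hk
      · obtain ⟨c, rfl⟩ := eq_C_of_isHomogeneous_zero (mem_harmonicPoly.1 hp).1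
        refine ⟨fun j hj => ?_, fun h => absurd rfl (h 0)⟩
        have : j = 0 := by omega
        subst this
        rw [← mul_one (C c), C_mul', map_smul]
        simp [smul_eval]
      · rw [gaussInt_harmonic hk.ne' hp]
        exact ⟨fun j hj => by omega, fun _ => rfl⟩
    · have h1 : gaussInt (p * linForm a ^ (m + 1)) = gaussInt (dirDeriv a p * linForm a ^ m) +
          m * (∑ i, a i ^ 2) * gaussInt (p * linForm a ^ (m - 1)) := by
        rw [pow_succ, ← mul_assoc, mul_comm, gaussInt_linForm_mul, Derivation.leibniz,
          Derivation.leibniz_pow, dirDeriv_linForm, map_add, add_comm]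
        congr 1
        · rw [smul_eq_mul, mul_comm]
        · have : p • m • linForm a ^ (m - 1) • C (∑ i, a i ^ 2) =
            ((m : ℂ) * ∑ i, a i ^ 2) • (p * linForm a ^ (m - 1)) := by
            simp only [smul_eq_mul, smul_eq_C_mul, nsmul_eq_mul, C_mul]
            rw [← C_eq_coe_nat]
            simp only [map_natCast]
            ring
          rw [this, map_smul, smul_eq_mul]
      have hD := dirDeriv_mem_harmonicPoly hp a
      have hev : eval a (dirDeriv a p) = k * eval a p := by
        have := congrArg (eval a) (mem_harmonicPoly.1 hp).1.sum_X_mul_pderiv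
        simpa [dirDeriv_apply, smul_eval] using this
      have hfac : (((m + 1).factorial : ℕ) : ℂ) = (m + 1) * m.factorial := by
        rw [Nat.factorial_succ]; push_cast; ring
      have hfac' : 1 ≤ m → ((m.factorial : ℕ) : ℂ) = m * (m - 1).factorial := fun hm => by
        rw [← Nat.mul_factorial_pred (by omega)]; push_cast; ring
      obtain ⟨iD1, iD2⟩ := ih m (by omega) hD
      rw [h1]
      have hD0 : k = 0 → dirDeriv a p = 0 := by
        rintro rfl
        obtain ⟨c, rfl⟩ := eq_C_of_isHomogeneous_zero (mem_harmonicPoly.1 hp).1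
        simp
      constructor
      · intro j hj
        rcases Nat.eq_zero_or_pos j with rfl | hj0
        · have hk : k = m + 1 := by omega
          rw [iD1 0 (by omega), hev]
          have h2 : (m : ℂ) * (∑ i, a i ^ 2) * gaussInt (p * linForm a ^ (m - 1)) = 0 := by
            rcases Nat.eq_zero_or_pos m with rfl | hm
            · simp
            · rw [(ih (m - 1) (by omega) hp).2 (fun j => by omega), mul_zero]
          rw [h2, hfac, hk]
          push_cast
          ring
        · obtain ⟨j, rfl⟩ : ∃ j', j = j' + 1 := ⟨j - 1, by omega⟩
          have hm : 1 ≤ m := by omega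
          rw [(ih (m - 1) (by omega) hp).1 j (by omega)]
          have hmc : (m : ℂ) + 1 = k + 2 * (j + 1) := by exact_mod_cast hj
          have hj1 : (((j + 1).factorial : ℕ) : ℂ) = (j + 1) * j.factorial := by
            rw [Nat.factorial_succ]; push_cast; ring
          have hjne : (j.factorial : ℂ) ≠ 0 := by exact_mod_cast j.factorial_ne_zero
          have hjne' : (j : ℂ) + 1 ≠ 0 := by exact_mod_cast j.succ_ne_zero
          have hterm : gaussInt (dirDeriv a p * linForm a ^ m) = k * ((m.factorial : ℂ) /
              (2 ^ (j + 1) * (j + 1).factorial) * (∑ i, a i ^ 2) ^ (j + 1) * eval a p *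
                gaussInt (1 : MvPolynomial (Fin n) ℂ)) := by
            rcases Nat.eq_zero_or_pos k with hk | hk
            · rw [hD0 hk, hk]; simp
            · rw [iD1 (j + 1) (by omega), hev]; ring
          rw [hterm, hfac, hmc, hj1, hfac' hm]
          field_simp
          ring
      · intro h
        have h2 : gaussInt (dirDeriv a p * linForm a ^ m) = 0 := by
          rcases Nat.eq_zero_or_pos k with hk | hk
          · rw [hD0 hk]; simp
          · exact iD2 fun j => by have := h j; omega
        have h3 : (m : ℂ) * (∑ i, a i ^ 2) * gaussInt (p * linForm a ^ (m - 1)) = 0 := by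
          rcases Nat.eq_zero_or_pos m with rfl | hm
          · simp
          · rw [(ih (m - 1) (by omega) hp).2 (fun j => by have := h (j + 1); omega), mul_zero]
        rw [h2, h3, add_zero]

end

end

noncomputable section

section
variable {n : ℕ}
open MvPolynomial

lemma polyVal_real_smul {d : ℕ} {q : MvPolynomial (Fin n) ℂ} (hq : q.IsHomogeneous d) (c : ℝ)
    (x : Rn n) : polyVal q (c • x) = (c : ℂ) ^ d * polyVal q x := by
  rw [polyVal, polyVal, eval_eq, eval_eq, Finset.mul_sum]
  refine Finset.sum_congr rfl fun m hm => ?_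
  have hd : m.degree = d := by
    by_contra h
    exact (mem_support_iff.1 hm) (hq.coeff_eq_zero h)
  have : ∏ i ∈ m.support, (((c • x) i : ℝ) : ℂ) ^ m i =
      (c : ℂ) ^ d * ∏ i ∈ m.support, ((x i : ℝ) : ℂ) ^ m i := by
    rw [← hd, Finsupp.degree_apply, ← Finset.prod_pow_eq_pow_sum, ← Finset.prod_mul_distrib]
    refine Finset.prod_congr rfl fun i _ => ?_
    simp [mul_pow]
  rw [this]
  ring

lemma polyVal_eq_norm_pow_mul {d : ℕ} {q : MvPolynomial (Fin n) ℂ} (hq : q.IsHomogeneous d)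
    (x : Rn n) : polyVal q x = (‖x‖ : ℂ) ^ d * polyVal q (‖x‖⁻¹ • x) := by
  rw [← polyVal_real_smul hq, smul_smul]
  rcases eq_or_ne x 0 with rfl | hx
  · simp
  · rw [mul_inv_cancel₀ (norm_ne_zero_iff.2 hx), one_smul]

/-- The radial integral `∫₀^∞ r^{d+n-1} e^{-r²/2} dr = 2^{(d+n)/2-1} Γ((d+n)/2)`. -/
def radialGauss (n d : ℕ) : ℝ := 2 ^ (((d + n : ℕ) : ℝ) / 2 - 1) * Real.Gamma (((d + n : ℕ) : ℝ) / 2)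

lemma radialGauss_pos (hn : 1 ≤ n) (d : ℕ) : 0 < radialGauss n d :=
  mul_pos (Real.rpow_pos_of_pos two_pos _) (Real.Gamma_pos_of_pos (by
    have : (1 : ℝ) ≤ (d + n : ℕ) := by exact_mod_cast hn.trans (Nat.le_add_left n d)
    positivity))

lemma integral_radialGauss (hn : 1 ≤ n) (d : ℕ) :
    ∫ r in Set.Ioi (0 : ℝ), r ^ (n - 1) * (r ^ d * Real.exp (-r ^ 2 / 2)) = radialGauss n d := by
  have h := integral_rpow_mul_exp_neg_mul_rpow (p := 2) (q := ((d + n : ℕ) : ℝ) - 1) (b := 1 / 2)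
    (by norm_num) (by
      have : (1 : ℝ) ≤ (d + n : ℕ) := by exact_mod_cast hn.trans (Nat.le_add_left n d)
      linarith) (by norm_num)
  have e1 : radialGauss n d = (1 / 2 : ℝ) ^ (-(((d + n : ℕ) : ℝ) - 1 + 1) / 2) * (1 / 2) *
      Real.Gamma ((((d + n : ℕ) : ℝ) - 1 + 1) / 2) := by
    rw [radialGauss, sub_add_cancel, Real.rpow_sub_one two_ne_zero, neg_div, one_div,
      Real.inv_rpow two_pos.le, Real.rpow_neg two_pos.le, inv_inv]
    ring
  rw [e1, ← h]
  refine setIntegral_congr_fun measurableSet_Ioi fun r hr => ?_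
  have e : ((d + n : ℕ) : ℝ) - 1 = ((n - 1 + d : ℕ) : ℝ) := by
    rw [Nat.cast_add (n - 1) d, Nat.cast_sub hn]; push_cast; ring
  rw [e, Real.rpow_natCast, pow_add, Real.rpow_two, mul_assoc]
  congr 3
  ring

/-- Polar coordinates turn Gaussian integrals of homogeneous polynomials into integrals over the
sphere. -/
lemma gaussInt_eq_radialGauss_mul (hn : 1 ≤ n) {d : ℕ} {q : MvPolynomial (Fin n) ℂ}
    (hq : q.IsHomogeneous d) :
    gaussInt q = radialGauss n d * ∫ θ : UnitSphere n, polyVal q (θ : Rn n) ∂(sphereMeasure n) := by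
  have h := integral_radial_mul_angular hn
    (fun r => (r : ℂ) ^ d * (Real.exp (-r ^ 2 / 2) : ℂ)) (polyVal q)
  have e : (∫ r in Set.Ioi (0 : ℝ), (r : ℂ) ^ (n - 1) * ((r : ℂ) ^ d *
      (Real.exp (-r ^ 2 / 2) : ℂ))) = radialGauss n d := by
    rw [← integral_radialGauss hn, ← integral_complex_ofReal]
    push_cast
    rfl
  rw [e] at h
  rw [← h]
  change ∫ x : Rn n, polyVal q x * (gaussWeight x : ℂ) = _
  refine integral_congr_ae (.of_forall fun x => ?_)
  simp only [gaussWeight]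
  rw [polyVal_eq_norm_pow_mul hq]
  push_cast
  ring

lemma gaussInt_one : gaussInt (1 : MvPolynomial (Fin n) ℂ) = ((2 * Real.pi) ^ ((n : ℝ) / 2) : ℝ) := by
  have h := GaussianFourier.integral_rexp_neg_mul_sq_norm (V := Rn n) (b := 1 / 2) (by norm_num)
  rw [finrank_euclideanSpace_fin] at h
  have e : Real.pi / (1 / 2) = 2 * Real.pi := by ring
  rw [e] at h
  rw [← h, ← integral_complex_ofReal]
  change ∫ x : Rn n, polyVal 1 x * (gaussWeight x : ℂ) = _
  refine integral_congr_ae (.of_forall fun x => ?_)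
  simp only [gaussWeight, polyVal_one, one_mul]
  congr 2
  ring

lemma polyVal_linForm (ξ x : Rn n) :
    polyVal (linForm fun i => (ξ i : ℂ)) x = ((inner ℝ x ξ : ℝ) : ℂ) := by
  simp [polyVal, linForm, PiLp.inner_apply]

lemma isHomogeneous_linForm (a : Fin n → ℂ) : (linForm a).IsHomogeneous 1 :=
  IsHomogeneous.sum _ _ _ fun i _ => by simpa using isHomogeneous_C_mul_X (a i) i

lemma sum_sq_coord (ξ : Rn n) : ∑ i, (ξ i : ℂ) ^ 2 = (‖ξ‖ : ℂ) ^ 2 := by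
  rw [← Complex.ofReal_pow, EuclideanSpace.norm_sq_eq]
  simp

/-! ### The Fourier transform of spherical harmonics -/

/-- The Fourier transform of the measure `f dσ` on the unit sphere. -/
def sphereFT (f : UnitSphere n → ℂ) (ξ : Rn n) : ℂ :=
  ∫ θ : UnitSphere n, f θ * Complex.exp (-Complex.I * ((inner ℝ (θ : Rn n) ξ : ℝ) : ℂ))
    ∂(sphereMeasure n)

lemma sphere_moment_of_eq (hn : 1 ≤ n) {k : ℕ} {p : MvPolynomial (Fin n) ℂ}
    (hp : p ∈ harmonicPoly n k) (ξ : Rn n) (j : ℕ) :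
    ∫ θ : UnitSphere n, polyVal p (θ : Rn n) * ((inner ℝ (θ : Rn n) ξ : ℝ) : ℂ) ^ (k + 2 * j)
      ∂(sphereMeasure n) = ((k + 2 * j).factorial : ℂ) / (2 ^ j * j.factorial) *
      (‖ξ‖ : ℂ) ^ (2 * j) * polyVal p ξ * ((2 * Real.pi) ^ ((n : ℝ) / 2) : ℝ) /
        radialGauss n (k + (k + 2 * j)) := by
  have h1 := (gaussInt_harmonic_mul_linForm_pow (fun i => (ξ i : ℂ)) (k + 2 * j) hp).1 j rfl
  have h2 := gaussInt_eq_radialGauss_mul hn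
    (((mem_harmonicPoly.1 hp).1).mul ((isHomogeneous_linForm fun i => (ξ i : ℂ)).pow (k + 2 * j)))
  rw [one_mul] at h2
  have hc : (radialGauss n (k + (k + 2 * j)) : ℂ) ≠ 0 := by
    exact_mod_cast (radialGauss_pos hn _).ne'
  rw [h1, sum_sq_coord, gaussInt_one, ← pow_mul] at h2
  rw [eq_div_iff hc, mul_comm]
  simp only [polyVal_mul, polyVal_pow, polyVal_linForm] at h2
  exact h2.symm

lemma sphere_moment_of_ne (hn : 1 ≤ n) {k m : ℕ} {p : MvPolynomial (Fin n) ℂ}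
    (hp : p ∈ harmonicPoly n k) (ξ : Rn n) (hm : ∀ j, m ≠ k + 2 * j) :
    ∫ θ : UnitSphere n, polyVal p (θ : Rn n) * ((inner ℝ (θ : Rn n) ξ : ℝ) : ℂ) ^ m
      ∂(sphereMeasure n) = 0 := by
  have h1 := (gaussInt_harmonic_mul_linForm_pow (fun i => (ξ i : ℂ)) m hp).2 hm
  have h2 := gaussInt_eq_radialGauss_mul hn
    (((mem_harmonicPoly.1 hp).1).mul ((isHomogeneous_linForm fun i => (ξ i : ℂ)).pow m))
  rw [one_mul] at h2
  have hc : (radialGauss n (k + m) : ℂ) ≠ 0 := by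
    exact_mod_cast (radialGauss_pos hn _).ne'
  rw [h1] at h2
  simp only [polyVal_mul, polyVal_pow, polyVal_linForm] at h2
  exact (mul_eq_zero.1 h2.symm).resolve_left hc

lemma continuous_polyVal_sphere (p : MvPolynomial (Fin n) ℂ) :
    Continuous fun θ : UnitSphere n => polyVal p (θ : Rn n) :=
  (continuous_polyVal p).comp continuous_subtype_val

lemma integrable_of_continuous_sphere {f : UnitSphere n → ℂ} (hf : Continuous f) :
    Integrable f (sphereMeasure n) :=
  hf.integrable_of_hasCompactSupport (HasCompactSupport.of_compactSpace f)

lemma besselOrder_nonneg (hn : 2 ≤ n) (k : ℕ) : 0 ≤ besselOrder n k := by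
  have : (2 : ℝ) ≤ n := by exact_mod_cast hn
  have : (0 : ℝ) ≤ k := k.cast_nonneg
  unfold besselOrder
  linarith

lemma radialGauss_eq (k j : ℕ) : radialGauss n (k + (k + 2 * j)) =
    2 ^ (besselOrder n k) * 2 ^ j * Real.Gamma (j + besselOrder n k + 1) := by
  have e : (((k + (k + 2 * j) + n : ℕ) : ℝ)) / 2 = j + besselOrder n k + 1 := by
    unfold besselOrder; push_cast; ring
  rw [radialGauss, e]
  congr 1
  rw [add_sub_cancel_right, Real.rpow_add two_pos, Real.rpow_natCast, mul_comm]

/-- Bochner's formula for the Fourier transform of a spherical harmonic, in terms of an entire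
function. -/
lemma sphereFT_harmonic_entire (hn : 2 ≤ n) {k : ℕ} {p : MvPolynomial (Fin n) ℂ}
    (hp : p ∈ harmonicPoly n k) (ξ : Rn n) :
    sphereFT (fun θ => polyVal p (θ : Rn n)) ξ = (-Complex.I) ^ k *
      ((2 * Real.pi) ^ ((n : ℝ) / 2) * (2 ^ besselOrder n k)⁻¹ *
        besselEntire (besselOrder n k) (‖ξ‖ ^ 2 / 4) : ℝ) * polyVal p ξ := by
  have hn1 : 1 ≤ n := by omega
  have hp0 := continuous_polyVal_sphere p
  have hint : Integrable (fun θ : UnitSphere n => ‖polyVal p (θ : Rn n)‖ * Real.exp ‖ξ‖)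
      (sphereMeasure n) := (integrable_of_continuous_sphere hp0).norm.mul_const _
  have hin : ∀ θ : UnitSphere n, |inner ℝ (θ : Rn n) ξ| ≤ ‖ξ‖ := fun θ => by
    have := abs_real_inner_le_norm (θ : Rn n) ξ
    rwa [norm_eq_of_mem_sphere, one_mul] at this
  have hexp : ∀ x : ℝ, HasSum (fun m : ℕ => x ^ m / m.factorial) (Real.exp x) := fun x => by
    rw [Real.exp_eq_exp_ℝ]; exact NormedSpace.expSeries_div_hasSum_exp x
  have h1 := hasSum_integral_of_dominated_convergence (μ := sphereMeasure n)
    (F := fun (m : ℕ) (θ : UnitSphere n) => polyVal p (θ : Rn n) *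
      ((-Complex.I * ((inner ℝ (θ : Rn n) ξ : ℝ) : ℂ)) ^ m / m.factorial))
    (f := fun θ => polyVal p (θ : Rn n) *
      Complex.exp (-Complex.I * ((inner ℝ (θ : Rn n) ξ : ℝ) : ℂ)))
    (fun m θ => ‖polyVal p (θ : Rn n)‖ * (‖ξ‖ ^ m / m.factorial))
    (fun m => Continuous.aestronglyMeasurable (by fun_prop))
    (fun m => .of_forall fun θ => by
      rw [norm_mul, norm_div, norm_pow, norm_mul, norm_neg, Complex.norm_I, one_mul,
        Complex.norm_real, Complex.norm_natCast, Real.norm_eq_abs]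
      gcongr
      exact hin θ)
    (.of_forall fun θ => (hexp ‖ξ‖).summable.mul_left _)
    (by
      refine hint.congr (.of_forall fun θ => ?_)
      simp only
      rw [tsum_mul_left, (hexp ‖ξ‖).tsum_eq])
    (.of_forall fun θ => by
      refine HasSum.mul_left _ ?_
      rw [Complex.exp_eq_exp_ℂ]
      exact NormedSpace.expSeries_div_hasSum_exp _)
  have hcoef : ∀ m : ℕ, ∫ θ : UnitSphere n, polyVal p (θ : Rn n) *
      ((-Complex.I * ((inner ℝ (θ : Rn n) ξ : ℝ) : ℂ)) ^ m / m.factorial) ∂(sphereMeasure n) =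
      (-Complex.I) ^ m / m.factorial * ∫ θ : UnitSphere n, polyVal p (θ : Rn n) *
        ((inner ℝ (θ : Rn n) ξ : ℝ) : ℂ) ^ m ∂(sphereMeasure n) := fun m => by
    rw [← integral_const_mul]
    refine integral_congr_ae (.of_forall fun θ => ?_)
    simp only [mul_pow]
    ring
  simp_rw [hcoef] at h1
  have hinj : Function.Injective fun j : ℕ => k + 2 * j := fun a b h => by
    simp only at h; omega
  rw [← hinj.hasSum_iff (fun m hm => by
    rw [sphere_moment_of_ne hn1 hp ξ fun j hj => hm ⟨j, hj.symm⟩, mul_zero])] at h1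
  have hν := besselOrder_nonneg hn k
  have h2 : HasSum (fun j : ℕ => ((-(‖ξ‖ ^ 2 / 4)) ^ j /
      ((j.factorial : ℝ) * Real.Gamma (j + besselOrder n k + 1)) : ℝ))
      (besselEntire (besselOrder n k) (‖ξ‖ ^ 2 / 4)) :=
    (summable_besselEntire hν _).hasSum
  have h3 := (Complex.hasSum_ofReal.2 (h2.mul_left
    ((2 * Real.pi) ^ ((n : ℝ) / 2) * (2 ^ besselOrder n k)⁻¹))).mul_left ((-Complex.I) ^ k)
  have h4 := h3.mul_right (polyVal p ξ)
  refine HasSum.unique h1 (h4.congr_fun fun j => ?_)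
  simp only [Function.comp]
  rw [sphere_moment_of_eq hn1 hp, radialGauss_eq]
  have hf : (((k + 2 * j).factorial : ℕ) : ℂ) ≠ 0 := by exact_mod_cast (k + 2 * j).factorial_ne_zero
  have hf' : ((j.factorial : ℕ) : ℂ) ≠ 0 := by exact_mod_cast j.factorial_ne_zero
  have hG : (Real.Gamma (j + besselOrder n k + 1) : ℂ) ≠ 0 := by
    exact_mod_cast (Real.Gamma_pos_of_pos (by positivity)).ne'
  have h2p : (((2 : ℝ) ^ besselOrder n k : ℝ) : ℂ) ≠ 0 := by
    exact_mod_cast (Real.rpow_pos_of_pos two_pos _).ne'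
  have hI : (-Complex.I) ^ (k + 2 * j) = (-Complex.I) ^ k * (-1) ^ j := by
    rw [pow_add, pow_mul, neg_sq, Complex.I_sq]
  have h4 : (-((‖ξ‖ : ℂ) ^ 2 / 4)) ^ j = (-1) ^ j * (‖ξ‖ : ℂ) ^ (2 * j) / (2 ^ j * 2 ^ j) := by
    rw [neg_pow, div_pow, ← pow_mul, ← mul_pow]
    norm_num
    ring
  rw [hI]
  generalize hA : ((2 * Real.pi) ^ ((n : ℝ) / 2) : ℝ) = A
  generalize hB : ((2 : ℝ) ^ besselOrder n k : ℝ) = B at h2p ⊢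
  generalize hC : Real.Gamma (j + besselOrder n k + 1) = G at hG ⊢
  push_cast
  rw [h4]
  field_simp

/-- The profile `(2π)^{n/2} r^{-(n-2)/2} J_{k+(n-2)/2}(r)`. -/
def besselProfile (n k : ℕ) (r : ℝ) : ℝ :=
  (2 * Real.pi) ^ ((n : ℝ) / 2) * (r ^ (((n : ℝ) - 2) / 2))⁻¹ * besselJ (besselOrder n k) r

lemma besselProfile_eq_entire {k : ℕ} {r : ℝ} (hr : 0 < r) :
    besselProfile n k r = (2 * Real.pi) ^ ((n : ℝ) / 2) * (2 ^ besselOrder n k)⁻¹ *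
        besselEntire (besselOrder n k) (r ^ 2 / 4) * r ^ k := by
  rw [besselProfile, besselJ_eq hr, Real.div_rpow hr.le two_pos.le]
  have e : r ^ besselOrder n k = r ^ k * r ^ (((n : ℝ) - 2) / 2) := by
    rw [besselOrder, Real.rpow_add hr, Real.rpow_natCast]
  have : r ^ (((n : ℝ) - 2) / 2) ≠ 0 := (Real.rpow_pos_of_pos hr _).ne'
  rw [e]
  field_simp

/-- Bochner's formula for the Fourier transform of a spherical harmonic. -/
lemma sphereFT_harmonic (hn : 2 ≤ n) {k : ℕ} {p : MvPolynomial (Fin n) ℂ}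
    (hp : p ∈ harmonicPoly n k) {ξ : Rn n} (hξ : ξ ≠ 0) :
    sphereFT (fun θ => polyVal p (θ : Rn n)) ξ = (-Complex.I) ^ k *
      (besselProfile n k ‖ξ‖ : ℂ) * polyVal p (‖ξ‖⁻¹ • ξ) := by
  rw [sphereFT_harmonic_entire hn hp, besselProfile_eq_entire (norm_pos_iff.2 hξ),
    polyVal_eq_norm_pow_mul (mem_harmonicPoly.1 hp).1 ξ]
  push_cast
  ring

end
end

noncomputable section

section
variable {n : ℕ}
open MvPolynomial

/-! ### Decomposition into spherical harmonics -/

/-- The polynomial with conjugate coefficients. -/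
def conjPoly (p : MvPolynomial (Fin n) ℂ) : MvPolynomial (Fin n) ℂ := map (starRingEnd ℂ) p

lemma polyVal_conjPoly (p : MvPolynomial (Fin n) ℂ) (x : Rn n) :
    polyVal (conjPoly p) x = starRingEnd ℂ (polyVal p x) := by
  rw [conjPoly, polyVal, polyVal, eval_map, ← coe_eval₂Hom, ← eval₂_id, eval₂_comp_left]
  simp only [RingHom.comp_id, coe_eval₂Hom]
  congr 1
  ext i
  simp

lemma isHomogeneous_conjPoly {d : ℕ} {p : MvPolynomial (Fin n) ℂ} (hp : p.IsHomogeneous d) :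
    (conjPoly p).IsHomogeneous d := hp.map _

lemma conjPoly_mem_harmonicPoly {k : ℕ} {p : MvPolynomial (Fin n) ℂ} (hp : p ∈ harmonicPoly n k) :
    conjPoly p ∈ harmonicPoly n k := by
  rw [mem_harmonicPoly] at hp ⊢
  refine ⟨isHomogeneous_conjPoly hp.1, ?_⟩
  rw [polyLap_apply]
  simp_rw [conjPoly, pderiv_map]
  rw [← map_sum, ← polyLap_apply, hp.2, map_zero]

lemma integral_harmonic_mul_eq_zero (hn : 1 ≤ n) {k l : ℕ} (hkl : k ≠ l)
    {p q : MvPolynomial (Fin n) ℂ} (hp : p ∈ harmonicPoly n k) (hq : q ∈ harmonicPoly n l) :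
    ∫ θ : UnitSphere n, polyVal p (θ : Rn n) * polyVal q (θ : Rn n) ∂(sphereMeasure n) = 0 := by
  have hp' := (mem_harmonicPoly.1 hp).1
  have hq' := (mem_harmonicPoly.1 hq).1
  have h := gaussInt_eq_radialGauss_mul hn (hp'.mul hq')
  have hc : (radialGauss n (k + l) : ℂ) ≠ 0 := by exact_mod_cast (radialGauss_pos hn _).ne'
  have h0 : gaussInt (p * q) = 0 := by
    rcases lt_or_gt_of_ne hkl with h1 | h1
    · rw [mul_comm]; exact gaussInt_harmonic_mul h1 hq hp'
    · exact gaussInt_harmonic_mul h1 hp hq'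
  rw [h0] at h
  simpa [hc] using h.symm

variable (n) in
/-- The polynomial `|x|²`. -/
def normSqPoly : MvPolynomial (Fin n) ℂ := ∑ i, X i ^ 2

lemma isHomogeneous_normSqPoly : (normSqPoly n).IsHomogeneous 2 :=
  IsHomogeneous.sum _ _ _ fun i _ => isHomogeneous_X_pow i 2

lemma polyVal_normSqPoly (x : Rn n) : polyVal (normSqPoly n) x = (‖x‖ : ℂ) ^ 2 := by
  rw [← sum_sq_coord]
  simp [polyVal, normSqPoly]

lemma normSqPoly_ne_zero (hn : 1 ≤ n) : normSqPoly n ≠ 0 := by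
  intro h
  have := polyVal_normSqPoly (EuclideanSpace.single (⟨0, hn⟩ : Fin n) (1 : ℝ))
  rw [h] at this
  simp [polyVal] at this

lemma eq_zero_of_polyVal_eq_zero {p : MvPolynomial (Fin n) ℂ} (h : ∀ x : Rn n, polyVal p x = 0) :
    p = 0 := by
  refine funext_set (fun _ => Set.range ((↑) : ℝ → ℂ))
    (fun _ => Set.infinite_range_of_injective Complex.ofReal_injective) fun x hx => ?_
  choose y hy using fun i => hx i (Set.mem_univ i)
  have := h (WithLp.toLp 2 y)
  simp only [polyVal, hy] at this
  simpa using this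

/-- The weight `|x|² e^{-|x|²/2}` is positive almost everywhere, so it defines a scalar product on
polynomials. -/
lemma eq_zero_of_gaussInt_normSq_mul (hn : 1 ≤ n) {q : MvPolynomial (Fin n) ℂ}
    (h : gaussInt (normSqPoly n * q * conjPoly q) = 0) : q = 0 := by
  have h1 : ∫ x : Rn n, ‖x‖ ^ 2 * ‖polyVal q x‖ ^ 2 * gaussWeight x = 0 := by
    rw [← Complex.ofReal_eq_zero, ← integral_complex_ofReal, ← h]
    change _ = ∫ x : Rn n, polyVal _ x * (gaussWeight x : ℂ)
    refine integral_congr_ae (.of_forall fun x => ?_)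
    simp only [polyVal_mul, polyVal_conjPoly, polyVal_normSqPoly]
    rw [mul_assoc _ (polyVal q x), Complex.mul_conj']
    push_cast
    rfl
  have hc : Continuous fun x : Rn n => ‖x‖ ^ 2 * ‖polyVal q x‖ ^ 2 * gaussWeight x :=
    ((continuous_norm.pow 2).mul ((continuous_polyVal q).norm.pow 2)).mul continuous_gaussWeight
  have hi : Integrable fun x : Rn n => ‖x‖ ^ 2 * ‖polyVal q x‖ ^ 2 * gaussWeight x := by
    refine (integrable_polyVal_mul_gaussWeight (normSqPoly n * q * conjPoly q)).norm.congr
      (.of_forall fun x => ?_)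
    simp only [polyVal_mul, polyVal_conjPoly, polyVal_normSqPoly]
    rw [mul_assoc _ (polyVal q x), Complex.mul_conj']
    have : 0 ≤ gaussWeight x := (Real.exp_pos _).le
    simp [abs_of_nonneg this]
  have h2 := (integral_eq_zero_iff_of_nonneg (fun x => by
    have : 0 ≤ gaussWeight x := (Real.exp_pos _).le
    positivity) hi).1 h1
  have h3 := (Continuous.ae_eq_iff_eq volume hc continuous_const).1 h2
  have h4 : normSqPoly n * q = 0 := eq_zero_of_polyVal_eq_zero fun x => by
    have h5 : ‖x‖ ^ 2 * ‖polyVal q x‖ ^ 2 * gaussWeight x = 0 := congrFun h3 x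
    have hg : gaussWeight x ≠ 0 := (Real.exp_pos _).ne'
    rw [mul_eq_zero, or_iff_left hg, mul_eq_zero] at h5
    rw [polyVal_mul, polyVal_normSqPoly]
    rcases h5 with h5 | h5
    · rw [← Complex.ofReal_pow, h5]; simp
    · rw [norm_eq_zero.1 (pow_eq_zero_iff two_ne_zero |>.1 h5), mul_zero]
  exact (mul_eq_zero.1 h4).resolve_left (normSqPoly_ne_zero hn)

lemma isHomogeneous_polyLap {m : ℕ} {q : MvPolynomial (Fin n) ℂ} (hq : q.IsHomogeneous (m + 2)) :
    (polyLap q).IsHomogeneous m := by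
  rw [polyLap_apply]
  exact IsHomogeneous.sum _ _ _ fun i _ => hq.pderiv.pderiv

/-- Every homogeneous polynomial of degree `m + 2` is `h + |x|² u` with `h` harmonic: the map
`u ↦ Δ(|x|² u)` is injective, hence bijective, on homogeneous polynomials of degree `m`. -/
lemma exists_harmonic_decomposition (hn : 1 ≤ n) {m : ℕ} {q : MvPolynomial (Fin n) ℂ}
    (hq : q.IsHomogeneous (m + 2)) :
    ∃ u : MvPolynomial (Fin n) ℂ, u.IsHomogeneous m ∧
      q - normSqPoly n * u ∈ harmonicPoly n (m + 2) := by
  have hmul : ∀ u : MvPolynomial (Fin n) ℂ, u.IsHomogeneous m →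
      (normSqPoly n * u).IsHomogeneous (m + 2) := fun u hu => by
    rw [add_comm]; exact isHomogeneous_normSqPoly.mul hu
  let A : homogeneousSubmodule (Fin n) ℂ m →ₗ[ℂ] homogeneousSubmodule (Fin n) ℂ m :=
    LinearMap.restrict (polyLap ∘ₗ LinearMap.mulLeft ℂ (normSqPoly n))
      (fun u hu => isHomogeneous_polyLap (hmul u hu))
  have : Module.Finite ℂ (homogeneousSubmodule (Fin n) ℂ m) :=
    Module.Finite.iff_fg.2 (homogeneousSubmodule_fg _ _ m)
  have hinj : Function.Injective A := by
    rw [← LinearMap.ker_eq_bot, LinearMap.ker_eq_bot']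
    rintro ⟨u, hu⟩ h0
    have h1 : polyLap (normSqPoly n * u) = 0 := congrArg Subtype.val h0
    have h2 : normSqPoly n * u ∈ harmonicPoly n (m + 2) :=
      mem_harmonicPoly.2 ⟨hmul u hu, h1⟩
    have h3 := gaussInt_harmonic_mul (by omega : m < m + 2) h2 (isHomogeneous_conjPoly hu)
    exact Subtype.ext (eq_zero_of_gaussInt_normSq_mul hn h3)
  obtain ⟨⟨u, hu⟩, h⟩ := (LinearMap.injective_iff_surjective.1 hinj)
    ⟨polyLap q, isHomogeneous_polyLap hq⟩
  have h1 : polyLap (normSqPoly n * u) = polyLap q := congrArg Subtype.val h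
  refine ⟨u, hu, mem_harmonicPoly.2 ⟨hq.sub (hmul u hu), ?_⟩⟩
  rw [map_sub, h1, sub_self]

variable (n) in
/-- Restriction of polynomials to the unit sphere. -/
def polySphere : MvPolynomial (Fin n) ℂ →ₐ[ℂ] C(UnitSphere n, ℂ) :=
  aeval fun i => ⟨fun θ => (((θ : Rn n) i : ℝ) : ℂ), by fun_prop⟩

lemma polySphere_apply (p : MvPolynomial (Fin n) ℂ) (θ : UnitSphere n) :
    polySphere n p θ = polyVal p (θ : Rn n) := by
  induction p using MvPolynomial.induction_on with
  | C a => simp [polySphere]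
  | add p q hp hq => simp [hp, hq]
  | mul_X p i hp => rw [map_mul, ContinuousMap.mul_apply, hp, polyVal_mul]; simp [polySphere]

/-- On the sphere, where `|x|² = 1`, iterating the harmonic decomposition gives a sum of spherical
harmonics whose degrees have the parity of `m`. Parity matters: `J_{ν+k}` is asymptotically
comparable to `J_ν` only for even `k`. -/
lemma polySphere_mem_iSup (hn : 1 ≤ n) (m : ℕ) : ∀ {q : MvPolynomial (Fin n) ℂ},
    q.IsHomogeneous m → polySphere n q ∈ ⨆ (k : ℕ) (_ : k ≤ m ∧ k % 2 = m % 2),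
      (harmonicPoly n k).map (polySphere n).toLinearMap := by
  induction m using Nat.twoStepInduction with
  | zero =>
    intro q hq
    obtain ⟨c, rfl⟩ := eq_C_of_isHomogeneous_zero hq
    refine Submodule.mem_iSup_of_mem 0 (Submodule.mem_iSup_of_mem ⟨le_rfl, rfl⟩
      ⟨_, mem_harmonicPoly.2 ⟨hq, ?_⟩, rfl⟩)
    simp [polyLap_apply]
  | one =>
    intro q hq
    refine Submodule.mem_iSup_of_mem 1 (Submodule.mem_iSup_of_mem ⟨le_rfl, rfl⟩
      ⟨_, mem_harmonicPoly.2 ⟨hq, ?_⟩, rfl⟩)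
    rw [polyLap_apply]
    refine Finset.sum_eq_zero fun i _ => ?_
    obtain ⟨c, hc⟩ := eq_C_of_isHomogeneous_zero (hq.pderiv (i := i))
    rw [hc, pderiv_C]
  | more m ih0 _ =>
    intro q hq
    obtain ⟨u, hu, h⟩ := exists_harmonic_decomposition hn hq
    have h1 : polySphere n q = polySphere n (q - normSqPoly n * u) + polySphere n u := by
      ext θ
      rw [ContinuousMap.add_apply, polySphere_apply, polySphere_apply, polySphere_apply,
        ← polyVal_add, polyVal, polyVal, map_add, map_sub, map_mul]
      have : eval (fun i => (((θ : Rn n) i : ℝ) : ℂ)) (normSqPoly n) = 1 := by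
        have := polyVal_normSqPoly (θ : Rn n)
        rw [norm_eq_of_mem_sphere] at this
        simpa [polyVal] using this
      rw [this]
      ring
    rw [h1]
    refine Submodule.add_mem _ ?_ ?_
    · exact Submodule.mem_iSup_of_mem (m + 2) (Submodule.mem_iSup_of_mem ⟨le_rfl, rfl⟩
        ⟨_, h, rfl⟩)
    · refine (iSup₂_mono' fun k hk => ⟨k, ⟨by omega, by omega⟩, le_rfl⟩ :
        (⨆ (k : ℕ) (_ : k ≤ m ∧ k % 2 = m % 2),
          (harmonicPoly n k).map (polySphere n).toLinearMap) ≤ _) (ih0 hu)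

lemma polySphere_mem_iSup_all (hn : 1 ≤ n) (q : MvPolynomial (Fin n) ℂ) :
    polySphere n q ∈ ⨆ k : ℕ, (harmonicPoly n k).map (polySphere n).toLinearMap := by
  rw [← sum_homogeneousComponent q, map_sum]
  refine Submodule.sum_mem _ fun i _ => ?_
  exact (iSup_mono fun k => iSup_le fun _ => le_rfl :
    (⨆ (k : ℕ) (_ : k ≤ i ∧ k % 2 = i % 2),
      (harmonicPoly n k).map (polySphere n).toLinearMap) ≤ _)
    (polySphere_mem_iSup hn i (homogeneousComponent_isHomogeneous i q))

/-- The class in `L²(𝕊ⁿ⁻¹)` of a polynomial. -/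
def polyLp (n : ℕ) : MvPolynomial (Fin n) ℂ →ₗ[ℂ] L2Sphere n :=
  (ContinuousMap.toLp (E := ℂ) 2 (sphereMeasure n) ℂ).toLinearMap ∘ₗ (polySphere n).toLinearMap

lemma polyLp_coe (p : MvPolynomial (Fin n) ℂ) :
    polyLp n p =ᵐ[sphereMeasure n] fun θ => polyVal p (θ : Rn n) := by
  filter_upwards [ContinuousMap.coeFn_toLp (E := ℂ) (p := 2) (𝕜 := ℂ) (sphereMeasure n)
    (polySphere n p)] with θ hθ
  exact hθ.trans (polySphere_apply p θ)

variable (n) in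
/-- The space of spherical harmonics of degree `k`, as a subspace of `L²(𝕊ⁿ⁻¹)`. -/
def harmonicLp (k : ℕ) : Submodule ℂ (L2Sphere n) := (harmonicPoly n k).map (polyLp n)

instance (k : ℕ) : FiniteDimensional ℂ (harmonicLp n k) := by
  have : Module.Finite ℂ (homogeneousSubmodule (Fin n) ℂ k) :=
    Module.Finite.iff_fg.2 (homogeneousSubmodule_fg _ _ k)
  have h : Module.Finite ℂ (harmonicPoly n k) :=
    Module.Finite.of_injective (Submodule.inclusion (inf_le_left :
      harmonicPoly n k ≤ homogeneousSubmodule (Fin n) ℂ k)) (Submodule.inclusion_injective _)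
  exact Module.Finite.map (harmonicPoly n k) (polyLp n)

lemma inner_polyLp (p q : MvPolynomial (Fin n) ℂ) :
    inner ℂ (polyLp n p) (polyLp n q) =
      ∫ θ : UnitSphere n, starRingEnd ℂ (polyVal p (θ : Rn n)) * polyVal q (θ : Rn n)
        ∂(sphereMeasure n) := by
  rw [L2.inner_def]
  refine integral_congr_ae ?_
  filter_upwards [polyLp_coe p, polyLp_coe q] with θ h1 h2
  rw [h1, h2, RCLike.inner_apply, mul_comm]

lemma inner_harmonicLp_eq_zero (hn : 1 ≤ n) {k l : ℕ} (hkl : k ≠ l) {f g : L2Sphere n}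
    (hf : f ∈ harmonicLp n k) (hg : g ∈ harmonicLp n l) : inner ℂ f g = 0 := by
  obtain ⟨p, hp, rfl⟩ := hf
  obtain ⟨q, hq, rfl⟩ := hg
  rw [inner_polyLp]
  simp_rw [← polyVal_conjPoly]
  exact integral_harmonic_mul_eq_zero hn hkl (conjPoly_mem_harmonicPoly hp) hq

lemma topologicalClosure_iSup_harmonicLp (hn : 1 ≤ n) :
    (⨆ k, harmonicLp n k).topologicalClosure = ⊤ := by
  let A : StarSubalgebra ℂ C(UnitSphere n, ℂ) :=
    { (polySphere n).range with
      star_mem' := by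
        rintro _ ⟨p, rfl⟩
        refine ⟨conjPoly p, ?_⟩
        ext θ
        change polySphere n (conjPoly p) θ = _
        rw [polySphere_apply, polyVal_conjPoly]
        change _ = starRingEnd ℂ (polySphere n p θ)
        rw [polySphere_apply] }
  have hA : A.SeparatesPoints := by
    intro θ θ' h
    obtain ⟨i, hi⟩ : ∃ i, (θ : Rn n) i ≠ (θ' : Rn n) i := by
      by_contra hc
      push Not at hc
      exact h (Subtype.ext (PiLp.ext hc))
    refine ⟨_, ⟨polySphere n (X i), ⟨X i, rfl⟩, rfl⟩, ?_⟩
    simp only [polySphere_apply, polyVal_X]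
    exact_mod_cast hi
  have h1 := ContinuousMap.starSubalgebra_topologicalClosure_eq_top_of_separatesPoints A hA
  have h2 : DenseRange (polySphere n) := by
    have h3 : closure (A : Set C(UnitSphere n, ℂ)) = Set.univ := by
      rw [← StarSubalgebra.topologicalClosure_coe, h1]
      rfl
    rw [DenseRange, dense_iff_closure_eq, ← h3]
    rfl
  have h4 : DenseRange (polyLp n) :=
    (ContinuousMap.toLp_denseRange ℂ (sphereMeasure n) ℂ (by norm_num)).comp h2
      (ContinuousLinearMap.continuous _)
  rw [Submodule.eq_top_iff']
  intro f
  have h5 : Set.range (polyLp n) ⊆ (⨆ k, harmonicLp n k : Submodule ℂ (L2Sphere n)) := by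
    rintro _ ⟨q, rfl⟩
    have h6 := Submodule.mem_map_of_mem
      (f := (ContinuousMap.toLp (E := ℂ) 2 (sphereMeasure n) ℂ).toLinearMap)
      (polySphere_mem_iSup_all hn q)
    rw [Submodule.map_iSup] at h6
    simp_rw [← Submodule.map_comp] at h6
    exact h6
  exact closure_mono h5 (h4 f)

end
end

noncomputable section

section
variable {n : ℕ}

/-! ### Smoothing kernels -/

/-- Two points of equal norm are exchanged by a reflection, which preserves Lebesgue measure. -/
lemma fourierInt_radial {f : Rn n → ℂ} (hf : ∀ x y : Rn n, ‖x‖ = ‖y‖ → f x = f y) {ξ η : Rn n}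
    (h : ‖ξ‖ = ‖η‖) : fourierInt f ξ = fourierInt f η := by
  set R := (ℝ ∙ (ξ - η))ᗮ.reflection
  have hR : R ξ = η := Submodule.reflection_sub h
  have h1 := R.measurePreserving.integral_comp R.toHomeomorph.measurableEmbedding
    fun x => f x * Complex.exp (-Complex.I * ((inner ℝ x η : ℝ) : ℂ))
  rw [fourierInt, fourierInt, ← h1]
  refine integral_congr_ae (.of_forall fun x => ?_)
  simp only
  rw [hf (R x) x (R.norm_map x), ← hR, R.inner_map_map]

lemma norm_exp_neg_I_mul (t : ℝ) : ‖Complex.exp (-Complex.I * (t : ℂ))‖ = 1 := by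
  have : -Complex.I * (t : ℂ) = ((-t : ℝ) : ℂ) * Complex.I := by push_cast; ring
  rw [this, Complex.norm_exp_ofReal_mul_I]

lemma integrable_mul_exp {α : Type*} [MeasurableSpace α] {μ : Measure α} {f : α → ℂ}
    (hf : Integrable f μ) {g : α → ℝ} (hg : AEStronglyMeasurable g μ) :
    Integrable (fun x => f x * Complex.exp (-Complex.I * (g x : ℂ))) μ := by
  refine hf.mono (hf.1.mul ?_) (.of_forall fun x => ?_)
  · have : Continuous fun t : ℝ => Complex.exp (-Complex.I * (t : ℂ)) := by fun_prop
    exact this.comp_aestronglyMeasurable hg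
  · rw [norm_mul, norm_exp_neg_I_mul, mul_one]

/-- An unnormalised smooth radial bump supported in the unit ball. -/
def bumpRaw (x : Rn n) : ℝ := Real.smoothTransition (1 - ‖x‖ ^ 2)

lemma contDiff_bumpRaw : ContDiff ℝ (⊤ : ℕ∞) (bumpRaw (n := n)) :=
  Real.smoothTransition.contDiff.comp (contDiff_const.sub (contDiff_norm_sq ℝ))

lemma bumpRaw_nonneg (x : Rn n) : 0 ≤ bumpRaw x := Real.smoothTransition.nonneg _

lemma bumpRaw_eq_zero {x : Rn n} (hx : 1 ≤ ‖x‖) : bumpRaw x = 0 :=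
  Real.smoothTransition.zero_of_nonpos (by nlinarith)

lemma hasCompactSupport_bumpRaw : HasCompactSupport (bumpRaw (n := n)) :=
  HasCompactSupport.intro (isCompact_closedBall 0 1) fun x hx => bumpRaw_eq_zero (by
    rw [Metric.mem_closedBall, dist_zero_right, not_le] at hx; exact hx.le)

lemma integral_bumpRaw_pos : 0 < ∫ x : Rn n, bumpRaw x :=
  contDiff_bumpRaw.continuous.integral_pos_of_hasCompactSupport_nonneg_nonzero (x := 0)
    hasCompactSupport_bumpRaw bumpRaw_nonneg (by simp [bumpRaw])

/-- A smooth radial probability density supported in the unit ball. -/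
def bump (x : Rn n) : ℝ := bumpRaw x / ∫ y : Rn n, bumpRaw y

lemma contDiff_bump : ContDiff ℝ (⊤ : ℕ∞) (bump (n := n)) := contDiff_bumpRaw.div_const _

lemma bump_nonneg (x : Rn n) : 0 ≤ bump x := div_nonneg (bumpRaw_nonneg x) integral_bumpRaw_pos.le

lemma bump_eq_zero {x : Rn n} (hx : 1 ≤ ‖x‖) : bump x = 0 := by
  rw [bump, bumpRaw_eq_zero hx, zero_div]

lemma bump_radial {x y : Rn n} (h : ‖x‖ = ‖y‖) : bump x = bump y := by
  simp only [bump, bumpRaw, h]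

lemma integral_bump : ∫ x : Rn n, bump x = 1 := by
  simp only [bump]
  rw [integral_div, div_self integral_bumpRaw_pos.ne']

lemma exists_bump_le : ∃ C : ℝ, ∀ x : Rn n, bump x ≤ C := by
  refine ⟨1 / ∫ y : Rn n, bumpRaw y, fun x => ?_⟩
  have := integral_bumpRaw_pos (n := n)
  unfold bump
  gcongr
  exact Real.smoothTransition.le_one _

/-- The translated and rescaled bump `ε^{-n} bump((x - x₀) / ε)`. -/
def scaledBump (ε : ℝ) (x₀ x : Rn n) : ℝ := (ε ^ n)⁻¹ * bump (ε⁻¹ • (x - x₀))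

lemma contDiff_scaledBump (ε : ℝ) (x₀ : Rn n) : ContDiff ℝ (⊤ : ℕ∞) (scaledBump ε x₀) :=
  contDiff_const.mul (contDiff_bump.comp (g := bump)
    (f := fun x : Rn n => ε⁻¹ • (x - x₀)) ((contDiff_id.sub contDiff_const).const_smul _))

lemma scaledBump_nonneg {ε : ℝ} (hε : 0 < ε) (x₀ x : Rn n) : 0 ≤ scaledBump ε x₀ x :=
  mul_nonneg (by positivity) (bump_nonneg _)

lemma scaledBump_eq_zero {ε : ℝ} (hε : 0 < ε) {x₀ x : Rn n} (h : x ∉ Metric.closedBall x₀ ε) :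
    scaledBump ε x₀ x = 0 := by
  rw [Metric.mem_closedBall, not_le, dist_eq_norm] at h
  rw [scaledBump, bump_eq_zero, mul_zero]
  rw [norm_smul, norm_inv, Real.norm_of_nonneg hε.le, inv_mul_eq_div, one_le_div hε]
  exact h.le

lemma hasCompactSupport_scaledBump {ε : ℝ} (hε : 0 < ε) (x₀ : Rn n) :
    HasCompactSupport (scaledBump ε x₀) :=
  HasCompactSupport.intro (isCompact_closedBall x₀ ε) fun _ hx => scaledBump_eq_zero hε hx

/-- The Fourier transform of the bump. -/
def bumpFT (ξ : Rn n) : ℂ := fourierInt (fun x => (bump x : ℂ)) ξ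

lemma bumpFT_radial {ξ η : Rn n} (h : ‖ξ‖ = ‖η‖) : bumpFT ξ = bumpFT η :=
  fourierInt_radial (fun _ _ hxy => by rw [bump_radial hxy]) h

lemma fourierInt_scaledBump {ε : ℝ} (hε : 0 < ε) (x₀ ξ : Rn n) :
    fourierInt (fun x => (scaledBump ε x₀ x : ℂ)) ξ =
      Complex.exp (-Complex.I * ((inner ℝ x₀ ξ : ℝ) : ℂ)) * bumpFT (ε • ξ) := by
  set G : Rn n → ℂ := fun y => ((ε ^ n : ℝ) : ℂ)⁻¹ *
    ((bump y : ℂ) * Complex.exp (-Complex.I * ((inner ℝ (x₀ + ε • y) ξ : ℝ) : ℂ)))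
  have h1 : fourierInt (fun x => (scaledBump ε x₀ x : ℂ)) ξ =
      ∫ x : Rn n, G (ε⁻¹ • (x - x₀)) := by
    refine integral_congr_ae (.of_forall fun x => ?_)
    simp only [G, scaledBump]
    rw [smul_smul, mul_inv_cancel₀ hε.ne', one_smul, add_sub_cancel]
    push_cast
    ring
  rw [h1, integral_sub_right_eq_self (fun x => G (ε⁻¹ • x)) x₀,
    Measure.integral_comp_inv_smul_of_nonneg _ _ hε.le, finrank_euclideanSpace_fin]
  simp only [G]
  rw [integral_const_mul, Complex.real_smul, ← mul_assoc, mul_inv_cancel₀, one_mul, bumpFT,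
    fourierInt, ← integral_const_mul]
  · refine integral_congr_ae (.of_forall fun x => ?_)
    simp only
    rw [mul_left_comm, ← Complex.exp_add, inner_add_left, inner_smul_left, inner_smul_right]
    congr 2
    simp
    ring
  · exact_mod_cast (pow_pos hε n).ne'

lemma norm_fourierInt_le (f : Rn n → ℂ) (ξ : Rn n) : ‖fourierInt f ξ‖ ≤ ∫ x, ‖f x‖ := by
  refine (norm_integral_le_integral_norm _).trans_eq ?_
  refine integral_congr_ae (.of_forall fun x => ?_)
  simp only
  rw [norm_mul, norm_exp_neg_I_mul, mul_one]

lemma norm_bumpFT_le (ξ : Rn n) : ‖bumpFT ξ‖ ≤ 1 := by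
  refine (norm_fourierInt_le _ ξ).trans_eq ?_
  rw [← integral_bump (n := n)]
  refine integral_congr_ae (.of_forall fun x => ?_)
  simp [abs_of_nonneg (bump_nonneg x)]

lemma bumpFT_zero : bumpFT (0 : Rn n) = 1 := by
  simp only [bumpFT, fourierInt, inner_zero_right, Complex.ofReal_zero, mul_zero, Complex.exp_zero,
    mul_one]
  rw [integral_complex_ofReal, integral_bump, Complex.ofReal_one]

lemma conj_exp_neg_I_mul (t : ℝ) : starRingEnd ℂ (Complex.exp (-Complex.I * (t : ℂ))) =
    Complex.exp (Complex.I * (t : ℂ)) := by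
  rw [← Complex.exp_conj, map_mul, map_neg, Complex.conj_I, Complex.conj_ofReal, neg_neg]

/-- The Fourier transform of the (even, real) bump is real. -/
lemma bumpFT_eq_re (ξ : Rn n) : bumpFT ξ = ((bumpFT ξ).re : ℂ) := by
  have h1 : starRingEnd ℂ (bumpFT ξ) = bumpFT (-ξ) := by
    rw [bumpFT, fourierInt, ← integral_conj]
    refine integral_congr_ae (.of_forall fun x => ?_)
    simp only
    rw [map_mul, Complex.conj_ofReal, conj_exp_neg_I_mul, inner_neg_right]
    push_cast
    ring_nf
  rw [bumpFT_radial (norm_neg ξ)] at h1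
  exact (Complex.conj_eq_iff_re.1 h1).symm

/-- The bump as a Schwartz function. -/
def bumpSchwartz (ε : ℝ) (hε : 0 < ε) (x₀ : Rn n) : 𝓢(Rn n, ℂ) :=
  HasCompactSupport.toSchwartzMap (f := fun x => (scaledBump ε x₀ x : ℂ))
    ((hasCompactSupport_scaledBump hε x₀).comp_left Complex.ofReal_zero)
    (Complex.ofRealCLM.contDiff.comp (contDiff_scaledBump ε x₀))

lemma bumpSchwartz_apply (ε : ℝ) (hε : 0 < ε) (x₀ x : Rn n) :
    bumpSchwartz ε hε x₀ x = (scaledBump ε x₀ x : ℂ) := rfl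

lemma fourierInt_eq_fourier (f : Rn n → ℂ) (ξ : Rn n) :
    fourierInt f ξ = FourierTransform.fourier f ((2 * Real.pi)⁻¹ • ξ) := by
  rw [fourierInt, Real.fourier_eq']
  refine integral_congr_ae (.of_forall fun x => ?_)
  simp only
  rw [smul_eq_mul, mul_comm, inner_smul_right]
  congr 2
  have : (Real.pi : ℂ) ≠ 0 := by exact_mod_cast Real.pi_ne_zero
  push_cast
  field_simp

lemma bumpFT_eq_fourier (ξ : Rn n) : bumpFT ξ =
    FourierTransform.fourier (bumpSchwartz 1 one_pos (0 : Rn n)) ((2 * Real.pi)⁻¹ • ξ) := by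
  have h := fourierInt_scaledBump one_pos (0 : Rn n) ξ
  rw [inner_zero_left, Complex.ofReal_zero, mul_zero, Complex.exp_zero, one_mul, one_smul] at h
  rw [← h, fourierInt_eq_fourier, SchwartzMap.fourier_coe]
  rfl

lemma continuous_bumpFT : Continuous (bumpFT (n := n)) := by
  rw [funext bumpFT_eq_fourier]
  exact (SchwartzMap.continuous _).comp (continuous_const_smul _)

lemma exists_norm_bumpFT_le (N : ℕ) :
    ∃ C : ℝ, 0 ≤ C ∧ ∀ ξ : Rn n, ‖bumpFT ξ‖ ≤ C * ((1 + ‖ξ‖) ^ N)⁻¹ := by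
  set f := FourierTransform.fourier (bumpSchwartz 1 one_pos (0 : Rn n))
  have h := SchwartzMap.one_add_le_sup_seminorm_apply (𝕜 := ℝ) (m := (N, 0)) le_rfl le_rfl f
  set B := 2 ^ N * ((Finset.Iic (N, 0)).sup fun m => SchwartzMap.seminorm ℝ m.1 m.2) f
  have hB : 0 ≤ B := le_trans (by positivity) (h 0)
  have h2π : 1 ≤ 2 * Real.pi := by linarith [Real.pi_gt_three]
  refine ⟨B * (2 * Real.pi) ^ N, by positivity, fun ξ => ?_⟩
  have h1 := h ((2 * Real.pi)⁻¹ • ξ)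
  rw [norm_iteratedFDeriv_zero] at h1
  rw [bumpFT_eq_fourier, ← div_eq_mul_inv, le_div_iff₀ (by positivity)]
  have h2 : 1 + ‖ξ‖ ≤ 2 * Real.pi * (1 + ‖(2 * Real.pi)⁻¹ • ξ‖) := by
    rw [norm_smul, norm_inv, Real.norm_of_nonneg (by positivity : 0 ≤ 2 * Real.pi), mul_add,
      mul_inv_cancel_left₀ (by positivity)]
    linarith
  calc ‖f ((2 * Real.pi)⁻¹ • ξ)‖ * (1 + ‖ξ‖) ^ N
      ≤ ‖f ((2 * Real.pi)⁻¹ • ξ)‖ * (2 * Real.pi * (1 + ‖(2 * Real.pi)⁻¹ • ξ‖)) ^ N := by gcongr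
    _ = (1 + ‖(2 * Real.pi)⁻¹ • ξ‖) ^ N * ‖f ((2 * Real.pi)⁻¹ • ξ)‖ * (2 * Real.pi) ^ N := by
        rw [mul_pow]; ring
    _ ≤ _ := by gcongr

/-- The weight `w(|ξ|)` multiplied by the Fourier transform of a bump at scale `ε`. -/
def mollWeight (w : ℝ → ℝ) (ε : ℝ) (ξ : Rn n) : ℂ := (w ‖ξ‖ : ℂ) * bumpFT (ε • ξ)

lemma aestronglyMeasurable_weight {w : ℝ → ℝ} {N : ℕ}
    (hw : Integrable (fun ξ : Rn n => w ‖ξ‖ * ((1 + ‖ξ‖) ^ N)⁻¹)) :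
    AEStronglyMeasurable (fun ξ : Rn n => w ‖ξ‖) := by
  have hc : Continuous fun ξ : Rn n => (1 + ‖ξ‖) ^ N := by fun_prop
  refine (hw.1.mul hc.aestronglyMeasurable).congr (.of_forall fun ξ => ?_)
  have : (1 + ‖ξ‖) ^ N ≠ 0 := by positivity
  simp [this]

lemma ae_weight_pos (hn : 1 ≤ n) {w : ℝ → ℝ} (hw : ∀ r : ℝ, 0 < r → 0 < w r) :
    ∀ᵐ ξ : Rn n, 0 < w ‖ξ‖ := by
  have : Nonempty (Fin n) := ⟨⟨0, hn⟩⟩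
  filter_upwards [compl_mem_ae_iff.2 (measure_singleton (0 : Rn n))] with ξ hξ
  exact hw _ (norm_pos_iff.2 hξ)

/-- The mass of the smoothed weight at scale `ε` is `O(ε^{-N})`, where `N` is a growth exponent of the
weight. -/
lemma exists_integral_mollWeight_le (hn : 1 ≤ n) {w : ℝ → ℝ} (hpos : ∀ r : ℝ, 0 < r → 0 < w r)
    {N : ℕ} (hw : Integrable (fun ξ : Rn n => w ‖ξ‖ * ((1 + ‖ξ‖) ^ N)⁻¹)) :
    ∃ C : ℝ, 0 ≤ C ∧ ∀ ε : ℝ, 0 < ε → ε ≤ 1 → Integrable (mollWeight (n := n) w ε) ∧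
      ∫ ξ : Rn n, ‖mollWeight w ε ξ‖ ≤ C * (ε ^ N)⁻¹ := by
  obtain ⟨C, hC, h⟩ := exists_norm_bumpFT_le (n := n) N
  have hmeas := aestronglyMeasurable_weight hw
  have hI : 0 ≤ ∫ ξ : Rn n, w ‖ξ‖ * ((1 + ‖ξ‖) ^ N)⁻¹ := integral_nonneg_of_ae (by
    filter_upwards [ae_weight_pos hn hpos] with ξ hξ
    simp only [Pi.zero_apply]
    positivity)
  refine ⟨C * ∫ ξ : Rn n, w ‖ξ‖ * ((1 + ‖ξ‖) ^ N)⁻¹, mul_nonneg hC hI, fun ε hε hε1 => ?_⟩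
  have hb : ∀ᵐ ξ : Rn n, ‖mollWeight w ε ξ‖ ≤
      C * (ε ^ N)⁻¹ * (w ‖ξ‖ * ((1 + ‖ξ‖) ^ N)⁻¹) := by
    filter_upwards [ae_weight_pos hn hpos] with ξ hξ
    rw [mollWeight, norm_mul, Complex.norm_real, Real.norm_of_nonneg hξ.le]
    have h1 := h (ε • ξ)
    rw [norm_smul, Real.norm_of_nonneg hε.le] at h1
    have h2 : ε * (1 + ‖ξ‖) ≤ 1 + ε * ‖ξ‖ := by linarith
    calc w ‖ξ‖ * ‖bumpFT (ε • ξ)‖ ≤ w ‖ξ‖ * (C * ((ε * (1 + ‖ξ‖)) ^ N)⁻¹) := by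
          gcongr
          refine h1.trans ?_
          gcongr
      _ = _ := by rw [mul_pow, mul_inv]; ring
  have hi : Integrable (mollWeight (n := n) w ε) :=
    (hw.const_mul (C * (ε ^ N)⁻¹)).mono'
      ((Complex.continuous_ofReal.comp_aestronglyMeasurable hmeas).mul
        (continuous_bumpFT.comp (continuous_const_smul ε)).aestronglyMeasurable) hb
  refine ⟨hi, (integral_mono_ae hi.norm (hw.const_mul _) hb).trans_eq ?_⟩
  rw [integral_const_mul]
  ring

lemma mollWeight_radial (w : ℝ → ℝ) (ε : ℝ) {x y : Rn n} (h : ‖x‖ = ‖y‖) :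
    mollWeight w ε x = mollWeight w ε y := by
  have : ‖ε • x‖ = ‖ε • y‖ := by rw [norm_smul, norm_smul, h]
  rw [mollWeight, mollWeight, h, bumpFT_radial this]

/-- The Fourier transform of the smoothed weight is the average of the density `Φ` of `ŵ` over a ball
of radius `ε`, as long as this ball avoids the origin. -/
lemma fourierInt_mollWeight {w : ℝ → ℝ} {Φ : Rn n → ℝ}
    (hΦ : ∀ φ : 𝓢(Rn n, ℂ), HasCompactSupport φ → (0 : Rn n) ∉ tsupport φ →
      ∫ ξ, (w ‖ξ‖ : ℂ) * fourierInt φ ξ = ∫ x, (Φ x : ℂ) * φ x)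
    {ε : ℝ} (hε : 0 < ε) {x₀ : Rn n} (hx₀ : 2 * ε ≤ ‖x₀‖) :
    fourierInt (mollWeight w ε) x₀ = ((∫ x, Φ x * scaledBump ε x₀ x : ℝ) : ℂ) := by
  have h0 : (0 : Rn n) ∉ tsupport (bumpSchwartz ε hε x₀) := by
    have h1 : tsupport (bumpSchwartz ε hε x₀) ⊆ Metric.closedBall x₀ ε := by
      refine closure_minimal (fun x hx => ?_) Metric.isClosed_closedBall
      by_contra h
      exact hx (by rw [bumpSchwartz_apply, scaledBump_eq_zero hε h, Complex.ofReal_zero])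
    intro h2
    have h3 := h1 h2
    rw [Metric.mem_closedBall, dist_zero_left] at h3
    linarith
  have h := hΦ (bumpSchwartz ε hε x₀)
    ((hasCompactSupport_scaledBump hε x₀).comp_left Complex.ofReal_zero) h0
  have e : ∀ ξ, fourierInt (bumpSchwartz ε hε x₀) ξ =
      Complex.exp (-Complex.I * ((inner ℝ x₀ ξ : ℝ) : ℂ)) * bumpFT (ε • ξ) :=
    fun ξ => fourierInt_scaledBump hε x₀ ξ
  simp_rw [e, bumpSchwartz_apply] at h
  rw [← integral_complex_ofReal]
  push_cast
  rw [← h]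
  refine integral_congr_ae (.of_forall fun ξ => ?_)
  simp only [mollWeight]
  rw [real_inner_comm]
  ring

/-- The weight multiplied by the square of the Fourier transform of a bump at scale `ε`. -/
def mollWeightSq (w : ℝ → ℝ) (ε : ℝ) (ξ : Rn n) : ℂ := mollWeight w ε ξ * bumpFT (ε • ξ)

lemma integrable_mollWeightSq {w : ℝ → ℝ} {ε : ℝ} (hi : Integrable (mollWeight (n := n) w ε)) :
    Integrable (mollWeightSq (n := n) w ε) := by
  refine hi.mono (hi.1.mul
    (continuous_bumpFT.comp (continuous_const_smul ε)).aestronglyMeasurable) (.of_forall fun ξ => ?_)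
  rw [mollWeightSq, norm_mul]
  exact mul_le_of_le_one_right (norm_nonneg _) (norm_bumpFT_le _)

lemma norm_mollWeightSq_le (w : ℝ → ℝ) (ε : ℝ) (ξ : Rn n) :
    ‖mollWeightSq w ε ξ‖ ≤ ‖mollWeight w ε ξ‖ := by
  rw [mollWeightSq, norm_mul]
  exact mul_le_of_le_one_right (norm_nonneg _) (norm_bumpFT_le _)

/-- Smoothing twice amounts to averaging the once smoothed transform. -/
lemma fourierInt_mollWeightSq {w : ℝ → ℝ} {ε : ℝ} (hε : 0 < ε)
    (hi : Integrable (mollWeight (n := n) w ε)) (x : Rn n) :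
    fourierInt (mollWeightSq w ε) x =
      ∫ y : Rn n, (scaledBump ε 0 y : ℂ) * fourierInt (mollWeight w ε) (x + y) := by
  have hsb : Integrable fun y : Rn n => (scaledBump ε 0 y : ℂ) :=
    ((contDiff_scaledBump ε 0).continuous.integrable_of_hasCompactSupport
      (hasCompactSupport_scaledBump hε 0)).ofReal
  have h1 : Integrable (Function.uncurry fun (y ξ : Rn n) =>
      ((scaledBump ε 0 y : ℂ) * mollWeight w ε ξ) *
        Complex.exp (-Complex.I * ((inner ℝ ξ (x + y) : ℝ) : ℂ))) (volume.prod volume) := by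
    refine integrable_mul_exp (hsb.mul_prod hi) ?_
    exact Continuous.aestronglyMeasurable (by fun_prop)
  have h2 := integral_integral_swap h1
  have e1 : ∀ y : Rn n, ∫ ξ : Rn n, ((scaledBump ε 0 y : ℂ) * mollWeight w ε ξ) *
        Complex.exp (-Complex.I * ((inner ℝ ξ (x + y) : ℝ) : ℂ)) =
      (scaledBump ε 0 y : ℂ) * fourierInt (mollWeight w ε) (x + y) := fun y => by
    rw [fourierInt, ← integral_const_mul]
    refine integral_congr_ae (.of_forall fun ξ => ?_)
    simp only
    ring
  simp_rw [e1] at h2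
  rw [h2]
  refine integral_congr_ae (.of_forall fun ξ => ?_)
  have h3 := fourierInt_scaledBump hε (0 : Rn n) ξ
  rw [inner_zero_left, Complex.ofReal_zero, mul_zero, Complex.exp_zero, one_mul] at h3
  simp only [mollWeightSq]
  rw [← h3, fourierInt, ← integral_const_mul, ← integral_mul_const]
  refine integral_congr_ae (.of_forall fun y => ?_)
  simp only
  rw [inner_add_right, real_inner_comm y ξ]
  push_cast
  rw [mul_add, Complex.exp_add]
  ring

/-- Away from the origin, smoothing `ŵ` gives a nonnegative function. -/
lemma fourierInt_mollWeight_nonneg {w : ℝ → ℝ} {Φ : Rn n → ℝ} (hΦ0 : ∀ x, x ≠ 0 → 0 < Φ x)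
    (hΦ : ∀ φ : 𝓢(Rn n, ℂ), HasCompactSupport φ → (0 : Rn n) ∉ tsupport φ →
      ∫ ξ, (w ‖ξ‖ : ℂ) * fourierInt φ ξ = ∫ x, (Φ x : ℂ) * φ x)
    {ε : ℝ} (hε : 0 < ε) {x₀ : Rn n} (hx₀ : 2 * ε ≤ ‖x₀‖) :
    ∃ t : ℝ, 0 ≤ t ∧ fourierInt (mollWeight w ε) x₀ = t := by
  refine ⟨_, integral_nonneg fun x => ?_, fourierInt_mollWeight hΦ hε hx₀⟩
  by_cases hx : x ∈ Metric.closedBall x₀ ε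
  · refine mul_nonneg (hΦ0 x ?_).le (scaledBump_nonneg hε _ _)
    rintro rfl
    rw [Metric.mem_closedBall, dist_zero_left] at hx
    linarith
  · simp [scaledBump_eq_zero hε hx]

lemma fourierInt_mollWeightSq_nonneg {w : ℝ → ℝ} {Φ : Rn n → ℝ} (hΦ0 : ∀ x, x ≠ 0 → 0 < Φ x)
    (hΦ : ∀ φ : 𝓢(Rn n, ℂ), HasCompactSupport φ → (0 : Rn n) ∉ tsupport φ →
      ∫ ξ, (w ‖ξ‖ : ℂ) * fourierInt φ ξ = ∫ x, (Φ x : ℂ) * φ x)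
    {ε : ℝ} (hε : 0 < ε) (hi : Integrable (mollWeight (n := n) w ε)) {x₀ : Rn n}
    (hx₀ : 3 * ε ≤ ‖x₀‖) :
    0 ≤ (fourierInt (mollWeightSq w ε) x₀).re := by
  rw [fourierInt_mollWeightSq hε hi]
  have h : ∀ y : Rn n, ∃ t : ℝ, 0 ≤ t ∧
      (scaledBump ε 0 y : ℂ) * fourierInt (mollWeight w ε) (x₀ + y) = t := fun y => by
    by_cases hy : y ∈ Metric.closedBall (0 : Rn n) ε
    · rw [Metric.mem_closedBall, dist_zero_right] at hy
      obtain ⟨t, ht, h⟩ := fourierInt_mollWeight_nonneg hΦ0 hΦ hε (x₀ := x₀ + y) (by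
        have := norm_sub_le (x₀ + y) y
        rw [add_sub_cancel_right] at this
        linarith)
      exact ⟨scaledBump ε 0 y * t, mul_nonneg (scaledBump_nonneg hε _ _) ht, by rw [h]; push_cast; rfl⟩
    · exact ⟨0, le_rfl, by simp [scaledBump_eq_zero hε hy]⟩
  choose t ht h using h
  simp_rw [h]
  rw [integral_complex_ofReal, Complex.ofReal_re]
  exact integral_nonneg ht

end
end

noncomputable section

section
variable {n : ℕ}
open MvPolynomial

/-! ### Bounds for the Bessel profiles -/

lemma besselOrder_eq_zero_add (n k : ℕ) : besselOrder n k = besselOrder n 0 + k := by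
  unfold besselOrder; push_cast; ring

lemma abs_besselProfile {k : ℕ} {r : ℝ} (hr : 0 < r) : |besselProfile n k r| =
    (2 * Real.pi) ^ ((n : ℝ) / 2) * (r ^ (((n : ℝ) - 2) / 2))⁻¹ * |besselJ (besselOrder n k) r| := by
  have h2 : 0 < (2 * Real.pi) ^ ((n : ℝ) / 2) := Real.rpow_pos_of_pos (by positivity) _
  have h3 : 0 < r ^ (((n : ℝ) - 2) / 2) := Real.rpow_pos_of_pos hr _
  rw [besselProfile, abs_mul, abs_of_pos (by positivity)]

lemma exists_abs_besselProfile_le (hn : 2 ≤ n) (k : ℕ) : ∃ C, 0 ≤ C ∧ ∀ r, 1 ≤ r →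
    |besselProfile n k r| ≤ |besselProfile n (k % 2) r| +
      C / r * (|besselProfile n 0 r| + |besselProfile n 1 r|) := by
  obtain ⟨C, hC, h⟩ := exists_abs_besselJ_add_le (besselOrder_nonneg hn 0) k
  refine ⟨C, hC, fun r hr => ?_⟩
  have hr0 : 0 < r := by linarith
  have h1 := h r hr
  have e1 : besselOrder n 0 + 1 = besselOrder n 1 := by
    rw [besselOrder_eq_zero_add n 1, Nat.cast_one]
  rw [e1, ← besselOrder_eq_zero_add, ← besselOrder_eq_zero_add] at h1
  simp only [abs_besselProfile hr0]
  have h2 : 0 < (2 * Real.pi) ^ ((n : ℝ) / 2) := Real.rpow_pos_of_pos (by positivity) _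
  have h3 : 0 < r ^ (((n : ℝ) - 2) / 2) := Real.rpow_pos_of_pos hr0 _
  calc _ ≤ (2 * Real.pi) ^ ((n : ℝ) / 2) * (r ^ (((n : ℝ) - 2) / 2))⁻¹ * _ :=
        mul_le_mul_of_nonneg_left h1 (by positivity)
    _ = _ := by ring

lemma exists_besselProfile_sq_le (hn : 2 ≤ n) (k : ℕ) : ∃ C, 0 ≤ C ∧ ∀ r, 1 ≤ r →
    besselProfile n k r ^ 2 ≤ C * (besselProfile n 0 r ^ 2 + besselProfile n 1 r ^ 2) := by
  obtain ⟨C, hC, h⟩ := exists_besselJ_add_sq_le (besselOrder_nonneg hn 0) k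
  refine ⟨C, hC, fun r hr => ?_⟩
  have h1 := h r hr
  have e1 : besselOrder n 0 + 1 = besselOrder n 1 := by
    rw [besselOrder_eq_zero_add n 1, Nat.cast_one]
  rw [e1, ← besselOrder_eq_zero_add] at h1
  simp only [besselProfile, mul_pow _ (besselJ _ r)]
  calc _ ≤ ((2 * Real.pi) ^ ((n : ℝ) / 2) * (r ^ (((n : ℝ) - 2) / 2))⁻¹) ^ 2 * _ :=
        mul_le_mul_of_nonneg_left h1 (sq_nonneg _)
    _ = _ := by ring

/-- `r^{n-1} g_k(r)² = (2π)^n r J_{k+(n-2)/2}(r)²`. -/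
lemma pow_mul_besselProfile_sq (hn : 1 ≤ n) (k : ℕ) {r : ℝ} (hr : 0 < r) :
    r ^ (n - 1) * besselProfile n k r ^ 2 =
      (2 * Real.pi) ^ n * (r * besselJ (besselOrder n k) r ^ 2) := by
  have e1 : ((2 * Real.pi) ^ ((n : ℝ) / 2)) ^ 2 = (2 * Real.pi) ^ n := by
    rw [← Real.rpow_natCast, ← Real.rpow_mul (by positivity), Nat.cast_two,
      div_mul_cancel₀ _ two_ne_zero, Real.rpow_natCast]
  have e2 : r * (r ^ (((n : ℝ) - 2) / 2)) ^ 2 = r ^ (n - 1) := by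
    rw [← Real.rpow_natCast, ← Real.rpow_mul hr.le, Nat.cast_two, div_mul_cancel₀ _ two_ne_zero,
      ← Real.rpow_natCast r (n - 1), Nat.cast_sub hn]
    nth_rewrite 1 [← Real.rpow_one r]
    rw [← Real.rpow_add hr]
    congr 1
    push_cast
    ring
  have h3 : r ^ (((n : ℝ) - 2) / 2) ≠ 0 := (Real.rpow_pos_of_pos hr _).ne'
  rw [besselProfile, mul_pow, mul_pow, e1, ← e2]
  field_simp

lemma exists_besselProfile_energy_lower (hn : 2 ≤ n) : ∃ c > 0, ∃ R > 0, ∀ r, R ≤ r →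
    c * (r ^ (n - 1))⁻¹ ≤ besselProfile n 0 r ^ 2 + besselProfile n 1 r ^ 2 := by
  obtain ⟨c, hc, R, hR, h⟩ := exists_besselJ_energy_lower (besselOrder_nonneg hn 0)
  refine ⟨(2 * Real.pi) ^ n * c, by positivity, R, hR, fun r hr => ?_⟩
  have hr0 : 0 < r := by linarith
  have h1 := h r hr
  have e1 : besselOrder n 0 + 1 = besselOrder n 1 := by
    rw [besselOrder_eq_zero_add n 1, Nat.cast_one]
  rw [e1] at h1
  rw [← div_eq_mul_inv, div_le_iff₀ (by positivity), mul_comm _ (r ^ (n - 1)), mul_add,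
    pow_mul_besselProfile_sq (by omega) 0 hr0, pow_mul_besselProfile_sq (by omega) 1 hr0, ← mul_add,
    ← mul_add]
  gcongr

lemma exists_abs_besselProfile_le_of_le (hn : 2 ≤ n) (k : ℕ) (R : ℝ) :
    ∃ C, 0 ≤ C ∧ ∀ r, 0 < r → r ≤ R → |besselProfile n k r| ≤ C := by
  have hc : Continuous fun r : ℝ => (2 * Real.pi) ^ ((n : ℝ) / 2) * (2 ^ besselOrder n k)⁻¹ *
      besselEntire (besselOrder n k) (r ^ 2 / 4) * r ^ k :=
    (continuous_const.mul ((continuous_besselEntire (besselOrder_nonneg hn k)).comp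
      (by fun_prop))).mul (by fun_prop)
  obtain ⟨C, hC⟩ := (isCompact_Icc (a := 0) (b := R)).exists_bound_of_continuousOn hc.continuousOn
  refine ⟨|C|, abs_nonneg _, fun r hr hrR => ?_⟩
  rw [besselProfile_eq_entire hr]
  exact (hC r ⟨hr.le, hrR⟩).trans (le_abs_self _)

/-! ### Fourier pairings on the sphere -/

lemma sphereFT_integrable {f : UnitSphere n → ℂ} (hf : Integrable f (sphereMeasure n)) (ξ : Rn n) :
    Integrable (fun θ : UnitSphere n => f θ *
      Complex.exp (-Complex.I * ((inner ℝ (θ : Rn n) ξ : ℝ) : ℂ))) (sphereMeasure n) :=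
  integrable_mul_exp hf (Continuous.aestronglyMeasurable (by fun_prop))

lemma sphereFT_add {f g : UnitSphere n → ℂ} (hf : Integrable f (sphereMeasure n))
    (hg : Integrable g (sphereMeasure n)) (ξ : Rn n) :
    sphereFT (fun θ => f θ + g θ) ξ = sphereFT f ξ + sphereFT g ξ := by
  rw [sphereFT, sphereFT, sphereFT, ← integral_add (sphereFT_integrable hf ξ)
    (sphereFT_integrable hg ξ)]
  simp only [add_mul]

lemma sphereFT_const_mul (c : ℂ) (f : UnitSphere n → ℂ) (ξ : Rn n) :
    sphereFT (fun θ => c * f θ) ξ = c * sphereFT f ξ := by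
  rw [sphereFT, sphereFT, ← integral_const_mul]
  simp only [mul_assoc]

lemma norm_sphereFT_le (f : UnitSphere n → ℂ) (ξ : Rn n) :
    ‖sphereFT f ξ‖ ≤ ∫ θ, ‖f θ‖ ∂(sphereMeasure n) := by
  refine (norm_integral_le_integral_norm _).trans_eq ?_
  simp only [norm_mul, norm_exp_neg_I_mul, mul_one]

lemma continuous_sphereFT {f : UnitSphere n → ℂ} (hf : Integrable f (sphereMeasure n)) :
    Continuous (sphereFT f) := by
  refine continuous_of_dominated (fun ξ => (sphereFT_integrable hf ξ).1)
    (bound := fun θ => ‖f θ‖) (fun ξ => .of_forall fun θ => ?_) hf.norm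
    (.of_forall fun θ => by fun_prop)
  rw [norm_mul, norm_exp_neg_I_mul, mul_one]

lemma continuous_fourierInt {f : Rn n → ℂ} (hf : Integrable f) : Continuous (fourierInt f) := by
  refine continuous_of_dominated (fun ξ => (integrable_mul_exp hf
    (Continuous.aestronglyMeasurable (by fun_prop))).1)
    (bound := fun θ => ‖f θ‖) (fun ξ => .of_forall fun θ => ?_) hf.norm
    (.of_forall fun θ => by fun_prop)
  rw [norm_mul, norm_exp_neg_I_mul, mul_one]

/-- Parseval's identity between the sphere and frequency space: both sides equal
`∭ m(ξ) a(θ) conj(b(θ')) e^{-i(θ-θ')·ξ}`. -/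
lemma integral_prod_mul_fourierInt {m : Rn n → ℂ} (hm : Integrable m) {a b : UnitSphere n → ℂ}
    (ha : Integrable a (sphereMeasure n)) (hb : Integrable b (sphereMeasure n)) :
    ∫ z : UnitSphere n × UnitSphere n, (a z.1 * starRingEnd ℂ (b z.2)) *
        fourierInt m ((z.1 : Rn n) - z.2) ∂((sphereMeasure n).prod (sphereMeasure n)) =
      ∫ ξ, m ξ * (sphereFT a ξ * starRingEnd ℂ (sphereFT b ξ)) := by
  have hb' : Integrable (fun θ => starRingEnd ℂ (b θ)) (sphereMeasure n) :=
    (LinearIsometryEquiv.integrable_comp_iff (Complex.conjLIE)).2 hb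
  have h1 : Integrable (Function.uncurry fun (z : UnitSphere n × UnitSphere n) (ξ : Rn n) =>
      ((a z.1 * starRingEnd ℂ (b z.2)) * m ξ) *
        Complex.exp (-Complex.I * ((inner ℝ ξ ((z.1 : Rn n) - z.2) : ℝ) : ℂ)))
      (((sphereMeasure n).prod (sphereMeasure n)).prod volume) := by
    refine integrable_mul_exp ((ha.mul_prod hb').mul_prod hm) ?_
    exact Continuous.aestronglyMeasurable (by fun_prop)
  have h2 := integral_integral_swap h1
  have e1 : ∀ z : UnitSphere n × UnitSphere n, ∫ ξ : Rn n,
      ((a z.1 * starRingEnd ℂ (b z.2)) * m ξ) *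
        Complex.exp (-Complex.I * ((inner ℝ ξ ((z.1 : Rn n) - z.2) : ℝ) : ℂ)) =
      (a z.1 * starRingEnd ℂ (b z.2)) * fourierInt m ((z.1 : Rn n) - z.2) := fun z => by
    rw [fourierInt, ← integral_const_mul]
    simp only [mul_assoc]
  simp_rw [e1] at h2
  rw [h2]
  refine integral_congr_ae (.of_forall fun ξ => ?_)
  simp only
  rw [sphereFT, sphereFT, ← integral_conj, ← integral_prod_mul, ← integral_const_mul]
  refine integral_congr_ae (.of_forall fun z => ?_)
  simp only
  rw [map_mul, conj_exp_neg_I_mul, inner_sub_right, real_inner_comm, real_inner_comm (z.2 : Rn n)]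
  push_cast
  rw [mul_sub, sub_eq_add_neg, Complex.exp_add, neg_mul Complex.I, neg_mul Complex.I, neg_neg]
  ring

/-- On spheres of large radius the Fourier transform of an even polynomial on the sphere is
controlled by the one of the surface measure, up to lower order terms. -/
lemma exists_norm_sphereFT_even_le (hn : 2 ≤ n) {m : ℕ} (hm : m % 2 = 0)
    {q : MvPolynomial (Fin n) ℂ} (hq : q.IsHomogeneous m) : ∃ C, 0 ≤ C ∧ ∀ ξ : Rn n, 1 ≤ ‖ξ‖ →
      ‖sphereFT (fun θ => polyVal q (θ : Rn n)) ξ‖ ≤ C * (|besselProfile n 0 ‖ξ‖| +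
        ‖ξ‖⁻¹ * (|besselProfile n 0 ‖ξ‖| + |besselProfile n 1 ‖ξ‖|)) := by
  set B : Rn n → ℝ := fun ξ => |besselProfile n 0 ‖ξ‖| +
        ‖ξ‖⁻¹ * (|besselProfile n 0 ‖ξ‖| + |besselProfile n 1 ‖ξ‖|)
  have hB : ∀ ξ, 0 ≤ B ξ := fun ξ => by positivity
  let V : Submodule ℂ C(UnitSphere n, ℂ) :=
    { carrier := {f | ∃ C, 0 ≤ C ∧ ∀ ξ : Rn n, 1 ≤ ‖ξ‖ → ‖sphereFT f ξ‖ ≤ C * B ξ}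
      add_mem' := by
        rintro f g ⟨C, hC, hf⟩ ⟨D, hD, hg⟩
        refine ⟨C + D, add_nonneg hC hD, fun ξ hξ => ?_⟩
        have e := sphereFT_add (integrable_of_continuous_sphere f.continuous)
          (integrable_of_continuous_sphere g.continuous) ξ
        calc _ = ‖sphereFT f ξ + sphereFT g ξ‖ := congrArg _ e
          _ ≤ _ := (norm_add_le _ _).trans (by rw [add_mul]; exact add_le_add (hf ξ hξ) (hg ξ hξ))
      zero_mem' := ⟨0, le_rfl, fun ξ _ => by simp [sphereFT]⟩
      smul_mem' := by
        rintro c f ⟨C, hC, hf⟩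
        refine ⟨‖c‖ * C, by positivity, fun ξ hξ => ?_⟩
        calc _ = ‖c * sphereFT f ξ‖ := congrArg _ (sphereFT_const_mul c f ξ)
          _ ≤ _ := by
            rw [norm_mul, mul_assoc]
            exact mul_le_mul_of_nonneg_left (hf ξ hξ) (norm_nonneg _) }
  have hV : polySphere n q ∈ V := by
    refine (iSup_le fun k => iSup_le fun hk => ?_ : _ ≤ V) (polySphere_mem_iSup (by omega) m hq)
    rintro f ⟨p, hp, rfl⟩
    obtain ⟨C, hC, h⟩ := exists_abs_besselProfile_le hn k
    rw [hk.2, hm] at h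
    obtain ⟨D, hD⟩ := (isCompact_sphere (0 : Rn n) 1).exists_bound_of_continuousOn
      (continuous_polyVal p).continuousOn
    refine ⟨|D| * (1 + C), by positivity, fun ξ hξ => ?_⟩
    have hξ0 : ξ ≠ 0 := norm_pos_iff.1 (by linarith)
    have e : sphereFT (⇑((polySphere n).toLinearMap p)) ξ =
        sphereFT (fun θ => polyVal p (θ : Rn n)) ξ := by
      congr 1; ext θ; exact polySphere_apply p θ
    rw [e, sphereFT_harmonic hn hp hξ0, norm_mul, norm_mul, norm_pow, norm_neg, Complex.norm_I,
      one_pow, one_mul, Complex.norm_real, Real.norm_eq_abs, mul_comm, mul_assoc]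
    have h1 : ‖polyVal p (‖ξ‖⁻¹ • ξ)‖ ≤ |D| := (hD _ (by
      rw [mem_sphere_zero_iff_norm, norm_smul, norm_inv, norm_norm,
        inv_mul_cancel₀ (norm_ne_zero_iff.2 hξ0)])).trans (le_abs_self _)
    refine mul_le_mul h1 ((h ‖ξ‖ hξ).trans ?_) (abs_nonneg _) (abs_nonneg _)
    simp only [B]
    have h2 : 0 ≤ ‖ξ‖⁻¹ * (|besselProfile n 0 ‖ξ‖| + |besselProfile n 1 ‖ξ‖|) := by positivity
    have h3 := abs_nonneg (besselProfile n 0 ‖ξ‖)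
    rw [div_eq_mul_inv, mul_assoc]
    nlinarith
  obtain ⟨C, hC, h⟩ := hV
  refine ⟨C, hC, fun ξ hξ => ?_⟩
  have e : sphereFT (⇑(polySphere n q)) ξ = sphereFT (fun θ => polyVal q (θ : Rn n)) ξ := by
    congr 1; ext θ; exact polySphere_apply q θ
  rw [← e]
  exact h ξ hξ

end
end

noncomputable section

section
variable {n : ℕ}
open MvPolynomial

/-! ### Finiteness of the energy of the weight -/

/-- The monomial `∏ₗ X_{i(l)}`. -/
def wordPoly {j : ℕ} (i : Fin j → Fin n) : MvPolynomial (Fin n) ℂ := ∏ l, X (i l)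

lemma isHomogeneous_wordPoly {j : ℕ} (i : Fin j → Fin n) : (wordPoly i).IsHomogeneous j := by
  have h := IsHomogeneous.prod Finset.univ (fun l => (X (i l) : MvPolynomial (Fin n) ℂ))
    (fun _ => 1) fun l _ => isHomogeneous_X _ _
  simpa [wordPoly] using h

lemma polyVal_wordPoly {j : ℕ} (i : Fin j → Fin n) (x : Rn n) :
    polyVal (wordPoly i) x = ∏ l, (x (i l) : ℂ) := by
  simp [polyVal, wordPoly]

lemma conj_polyVal_wordPoly {j : ℕ} (i : Fin j → Fin n) (x : Rn n) :
    starRingEnd ℂ (polyVal (wordPoly i) x) = polyVal (wordPoly i) x := by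
  rw [polyVal_wordPoly, map_prod]
  simp

/-- The Fourier transform at `(ξ, -ξ)` of the kernel `⟨θ, θ'⟩^j` on the product of two spheres.
Expanding the power of the inner product makes it a sum of squares. -/
def innerPowFT (n j : ℕ) (ξ : Rn n) : ℝ :=
  ∑ i : Fin j → Fin n, ‖sphereFT (fun θ => polyVal (wordPoly i) (θ : Rn n)) ξ‖ ^ 2

lemma innerPowFT_nonneg (j : ℕ) (ξ : Rn n) : 0 ≤ innerPowFT n j ξ :=
  Finset.sum_nonneg fun _ _ => sq_nonneg _

/-- The Fourier transform at `(ξ, -ξ)` of the kernel `(1 - ⟨θ, θ'⟩)^M = (|θ - θ'|² / 2)^M` on the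
product of two spheres, by the binomial theorem. -/
def chordPowFT (n M : ℕ) (ξ : Rn n) : ℝ :=
  ∑ j ∈ Finset.range (M + 1), ((-1) ^ j * (M.choose j : ℝ)) * innerPowFT n j ξ

lemma inner_pow_eq_sum (j : ℕ) (x y : Rn n) : ((inner ℝ x y : ℝ) : ℂ) ^ j =
    ∑ i : Fin j → Fin n, polyVal (wordPoly i) x * starRingEnd ℂ (polyVal (wordPoly i) y) := by
  have : ((inner ℝ x y : ℝ) : ℂ) = ∑ l, (x l : ℂ) * (y l : ℂ) := by
    simp [PiLp.inner_apply, mul_comm]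
  rw [this, Fintype.sum_pow]
  refine Finset.sum_congr rfl fun i _ => ?_
  rw [conj_polyVal_wordPoly, polyVal_wordPoly, polyVal_wordPoly, Finset.prod_mul_distrib]

lemma integrable_prod_of_continuous {f : UnitSphere n × UnitSphere n → ℂ} (hf : Continuous f) :
    Integrable f ((sphereMeasure n).prod (sphereMeasure n)) :=
  hf.integrable_of_hasCompactSupport (HasCompactSupport.of_compactSpace f)

lemma continuous_wordPoly_kernel {j : ℕ} (i : Fin j → Fin n) :
    Continuous fun z : UnitSphere n × UnitSphere n => polyVal (wordPoly i) (z.1 : Rn n) *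
      starRingEnd ℂ (polyVal (wordPoly i) (z.2 : Rn n)) := by
  simp only [conj_polyVal_wordPoly]
  exact ((continuous_polyVal_sphere _).comp continuous_fst).mul
    ((continuous_polyVal_sphere _).comp continuous_snd)

lemma continuous_sub_fourierInt {m : Rn n → ℂ} (hm : Integrable m) :
    Continuous fun z : UnitSphere n × UnitSphere n => fourierInt m ((z.1 : Rn n) - z.2) :=
  (continuous_fourierInt hm).comp (by fun_prop)

lemma continuous_innerPowFT (j : ℕ) : Continuous (innerPowFT n j) :=
  continuous_finsetSum _ fun i _ => (continuous_sphereFT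
    (integrable_of_continuous_sphere (continuous_polyVal_sphere (wordPoly i)))).norm.pow 2

lemma continuous_chordPowFT (M : ℕ) : Continuous (chordPowFT n M) :=
  continuous_finsetSum _ fun j _ => continuous_const.mul (continuous_innerPowFT j)

lemma exists_innerPowFT_le (j : ℕ) : ∃ C : ℝ, ∀ ξ : Rn n, innerPowFT n j ξ ≤ C :=
  ⟨_, fun _ => Finset.sum_le_sum fun _ _ => pow_le_pow_left₀ (norm_nonneg _)
    (norm_sphereFT_le _ _) 2⟩

lemma exists_abs_chordPowFT_le (M : ℕ) : ∃ C : ℝ, ∀ ξ : Rn n, |chordPowFT n M ξ| ≤ C := by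
  choose C hC using exists_innerPowFT_le (n := n)
  refine ⟨∑ j ∈ Finset.range (M + 1), |(-1) ^ j * (M.choose j : ℝ)| * C j, fun ξ => ?_⟩
  refine (Finset.abs_sum_le_sum_abs _ _).trans (Finset.sum_le_sum fun j _ => ?_)
  rw [abs_mul, abs_of_nonneg (innerPowFT_nonneg j ξ)]
  exact mul_le_mul_of_nonneg_left (hC j ξ) (abs_nonneg _)

lemma integral_chordPow_mul_fourierInt (M : ℕ) {m : Rn n → ℂ} (hm : Integrable m) :
    ∫ z : UnitSphere n × UnitSphere n, (((1 - inner ℝ (z.1 : Rn n) (z.2 : Rn n)) ^ M : ℝ) : ℂ) *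
        fourierInt m ((z.1 : Rn n) - z.2) ∂((sphereMeasure n).prod (sphereMeasure n)) =
      ∫ ξ, m ξ * (chordPowFT n M ξ : ℂ) := by
  have e1 : ∀ z : UnitSphere n × UnitSphere n,
      (((1 - inner ℝ (z.1 : Rn n) (z.2 : Rn n)) ^ M : ℝ) : ℂ) *
        fourierInt m ((z.1 : Rn n) - z.2) =
      ∑ j ∈ Finset.range (M + 1), ∑ i : Fin j → Fin n, ((-1) ^ j * (M.choose j : ℂ)) *
        ((polyVal (wordPoly i) (z.1 : Rn n) * starRingEnd ℂ (polyVal (wordPoly i) (z.2 : Rn n))) *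
          fourierInt m ((z.1 : Rn n) - z.2)) := fun z => by
    push_cast
    rw [sub_eq_add_neg, add_comm, add_pow, Finset.sum_mul]
    refine Finset.sum_congr rfl fun j _ => ?_
    rw [← Finset.mul_sum, ← Finset.sum_mul, ← inner_pow_eq_sum, neg_pow, one_pow]
    ring
  have hint : ∀ j : ℕ, ∀ i : Fin j → Fin n, Integrable (fun z : UnitSphere n × UnitSphere n =>
      ((-1) ^ j * (M.choose j : ℂ)) * ((polyVal (wordPoly i) (z.1 : Rn n) *
        starRingEnd ℂ (polyVal (wordPoly i) (z.2 : Rn n))) *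
          fourierInt m ((z.1 : Rn n) - z.2))) ((sphereMeasure n).prod (sphereMeasure n)) :=
    fun j i => integrable_prod_of_continuous (continuous_const.mul
      ((continuous_wordPoly_kernel i).mul (continuous_sub_fourierInt hm)))
  simp_rw [e1]
  rw [integral_finsetSum _ fun j _ => integrable_finsetSum _ fun i _ => hint j i]
  have hint2 : ∀ j : ℕ, Integrable fun ξ : Rn n =>
      ((-1) ^ j * (M.choose j : ℂ)) * (m ξ * (innerPowFT n j ξ : ℂ)) := fun j => by
    obtain ⟨C, hC⟩ := exists_innerPowFT_le (n := n) j
    refine Integrable.const_mul (hm.mul_bdd (c := C) (Complex.continuous_ofReal.comp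
      (continuous_innerPowFT j)).aestronglyMeasurable (.of_forall fun ξ => ?_)) _
    simp only [Function.comp]
    rw [Complex.norm_real, Real.norm_of_nonneg (innerPowFT_nonneg j ξ)]
    exact hC ξ
  have e2 : ∀ ξ, m ξ * (chordPowFT n M ξ : ℂ) = ∑ j ∈ Finset.range (M + 1),
      ((-1) ^ j * (M.choose j : ℂ)) * (m ξ * (innerPowFT n j ξ : ℂ)) := fun ξ => by
    rw [chordPowFT]
    push_cast
    rw [Finset.mul_sum]
    refine Finset.sum_congr rfl fun j _ => ?_
    ring
  simp_rw [e2]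
  rw [integral_finsetSum _ fun j _ => hint2 j]
  refine Finset.sum_congr rfl fun j _ => ?_
  rw [integral_finsetSum _ fun i _ => hint j i, integral_const_mul]
  simp_rw [integral_const_mul]
  rw [← Finset.mul_sum]
  congr 1
  have hc : ∀ i : Fin j → Fin n, Integrable (fun θ : UnitSphere n =>
      polyVal (wordPoly i) (θ : Rn n)) (sphereMeasure n) := fun i =>
    integrable_of_continuous_sphere (continuous_polyVal_sphere _)
  have hint3 : ∀ i : Fin j → Fin n, Integrable fun ξ : Rn n =>
      m ξ * (sphereFT (fun θ => polyVal (wordPoly i) (θ : Rn n)) ξ *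
        starRingEnd ℂ (sphereFT (fun θ => polyVal (wordPoly i) (θ : Rn n)) ξ)) := fun i => by
    have hcc := continuous_sphereFT (hc i)
    refine hm.mul_bdd (c := (∫ θ : UnitSphere n, ‖polyVal (wordPoly i) (θ : Rn n)‖
      ∂(sphereMeasure n)) ^ 2) (hcc.mul (Complex.continuous_conj.comp hcc)).aestronglyMeasurable
      (.of_forall fun ξ => ?_)
    rw [norm_mul, RCLike.norm_conj, ← sq]
    exact pow_le_pow_left₀ (norm_nonneg _) (norm_sphereFT_le _ _) 2
  simp_rw [integral_prod_mul_fourierInt hm (hc _) (hc _)]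
  rw [← integral_finsetSum _ fun i _ => hint3 i]
  refine integral_congr_ae (.of_forall fun ξ => ?_)
  simp only [innerPowFT]
  push_cast
  rw [Finset.mul_sum]
  simp_rw [Complex.mul_conj, Complex.normSq_eq_norm_sq]
  push_cast
  rfl

lemma one_sub_inner_sphere (θ θ' : UnitSphere n) :
    1 - inner ℝ (θ : Rn n) (θ' : Rn n) = ‖(θ : Rn n) - θ'‖ ^ 2 / 2 := by
  have h1 : ‖(θ : Rn n)‖ = 1 := mem_sphere_zero_iff_norm.1 θ.2
  have h2 : ‖(θ' : Rn n)‖ = 1 := mem_sphere_zero_iff_norm.1 θ'.2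
  rw [norm_sub_sq_real, h1, h2]
  ring

/-- Positivity of `ŵ` away from the origin, tested against a kernel vanishing to high order on the
diagonal. -/
lemma exists_le_integral_mollWeightSq_mul_chordPowFT (hn : 1 ≤ n) {w : ℝ → ℝ}
    (hpos : ∀ r : ℝ, 0 < r → 0 < w r) {N M : ℕ} (hNM : N ≤ 2 * M)
    (hw : Integrable (fun ξ : Rn n => w ‖ξ‖ * ((1 + ‖ξ‖) ^ N)⁻¹))
    {Φ : Rn n → ℝ} (hΦ0 : ∀ x, x ≠ 0 → 0 < Φ x)
    (hΦ : ∀ φ : 𝓢(Rn n, ℂ), HasCompactSupport φ → (0 : Rn n) ∉ tsupport φ →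
      ∫ ξ, (w ‖ξ‖ : ℂ) * fourierInt φ ξ = ∫ x, (Φ x : ℂ) * φ x) :
    ∃ C : ℝ, ∀ ε : ℝ, 0 < ε → ε ≤ 1 →
      -C ≤ (∫ ξ : Rn n, mollWeightSq w ε ξ * (chordPowFT n M ξ : ℂ)).re := by
  obtain ⟨C, hC, h⟩ := exists_integral_mollWeight_le hn hpos hw
  set μ := (sphereMeasure n).prod (sphereMeasure n)
  refine ⟨(9 / 2) ^ M * C * μ.real Set.univ, fun ε hε hε1 => ?_⟩
  obtain ⟨hi, hle⟩ := h ε hε hε1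
  have hi2 := integrable_mollWeightSq hi
  rw [← integral_chordPow_mul_fourierInt M hi2, ← RCLike.re_eq_complex_re, ← integral_re]
  · have : -((9 / 2) ^ M * C * μ.real Set.univ) = ∫ _z, -((9 / 2) ^ M * C) ∂μ := by
      rw [integral_const, smul_eq_mul]; ring
    rw [this]
    refine integral_mono (integrable_const _) (Integrable.re ?_) fun z => ?_
    · exact integrable_prod_of_continuous ((Complex.continuous_ofReal.comp (by fun_prop)).mul
        (continuous_sub_fourierInt hi2))
    simp only [RCLike.re_eq_complex_re, Complex.re_ofReal_mul]
    rw [one_sub_inner_sphere]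
    -- away from the diagonal `ŵ` is positive; near it the vanishing of order `2M ≥ N` of the kernel
    -- compensates the bound `O(ε^{-N})` for the smoothed transform
    rcases le_or_gt (3 * ε) ‖(z.1 : Rn n) - (z.2 : Rn n)‖ with hz | hz
    · have h1 := fourierInt_mollWeightSq_nonneg hΦ0 hΦ hε hi hz
      have h2 : 0 ≤ (9 / 2 : ℝ) ^ M * C := by positivity
      have h3 : 0 ≤ (‖(z.1 : Rn n) - (z.2 : Rn n)‖ ^ 2 / 2) ^ M := by positivity
      nlinarith [mul_nonneg h3 h1]
    · have h1 : |(fourierInt (mollWeightSq w ε) ((z.1 : Rn n) - (z.2 : Rn n))).re| ≤ C * (ε ^ N)⁻¹ :=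
        (Complex.abs_re_le_norm _).trans ((norm_fourierInt_le _ _).trans
          ((integral_mono hi2.norm hi.norm fun ξ => norm_mollWeightSq_le w ε ξ).trans hle))
      have h2 : (‖(z.1 : Rn n) - (z.2 : Rn n)‖ ^ 2 / 2) ^ M ≤ (9 / 2 * ε ^ 2) ^ M := by
        refine pow_le_pow_left₀ (by positivity) ?_ M
        nlinarith [norm_nonneg ((z.1 : Rn n) - (z.2 : Rn n))]
      have h3 : (9 / 2 * ε ^ 2) ^ M * (C * (ε ^ N)⁻¹) ≤ (9 / 2) ^ M * C := by
        have : ε ^ (2 * M) ≤ ε ^ N := pow_le_pow_of_le_one hε.le hε1 hNM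
        have h4 : ε ^ (2 * M) * (ε ^ N)⁻¹ ≤ 1 := by
          rw [← div_eq_mul_inv, div_le_one (by positivity)]; exact this
        rw [mul_pow, ← pow_mul]
        calc _ = ((9 / 2) ^ M * C) * (ε ^ (2 * M) * (ε ^ N)⁻¹) := by ring
          _ ≤ _ := mul_le_of_le_one_right (by positivity) h4
      have h5 : |(‖(z.1 : Rn n) - z.2‖ ^ 2 / 2) ^ M *
          (fourierInt (mollWeightSq w ε) ((z.1 : Rn n) - (z.2 : Rn n))).re| ≤ (9 / 2) ^ M * C := by
        rw [abs_mul, abs_of_nonneg (by positivity)]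
        exact (mul_le_mul h2 h1 (abs_nonneg _) (by positivity)).trans h3
      exact neg_le_of_abs_le h5
  · exact integrable_prod_of_continuous ((Complex.continuous_ofReal.comp (by fun_prop)).mul
      (continuous_sub_fourierInt hi2))

lemma X_mem_harmonicPoly (i : Fin n) : X i ∈ harmonicPoly n 1 := by
  rw [mem_harmonicPoly, polyLap_apply]
  refine ⟨isHomogeneous_X _ _, Finset.sum_eq_zero fun j _ => ?_⟩
  rw [pderiv_X]
  simp [Pi.single_apply, apply_ite]

lemma innerPowFT_one (hn : 2 ≤ n) {ξ : Rn n} (hξ : ξ ≠ 0) :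
    innerPowFT n 1 ξ = besselProfile n 1 ‖ξ‖ ^ 2 := by
  have e : ∀ i : Fin 1 → Fin n, ‖sphereFT (fun θ => polyVal (wordPoly i) (θ : Rn n)) ξ‖ ^ 2 =
      besselProfile n 1 ‖ξ‖ ^ 2 * (‖ξ‖⁻¹ * ξ (i 0)) ^ 2 := fun i => by
    have : wordPoly i = X (i 0) := by simp [wordPoly]
    rw [this, sphereFT_harmonic hn (X_mem_harmonicPoly _) hξ, norm_mul, norm_mul, norm_pow,
      norm_neg, Complex.norm_I, one_pow, one_mul, polyVal_X, Complex.norm_real, Complex.norm_real,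
      mul_pow, Real.norm_eq_abs, Real.norm_eq_abs, sq_abs, sq_abs]
    simp
  rw [innerPowFT, Finset.sum_congr rfl fun i _ => e i,
    Fintype.sum_equiv (Equiv.funUnique (Fin 1) (Fin n)) _ (fun l => besselProfile n 1 ‖ξ‖ ^ 2 *
      (‖ξ‖⁻¹ * ξ l) ^ 2) (fun i => by simp), ← Finset.mul_sum]
  simp_rw [mul_pow]
  rw [← Finset.mul_sum]
  have h1 : ∑ l, ξ l ^ 2 = ‖ξ‖ ^ 2 := by rw [EuclideanSpace.norm_sq_eq]; simp
  have : ‖ξ‖ ≠ 0 := norm_ne_zero_iff.2 hξ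
  rw [h1]
  field_simp

lemma exists_innerPowFT_even_le (hn : 2 ≤ n) {j : ℕ} (hj : j % 2 = 0) :
    ∃ C, 0 ≤ C ∧ ∀ ξ : Rn n, 1 ≤ ‖ξ‖ → innerPowFT n j ξ ≤ C * (besselProfile n 0 ‖ξ‖ ^ 2 +
      (‖ξ‖⁻¹) ^ 2 * (besselProfile n 0 ‖ξ‖ ^ 2 + besselProfile n 1 ‖ξ‖ ^ 2)) := by
  choose C hC h using fun i : Fin j → Fin n =>
    exists_norm_sphereFT_even_le hn hj (isHomogeneous_wordPoly i)
  refine ⟨∑ i, 4 * C i ^ 2, Finset.sum_nonneg fun i _ => by positivity, fun ξ hξ => ?_⟩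
  rw [innerPowFT, Finset.sum_mul]
  refine Finset.sum_le_sum fun i _ => ?_
  refine (pow_le_pow_left₀ (norm_nonneg _) (h i ξ hξ) 2).trans ?_
  rw [mul_pow, mul_comm 4, mul_assoc]
  refine mul_le_mul_of_nonneg_left ?_ (sq_nonneg _)
  rw [← sq_abs (besselProfile n 0 ‖ξ‖), ← sq_abs (besselProfile n 1 ‖ξ‖)]
  generalize |besselProfile n 0 ‖ξ‖| = a
  generalize |besselProfile n 1 ‖ξ‖| = b
  generalize ‖ξ‖⁻¹ = t
  nlinarith [sq_nonneg (a - t * (a + b)), mul_nonneg (sq_nonneg t) (sq_nonneg (a - b)),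
    sq_nonneg a]

/-- The even powers in the expansion of `(1 - ⟨θ, θ'⟩)^M` are controlled by `σ̂`, the odd powers
have a favourable sign and the first power contributes `g₁²`. -/
lemma exists_energy_le_sub_chordPowFT (hn : 2 ≤ n) {M : ℕ} (hM : 1 ≤ M) :
    ∃ κ R : ℝ, 1 ≤ κ ∧ 1 ≤ R ∧ ∀ ξ : Rn n, R ≤ ‖ξ‖ →
      (besselProfile n 0 ‖ξ‖ ^ 2 + besselProfile n 1 ‖ξ‖ ^ 2) / 2 ≤
        κ * besselProfile n 0 ‖ξ‖ ^ 2 - chordPowFT n M ξ := by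
  have h1 : ∀ j : ℕ, ∃ C, 0 ≤ C ∧ ∀ ξ : Rn n, 1 ≤ ‖ξ‖ →
      ((-1) ^ j * (M.choose j : ℝ)) * innerPowFT n j ξ ≤ C * (besselProfile n 0 ‖ξ‖ ^ 2 +
      (‖ξ‖⁻¹) ^ 2 * (besselProfile n 0 ‖ξ‖ ^ 2 + besselProfile n 1 ‖ξ‖ ^ 2)) -
        if j = 1 then besselProfile n 1 ‖ξ‖ ^ 2 else 0 := fun j => by
    rcases Nat.mod_two_eq_zero_or_one j with hj | hj
    · obtain ⟨C, hC, h⟩ := exists_innerPowFT_even_le hn hj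
      refine ⟨M.choose j * C, by positivity, fun ξ hξ => ?_⟩
      have : j ≠ 1 := by omega
      rw [(Nat.even_iff.2 hj).neg_one_pow, one_mul, if_neg this, sub_zero, mul_assoc]
      exact mul_le_mul_of_nonneg_left (h ξ hξ) (by positivity)
    · refine ⟨0, le_rfl, fun ξ hξ => ?_⟩
      rw [(Nat.odd_iff.2 hj).neg_one_pow, zero_mul, zero_sub, neg_one_mul, neg_mul, neg_le_neg_iff]
      split_ifs with h
      · have hξ0 : ξ ≠ 0 := norm_pos_iff.1 (by linarith)
        subst h
        rw [innerPowFT_one hn hξ0, Nat.choose_one_right]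
        exact le_mul_of_one_le_left (sq_nonneg _) (by exact_mod_cast hM)
      · exact mul_nonneg (Nat.cast_nonneg _) (innerPowFT_nonneg _ _)
  choose C hC h using h1
  set D := ∑ j ∈ Finset.range (M + 1), C j
  have hD : 0 ≤ D := Finset.sum_nonneg fun j _ => hC j
  refine ⟨D + 1, 2 * D + 1, by linarith, by linarith, fun ξ hξ => ?_⟩
  have hξ1 : 1 ≤ ‖ξ‖ := by linarith
  have h2 : chordPowFT n M ξ ≤ D * (besselProfile n 0 ‖ξ‖ ^ 2 +
      (‖ξ‖⁻¹) ^ 2 * (besselProfile n 0 ‖ξ‖ ^ 2 + besselProfile n 1 ‖ξ‖ ^ 2)) -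
        besselProfile n 1 ‖ξ‖ ^ 2 := by
    refine (Finset.sum_le_sum fun j _ => h j ξ hξ1).trans_eq ?_
    rw [Finset.sum_sub_distrib, ← Finset.sum_mul, Finset.sum_ite_eq' (Finset.range (M + 1)) 1,
      if_pos (Finset.mem_range.2 (by omega))]
  have h3 : D * (‖ξ‖⁻¹) ^ 2 ≤ 1 / 2 := by
    rw [inv_pow, ← div_eq_mul_inv, div_le_iff₀ (by positivity)]
    nlinarith
  have h4 := mul_le_mul_of_nonneg_right h3
    (add_nonneg (sq_nonneg (besselProfile n 0 ‖ξ‖)) (sq_nonneg (besselProfile n 1 ‖ξ‖)))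
  nlinarith

end
end

noncomputable section

section
variable {n : ℕ}
open MvPolynomial

lemma ae_ne_zero (hn : 1 ≤ n) : ∀ᵐ ξ : Rn n, ξ ≠ 0 := by
  have : Nonempty (Fin n) := ⟨⟨0, hn⟩⟩
  exact compl_mem_ae_iff.2 (measure_singleton (0 : Rn n))

lemma aestronglyMeasurable_besselProfile_norm (hn : 2 ≤ n) (k : ℕ) :
    AEStronglyMeasurable (fun ξ : Rn n => besselProfile n k ‖ξ‖) := by
  have hc : Continuous fun r : ℝ => (2 * Real.pi) ^ ((n : ℝ) / 2) * (2 ^ besselOrder n k)⁻¹ *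
      besselEntire (besselOrder n k) (r ^ 2 / 4) * r ^ k :=
    (continuous_const.mul ((continuous_besselEntire (besselOrder_nonneg hn k)).comp
      (by fun_prop))).mul (by fun_prop)
  refine (hc.comp continuous_norm).aestronglyMeasurable.congr ?_
  filter_upwards [ae_ne_zero (n := n) (by omega)] with ξ hξ
  exact (besselProfile_eq_entire (norm_pos_iff.2 hξ)).symm

lemma integrable_weight_mul_besselProfile_iff (hn : 2 ≤ n) (w : ℝ → ℝ) (k : ℕ) :
    Integrable (fun ξ : Rn n => w ‖ξ‖ * besselProfile n k ‖ξ‖ ^ 2) ↔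
      IntegrableOn (lambdaIntegrand n w k) (Set.Ioi 0) := by
  have : Nonempty (Fin n) := ⟨⟨0, by omega⟩⟩
  rw [integrable_fun_norm_addHaar volume (f := fun r => w r * besselProfile n k r ^ 2),
    finrank_euclideanSpace_fin]
  have h : Set.EqOn (fun y : ℝ => y ^ (n - 1) • (w y * besselProfile n k y ^ 2))
      (fun y => (2 * Real.pi) ^ n * lambdaIntegrand n w k y) (Set.Ioi 0) := fun y hy => by
    simp only [smul_eq_mul, lambdaIntegrand]
    rw [mul_left_comm, pow_mul_besselProfile_sq (by omega) k hy]
    ring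
  rw [integrableOn_congr_fun h measurableSet_Ioi]
  exact integrable_const_mul_iff (IsUnit.mk0 _ (by positivity)) _

/-- A pointwise limit of nonnegative functions with bounded integrals is integrable. -/
lemma integrable_of_tendsto_of_integral_le {α : Type*} [MeasurableSpace α] {μ : Measure α}
    {F : ℕ → α → ℝ} {f : α → ℝ} {K : ℝ} (hF : ∀ k, Integrable (F k) μ) (h0 : ∀ k, 0 ≤ᵐ[μ] F k)
    (hlim : ∀ᵐ x ∂μ, Tendsto (fun k => F k x) atTop (𝓝 (f x))) (hK : ∀ k, ∫ x, F k x ∂μ ≤ K) :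
    Integrable f μ := by
  refine ⟨aestronglyMeasurable_of_tendsto_ae atTop (fun k => (hF k).1) hlim, ?_⟩
  have h1 : ∀ᵐ x ∂μ, ‖f x‖ₑ = liminf (fun k => ENNReal.ofReal (F k x)) atTop := by
    filter_upwards [hlim, ae_all_iff.2 h0] with x hx hx0
    rw [(ENNReal.tendsto_ofReal hx).liminf_eq, Real.enorm_of_nonneg]
    exact ge_of_tendsto' hx hx0
  rw [HasFiniteIntegral, lintegral_congr_ae h1]
  refine (lintegral_liminf_le' fun k => (hF k).1.aemeasurable.ennreal_ofReal).trans_lt ?_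
  refine (liminf_le_of_frequently_le' (Frequently.of_forall fun k => ?_)).trans_lt
    (ENNReal.ofReal_lt_top (r := K))
  rw [← ofReal_integral_eq_lintegral_ofReal (hF k) (h0 k)]
  exact ENNReal.ofReal_le_ofReal (hK k)

lemma mollWeightSq_eq_ofReal (w : ℝ → ℝ) (ε : ℝ) (ξ : Rn n) :
    mollWeightSq w ε ξ = ((w ‖ξ‖ * (bumpFT (ε • ξ)).re ^ 2 : ℝ) : ℂ) := by
  rw [mollWeightSq, mollWeight, bumpFT_eq_re]
  push_cast
  simp only [Complex.ofReal_re]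
  ring

lemma bumpFT_re_sq_le (ξ : Rn n) : (bumpFT ξ).re ^ 2 ≤ 1 := by
  rw [sq_le_one_iff_abs_le_one]
  exact (Complex.abs_re_le_norm _).trans (norm_bumpFT_le _)

lemma tendsto_bumpFT_smul (ξ : Rn n) :
    Tendsto (fun k : ℕ => bumpFT ((1 / ((k : ℝ) + 1)) • ξ)) atTop (𝓝 1) := by
  have h : Tendsto (fun k : ℕ => (1 / ((k : ℝ) + 1)) • ξ) atTop (𝓝 ((0 : ℝ) • ξ)) :=
    tendsto_one_div_add_atTop_nhds_zero_nat.smul_const ξ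
  rw [zero_smul] at h
  have := (continuous_bumpFT (n := n)).tendsto 0
  rw [bumpFT_zero] at this
  exact this.comp h

lemma integrableOn_ball_weight {w : ℝ → ℝ} {N : ℕ}
    (hw : Integrable (fun ξ : Rn n => w ‖ξ‖ * ((1 + ‖ξ‖) ^ N)⁻¹)) (R : ℝ) :
    IntegrableOn (fun ξ : Rn n => w ‖ξ‖) (Metric.ball 0 R) := by
  have hc : Continuous fun ξ : Rn n => (1 + ‖ξ‖) ^ N := by fun_prop
  refine (hw.integrableOn.mul_bdd (c := (1 + |R|) ^ N) hc.aestronglyMeasurable ?_).congr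
    (.of_forall fun ξ => ?_)
  · refine ae_restrict_of_forall_mem measurableSet_ball fun ξ hξ => ?_
    rw [mem_ball_zero_iff] at hξ
    rw [Real.norm_of_nonneg (by positivity)]
    have := le_abs_self R
    gcongr
    linarith
  · have : (1 + ‖ξ‖) ^ N ≠ 0 := by positivity
    simp [this]

/-- The weight has finite energy at infinity against `g₀² + g₁²`, which decays exactly like
`r^{-(n-1)}`. -/
lemma exists_integrableOn_weight_mul_energy (hn : 2 ≤ n) {w : ℝ → ℝ}
    (hpos : ∀ r : ℝ, 0 < r → 0 < w r) {N : ℕ}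
    (hw : Integrable (fun ξ : Rn n => w ‖ξ‖ * ((1 + ‖ξ‖) ^ N)⁻¹))
    {Φ : Rn n → ℝ} (hΦ0 : ∀ x, x ≠ 0 → 0 < Φ x)
    (hΦ : ∀ φ : 𝓢(Rn n, ℂ), HasCompactSupport φ → (0 : Rn n) ∉ tsupport φ →
      ∫ ξ, (w ‖ξ‖ : ℂ) * fourierInt φ ξ = ∫ x, (Φ x : ℂ) * φ x)
    (h0 : Integrable (fun ξ : Rn n => w ‖ξ‖ * besselProfile n 0 ‖ξ‖ ^ 2)) :
    ∃ R : ℝ, 1 ≤ R ∧ IntegrableOn (fun ξ : Rn n => w ‖ξ‖ *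
      (besselProfile n 0 ‖ξ‖ ^ 2 + besselProfile n 1 ‖ξ‖ ^ 2)) (Metric.ball 0 R)ᶜ := by
  have hn1 : 1 ≤ n := by omega
  obtain ⟨C, hC⟩ := exists_le_integral_mollWeightSq_mul_chordPowFT hn1 hpos
    (M := N + 1) (by omega) hw hΦ0 hΦ
  obtain ⟨D, -, hD⟩ := exists_integral_mollWeight_le hn1 hpos hw
  obtain ⟨κ, R, hκ, hR, hE⟩ := exists_energy_le_sub_chordPowFT (n := n) hn (M := N + 1) (by omega)
  obtain ⟨B, hB⟩ := exists_abs_chordPowFT_le (n := n) (N + 1)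
  refine ⟨R, hR, ?_⟩
  set K : Rn n → ℝ := chordPowFT n (N + 1)
  set E : Rn n → ℝ := fun ξ => besselProfile n 0 ‖ξ‖ ^ 2 + besselProfile n 1 ‖ξ‖ ^ 2
  set m : ℕ → Rn n → ℝ := fun k ξ => (bumpFT ((1 / ((k : ℝ) + 1)) • ξ)).re ^ 2
  have hm1 : ∀ k ξ, m k ξ ≤ 1 := fun k ξ => bumpFT_re_sq_le _
  have hm0 : ∀ k ξ, 0 ≤ m k ξ := fun k ξ => sq_nonneg _
  have hmc : ∀ k, Continuous (m k) := fun k =>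
    (Complex.continuous_re.comp (continuous_bumpFT.comp (continuous_const_smul _))).pow 2
  have hE0 : ∀ ξ, 0 ≤ E ξ := fun ξ => add_nonneg (sq_nonneg _) (sq_nonneg _)
  have hEm : AEStronglyMeasurable E :=
    ((aestronglyMeasurable_besselProfile_norm hn 0).pow 2).add
      ((aestronglyMeasurable_besselProfile_norm hn 1).pow 2)
  have hwm := aestronglyMeasurable_weight hw
  have hwpos := ae_weight_pos (n := n) hn1 hpos
  have hms : MeasurableSet (Metric.ball (0 : Rn n) R)ᶜ := measurableSet_ball.compl
  -- `F k ≤ G k`, where the integrals of `G k` are bounded and `F k` converges to `w E / 2` outside the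
  -- ball; the term with `B` absorbs the values of the kernel inside the ball
  set F : ℕ → Rn n → ℝ := fun k =>
    (Metric.ball (0 : Rn n) R)ᶜ.indicator fun ξ => w ‖ξ‖ * m k ξ * (E ξ / 2)
  set G : ℕ → Rn n → ℝ := fun k ξ => κ * (w ‖ξ‖ * besselProfile n 0 ‖ξ‖ ^ 2) -
    w ‖ξ‖ * m k ξ * K ξ + B * (Metric.ball (0 : Rn n) R).indicator (fun ξ => w ‖ξ‖) ξ
  have hε : ∀ k : ℕ, 0 < 1 / ((k : ℝ) + 1) ∧ 1 / ((k : ℝ) + 1) ≤ 1 := fun k =>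
    ⟨by positivity, by rw [div_le_one (by positivity)]; linarith [(k.cast_nonneg : (0 : ℝ) ≤ k)]⟩
  have hmw : ∀ k, Integrable fun ξ : Rn n => w ‖ξ‖ * m k ξ * K ξ := fun k => by
    have h1 := integrable_mollWeightSq (hD _ (hε k).1 (hε k).2).1
    have h2 : Integrable fun ξ : Rn n => w ‖ξ‖ * m k ξ := by
      refine h1.re.congr (.of_forall fun ξ => ?_)
      simp only [mollWeightSq_eq_ofReal, RCLike.re_eq_complex_re, Complex.ofReal_re, m]
    exact h2.mul_bdd (c := B) (continuous_chordPowFT _).aestronglyMeasurable (.of_forall hB)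
  have hwB := integrableOn_ball_weight hw R
  have hG : ∀ k, Integrable (G k) := fun k => ((h0.const_mul κ).sub (hmw k)).add
    ((hwB.integrable_indicator measurableSet_ball).const_mul B)
  have hFG : ∀ k, ∀ᵐ ξ, F k ξ ≤ G k ξ := fun k => by
    filter_upwards [hwpos] with ξ hξ
    simp only [F, G]
    have hwm0 : 0 ≤ w ‖ξ‖ * m k ξ := mul_nonneg hξ.le (hm0 k ξ)
    have hwm1 : w ‖ξ‖ * m k ξ ≤ w ‖ξ‖ := mul_le_of_le_one_right hξ.le (hm1 k ξ)
    by_cases h : ξ ∈ Metric.ball (0 : Rn n) R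
    · rw [Set.indicator_of_notMem (by simpa using h), Set.indicator_of_mem h]
      have h1 := (abs_le.1 (hB ξ)).2
      have h2 : 0 ≤ w ‖ξ‖ * besselProfile n 0 ‖ξ‖ ^ 2 := mul_nonneg hξ.le (sq_nonneg _)
      have h3 : w ‖ξ‖ * m k ξ * K ξ ≤ w ‖ξ‖ * m k ξ * B := mul_le_mul_of_nonneg_left h1 hwm0
      have h4 : w ‖ξ‖ * m k ξ * B ≤ w ‖ξ‖ * B :=
        mul_le_mul_of_nonneg_right hwm1 ((abs_nonneg _).trans (hB ξ))
      have h5 : 0 ≤ κ * (w ‖ξ‖ * besselProfile n 0 ‖ξ‖ ^ 2) := mul_nonneg (by linarith) h2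
      linarith
    · rw [Set.indicator_of_mem (by simpa using h), Set.indicator_of_notMem h, mul_zero, add_zero]
      rw [mem_ball_zero_iff, not_lt] at h
      have h1 := mul_le_mul_of_nonneg_left (hE ξ h) hwm0
      have h2 : w ‖ξ‖ * m k ξ * (κ * besselProfile n 0 ‖ξ‖ ^ 2) ≤
          w ‖ξ‖ * (κ * besselProfile n 0 ‖ξ‖ ^ 2) := mul_le_mul_of_nonneg_right hwm1 (by positivity)
      simp only [E, K] at h1 ⊢
      linarith
  have hF0 : ∀ k, 0 ≤ᵐ[volume] F k := fun k => by
    filter_upwards [hwpos] with ξ hξ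
    exact Set.indicator_apply_nonneg fun _ =>
      mul_nonneg (mul_nonneg hξ.le (hm0 k ξ)) (by linarith [hE0 ξ])
  have hF : ∀ k, Integrable (F k) := fun k => by
    refine (hG k).mono' (((hwm.mul (hmc k).aestronglyMeasurable).mul
      (by simpa only [div_eq_mul_inv] using hEm.mul_const (2 : ℝ)⁻¹)).indicator hms) ?_
    filter_upwards [hFG k, hF0 k] with ξ h1 h2
    rw [Real.norm_of_nonneg h2]
    exact h1
  have hlim : ∀ᵐ ξ, Tendsto (fun k => F k ξ) atTop
      (𝓝 ((Metric.ball (0 : Rn n) R)ᶜ.indicator (fun ξ => w ‖ξ‖ * (E ξ / 2)) ξ)) := by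
    refine .of_forall fun ξ => ?_
    simp only [F]
    by_cases h : ξ ∈ (Metric.ball (0 : Rn n) R)ᶜ
    · simp only [Set.indicator_of_mem h]
      have h1 : Tendsto (fun k => m k ξ) atTop (𝓝 1) := by
        have := ((Complex.continuous_re.tendsto 1).comp (tendsto_bumpFT_smul ξ)).pow 2
        rwa [Complex.one_re, one_pow] at this
      simpa using (h1.const_mul (w ‖ξ‖)).mul_const (E ξ / 2)
    · simp only [Set.indicator_of_notMem h]
      exact tendsto_const_nhds
  have hfin := integrable_of_tendsto_of_integral_le hF hF0 hlim
    (K := κ * (∫ ξ : Rn n, w ‖ξ‖ * besselProfile n 0 ‖ξ‖ ^ 2) + C +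
      B * ∫ ξ, (Metric.ball (0 : Rn n) R).indicator (fun ξ => w ‖ξ‖) ξ) fun k => by
    refine (integral_mono_ae (hF k) (hG k) (hFG k)).trans ?_
    have h3 : ∫ ξ, G k ξ = κ * (∫ ξ : Rn n, w ‖ξ‖ * besselProfile n 0 ‖ξ‖ ^ 2) -
        (∫ ξ : Rn n, w ‖ξ‖ * m k ξ * K ξ) +
        B * ∫ ξ, (Metric.ball (0 : Rn n) R).indicator (fun ξ => w ‖ξ‖) ξ := by
      rw [← integral_const_mul, ← integral_const_mul, ← integral_sub (h0.const_mul κ) (hmw k)]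
      exact integral_add ((h0.const_mul κ).sub (hmw k))
        ((hwB.integrable_indicator measurableSet_ball).const_mul B)
    rw [h3]
    have h1 := hC _ (hε k).1 (hε k).2
    have h2 : ∫ ξ : Rn n, mollWeightSq w (1 / ((k : ℝ) + 1)) ξ * (K ξ : ℂ) =
        ((∫ ξ : Rn n, w ‖ξ‖ * m k ξ * K ξ : ℝ) : ℂ) := by
      rw [← integral_complex_ofReal]
      refine integral_congr_ae (.of_forall fun ξ => ?_)
      simp only [mollWeightSq_eq_ofReal, m]
      push_cast
      rfl
    rw [h2, Complex.ofReal_re] at h1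
    linarith
  rw [integrable_indicator_iff hms] at hfin
  refine (hfin.const_mul 2).congr (.of_forall fun ξ => ?_)
  simp only
  ring

/-- All `λ_k` are finite: for large radii `g_k²` is dominated by `g₀² + g₁²`. -/
lemma integrable_weight_mul_besselProfile (hn : 2 ≤ n) {w : ℝ → ℝ}
    (hpos : ∀ r : ℝ, 0 < r → 0 < w r) {N : ℕ}
    (hw : Integrable (fun ξ : Rn n => w ‖ξ‖ * ((1 + ‖ξ‖) ^ N)⁻¹)) {R : ℝ} (hR : 1 ≤ R)
    (hE : IntegrableOn (fun ξ : Rn n => w ‖ξ‖ *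
      (besselProfile n 0 ‖ξ‖ ^ 2 + besselProfile n 1 ‖ξ‖ ^ 2)) (Metric.ball 0 R)ᶜ) (k : ℕ) :
    Integrable (fun ξ : Rn n => w ‖ξ‖ * besselProfile n k ‖ξ‖ ^ 2) := by
  have hwpos := ae_weight_pos (n := n) (by omega) hpos
  have hgm := (aestronglyMeasurable_besselProfile_norm hn k).pow 2
  rw [← integrableOn_univ, ← Set.union_compl_self (Metric.ball (0 : Rn n) R)]
  refine IntegrableOn.union ?_ ?_
  · obtain ⟨C, hC, h⟩ := exists_abs_besselProfile_le_of_le hn k R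
    refine (integrableOn_ball_weight hw R).mul_bdd (c := C ^ 2) hgm.restrict ?_
    filter_upwards [ae_restrict_mem measurableSet_ball,
      ae_restrict_of_ae (ae_ne_zero (n := n) (by omega))] with ξ h1 h2
    rw [mem_ball_zero_iff] at h1
    rw [norm_pow, Real.norm_eq_abs]
    exact pow_le_pow_left₀ (abs_nonneg _) (h _ (norm_pos_iff.2 h2) h1.le) 2
  · obtain ⟨C, hC, h⟩ := exists_besselProfile_sq_le hn k
    refine (hE.const_mul C).mono' ((aestronglyMeasurable_weight hw).mul hgm).restrict ?_
    filter_upwards [ae_restrict_mem measurableSet_ball.compl, ae_restrict_of_ae hwpos] with ξ h1 h2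
    rw [Set.mem_compl_iff, mem_ball_zero_iff, not_lt] at h1
    rw [Real.norm_of_nonneg (mul_nonneg h2.le (sq_nonneg _)), mul_left_comm]
    exact mul_le_mul_of_nonneg_left (h _ (hR.trans h1)) h2.le

/-- As `g₀² + g₁²` is bounded below by a multiple of `r^{-(n-1)}`, finiteness of `λ₀` and `λ₁` limits
the growth of the weight. The exponent `n - 1` is the codimension of the diagonal in the product of
two spheres. -/
lemma integrable_weight_mul_inv_pow (hn : 2 ≤ n) {w : ℝ → ℝ}
    (hpos : ∀ r : ℝ, 0 < r → 0 < w r) {N : ℕ}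
    (hw : Integrable (fun ξ : Rn n => w ‖ξ‖ * ((1 + ‖ξ‖) ^ N)⁻¹))
    (h0 : Integrable (fun ξ : Rn n => w ‖ξ‖ * besselProfile n 0 ‖ξ‖ ^ 2))
    (h1 : Integrable (fun ξ : Rn n => w ‖ξ‖ * besselProfile n 1 ‖ξ‖ ^ 2)) :
    Integrable (fun ξ : Rn n => w ‖ξ‖ * ((1 + ‖ξ‖) ^ (n - 1))⁻¹) := by
  have hwpos := ae_weight_pos (n := n) (by omega) hpos
  obtain ⟨c, hc, R, hR, h⟩ := exists_besselProfile_energy_lower hn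
  have hcont : Continuous fun ξ : Rn n => ((1 + ‖ξ‖) ^ (n - 1))⁻¹ :=
    Continuous.inv₀ (by fun_prop) fun ξ => by positivity
  rw [← integrableOn_univ, ← Set.union_compl_self (Metric.ball (0 : Rn n) R)]
  refine IntegrableOn.union ?_ ?_
  · refine (integrableOn_ball_weight hw R).mul_bdd (c := 1) hcont.aestronglyMeasurable
      (.of_forall fun ξ => ?_)
    rw [Real.norm_of_nonneg (by positivity)]
    refine inv_le_one_of_one_le₀ (one_le_pow₀ ?_)
    linarith [norm_nonneg ξ]
  · refine ((h0.add h1).const_mul c⁻¹).integrableOn.mono'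
      ((aestronglyMeasurable_weight hw).mul hcont.aestronglyMeasurable).restrict ?_
    filter_upwards [ae_restrict_mem measurableSet_ball.compl, ae_restrict_of_ae hwpos] with ξ h1 h2
    rw [Set.mem_compl_iff, mem_ball_zero_iff, not_lt] at h1
    rw [Real.norm_of_nonneg (by positivity), Pi.add_apply, ← mul_add, mul_left_comm]
    refine mul_le_mul_of_nonneg_left ?_ h2.le
    rw [← div_eq_inv_mul, le_div_iff₀ hc, mul_comm]
    refine le_trans ?_ (h _ h1)
    have : 0 < ‖ξ‖ := by linarith
    gcongr
    linarith

end
end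

noncomputable section

section
variable {n : ℕ}
open MvPolynomial

/-! ### Weighted Fourier transforms of polynomials on the sphere -/

lemma sphereFT_polySphere (q : MvPolynomial (Fin n) ℂ) :
    sphereFT (⇑(polySphere n q)) = sphereFT fun θ => polyVal q (θ : Rn n) := by
  congr 1; ext θ; exact polySphere_apply q θ

lemma continuous_sphereFT_polyVal (q : MvPolynomial (Fin n) ℂ) :
    Continuous (sphereFT fun θ : UnitSphere n => polyVal q (θ : Rn n)) :=
  continuous_sphereFT (integrable_of_continuous_sphere (continuous_polyVal_sphere q))

lemma exists_norm_polyVal_direction_le (p : MvPolynomial (Fin n) ℂ) :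
    ∃ D, 0 ≤ D ∧ ∀ ξ : Rn n, ξ ≠ 0 → ‖polyVal p (‖ξ‖⁻¹ • ξ)‖ ≤ D := by
  obtain ⟨D, hD⟩ := (isCompact_sphere (0 : Rn n) 1).exists_bound_of_continuousOn
    (continuous_polyVal p).continuousOn
  refine ⟨|D|, abs_nonneg _, fun ξ hξ => (hD _ ?_).trans (le_abs_self _)⟩
  rw [mem_sphere_zero_iff_norm, norm_smul, norm_inv, norm_norm,
    inv_mul_cancel₀ (norm_ne_zero_iff.2 hξ)]

lemma integrable_weight_mul_sphereFT_sq (hn : 2 ≤ n) {w : ℝ → ℝ}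
    (hpos : ∀ r : ℝ, 0 < r → 0 < w r) (hwm : AEStronglyMeasurable (fun ξ : Rn n => w ‖ξ‖))
    (hint : ∀ k, Integrable (fun ξ : Rn n => w ‖ξ‖ * besselProfile n k ‖ξ‖ ^ 2))
    (q : MvPolynomial (Fin n) ℂ) :
    Integrable fun ξ : Rn n => w ‖ξ‖ * ‖sphereFT (fun θ => polyVal q (θ : Rn n)) ξ‖ ^ 2 := by
  have hwpos := ae_weight_pos (n := n) (by omega) hpos
  have hmeas : ∀ f : C(UnitSphere n, ℂ), AEStronglyMeasurable fun ξ : Rn n =>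
      w ‖ξ‖ * ‖sphereFT f ξ‖ ^ 2 := fun f => hwm.mul
    ((continuous_sphereFT (integrable_of_continuous_sphere
      f.continuous)).norm.pow 2).aestronglyMeasurable
  let V : Submodule ℂ C(UnitSphere n, ℂ) :=
    { carrier := {f | Integrable fun ξ : Rn n => w ‖ξ‖ * ‖sphereFT f ξ‖ ^ 2}
      add_mem' := by
        intro f g hf hg
        refine ((Integrable.const_mul hf 2).add (Integrable.const_mul hg 2)).mono' (hmeas _) ?_
        filter_upwards [hwpos] with ξ hξ
        have e : sphereFT (⇑(f + g)) ξ = sphereFT f ξ + sphereFT g ξ :=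
          sphereFT_add (integrable_of_continuous_sphere f.continuous)
            (integrable_of_continuous_sphere g.continuous) ξ
        rw [Real.norm_of_nonneg (by positivity), e, Pi.add_apply]
        have h1 : ‖sphereFT f ξ + sphereFT g ξ‖ ^ 2 ≤
            2 * ‖sphereFT f ξ‖ ^ 2 + 2 * ‖sphereFT g ξ‖ ^ 2 := by
          have := pow_le_pow_left₀ (norm_nonneg _) (norm_add_le (sphereFT f ξ) (sphereFT g ξ)) 2
          nlinarith [sq_nonneg (‖sphereFT f ξ‖ - ‖sphereFT g ξ‖)]
        nlinarith [mul_le_mul_of_nonneg_left h1 hξ.le]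
      zero_mem' := by simp [sphereFT]
      smul_mem' := by
        intro c f hf
        refine (Integrable.const_mul hf (‖c‖ ^ 2)).congr (.of_forall fun ξ => ?_)
        have e : sphereFT (⇑(c • f)) ξ = c * sphereFT f ξ := sphereFT_const_mul c f ξ
        simp only
        rw [e, norm_mul]
        ring }
  have hV : polySphere n q ∈ V := by
    refine (iSup_le fun k => ?_ : _ ≤ V) (polySphere_mem_iSup_all (by omega) q)
    rintro f ⟨p, hp, rfl⟩
    obtain ⟨D, hD, h⟩ := exists_norm_polyVal_direction_le p
    refine ((hint k).const_mul (D ^ 2)).mono' (hmeas _) ?_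
    filter_upwards [hwpos, ae_ne_zero (n := n) (by omega)] with ξ hξ hξ0
    change ‖w ‖ξ‖ * ‖sphereFT (⇑(polySphere n p)) ξ‖ ^ 2‖ ≤ _
    rw [Real.norm_of_nonneg (by positivity), sphereFT_polySphere, sphereFT_harmonic hn hp hξ0,
      norm_mul, norm_mul, norm_pow, norm_neg, Complex.norm_I, one_pow, one_mul, Complex.norm_real,
      mul_pow, Real.norm_eq_abs, sq_abs]
    have := pow_le_pow_left₀ (norm_nonneg _) (h ξ hξ0) 2
    calc _ = (w ‖ξ‖ * besselProfile n k ‖ξ‖ ^ 2) * ‖polyVal p (‖ξ‖⁻¹ • ξ)‖ ^ 2 := by ring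
      _ ≤ (w ‖ξ‖ * besselProfile n k ‖ξ‖ ^ 2) * D ^ 2 := by gcongr
      _ = _ := by ring
  have h := hV
  change Integrable (fun ξ : Rn n => w ‖ξ‖ * ‖sphereFT (⇑(polySphere n q)) ξ‖ ^ 2) at h
  rwa [sphereFT_polySphere] at h

lemma integrable_weight_mul_sphereFT_mul (hn : 2 ≤ n) {w : ℝ → ℝ}
    (hpos : ∀ r : ℝ, 0 < r → 0 < w r) (hwm : AEStronglyMeasurable (fun ξ : Rn n => w ‖ξ‖))
    (hint : ∀ k, Integrable (fun ξ : Rn n => w ‖ξ‖ * besselProfile n k ‖ξ‖ ^ 2))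
    (p q : MvPolynomial (Fin n) ℂ) :
    Integrable fun ξ : Rn n => (w ‖ξ‖ : ℂ) * (sphereFT (fun θ => polyVal p (θ : Rn n)) ξ *
      starRingEnd ℂ (sphereFT (fun θ => polyVal q (θ : Rn n)) ξ)) := by
  refine ((integrable_weight_mul_sphereFT_sq hn hpos hwm hint p).add
    (integrable_weight_mul_sphereFT_sq hn hpos hwm hint q)).mono'
    ((Complex.continuous_ofReal.comp_aestronglyMeasurable hwm).mul
      ((continuous_sphereFT_polyVal p).mul (Complex.continuous_conj.comp
        (continuous_sphereFT_polyVal q))).aestronglyMeasurable) ?_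
  filter_upwards [ae_weight_pos (n := n) (by omega) hpos] with ξ hξ
  rw [norm_mul, norm_mul, Complex.norm_real, Real.norm_of_nonneg hξ.le, RCLike.norm_conj,
    Pi.add_apply, ← mul_add]
  refine mul_le_mul_of_nonneg_left ?_ hξ.le
  nlinarith [sq_nonneg (‖sphereFT (fun θ => polyVal p (θ : Rn n)) ξ‖ -
    ‖sphereFT (fun θ => polyVal q (θ : Rn n)) ξ‖), sq_nonneg (‖sphereFT (fun θ =>
    polyVal p (θ : Rn n)) ξ‖), sq_nonneg (‖sphereFT (fun θ => polyVal q (θ : Rn n)) ξ‖)]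

lemma integral_pow_mul_besselProfile_sq (hn : 1 ≤ n) (w : ℝ → ℝ) (k : ℕ) :
    ∫ r in Set.Ioi (0 : ℝ), (r : ℂ) ^ (n - 1) * ((w r * besselProfile n k r ^ 2 : ℝ) : ℂ) =
      (((2 * Real.pi) ^ n * lambdaCoeff n w k : ℝ) : ℂ) := by
  rw [lambdaCoeff, ← integral_const_mul, ← integral_complex_ofReal]
  refine setIntegral_congr_fun measurableSet_Ioi fun r hr => ?_
  simp only [← Complex.ofReal_pow, ← Complex.ofReal_mul]
  rw [mul_left_comm, pow_mul_besselProfile_sq hn k hr, lambdaIntegrand]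
  congr 1
  ring

/-- The weighted Fourier transforms of spherical harmonics of degree `k` have the inner products of
the spherical harmonics, multiplied by `(2π)^n λ_k`. -/
lemma integral_weight_mul_sphereFT_harmonic (hn : 2 ≤ n) (w : ℝ → ℝ) {k : ℕ}
    {p q : MvPolynomial (Fin n) ℂ} (hp : p ∈ harmonicPoly n k) (hq : q ∈ harmonicPoly n k) :
    ∫ ξ : Rn n, (w ‖ξ‖ : ℂ) * (sphereFT (fun θ => polyVal p (θ : Rn n)) ξ *
      starRingEnd ℂ (sphereFT (fun θ => polyVal q (θ : Rn n)) ξ)) =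
    (((2 * Real.pi) ^ n * lambdaCoeff n w k : ℝ) : ℂ) *
      ∫ θ : UnitSphere n, polyVal p (θ : Rn n) * starRingEnd ℂ (polyVal q (θ : Rn n))
        ∂(sphereMeasure n) := by
  rw [← integral_pow_mul_besselProfile_sq (by omega), ← integral_radial_mul_angular (by omega)
    (fun r => ((w r * besselProfile n k r ^ 2 : ℝ) : ℂ))
    (fun x => polyVal p x * starRingEnd ℂ (polyVal q x))]
  refine integral_congr_ae ?_
  filter_upwards [ae_ne_zero (n := n) (by omega)] with ξ hξ
  rw [sphereFT_harmonic hn hp hξ, sphereFT_harmonic hn hq hξ]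
  have h1 : (-Complex.I) ^ k * starRingEnd ℂ ((-Complex.I) ^ k) = 1 := by
    rw [Complex.mul_conj, Complex.normSq_eq_norm_sq]; simp
  rw [map_mul, map_mul, Complex.conj_ofReal]
  push_cast
  linear_combination ((w ‖ξ‖ : ℂ) * (besselProfile n k ‖ξ‖ : ℂ) ^ 2 * (polyVal p (‖ξ‖⁻¹ • ξ) *
    starRingEnd ℂ (polyVal q (‖ξ‖⁻¹ • ξ)))) * h1

lemma integral_weight_mul_sphereFT_harmonic_of_ne (hn : 2 ≤ n) (w : ℝ → ℝ) {k l : ℕ} (hkl : k ≠ l)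
    {p q : MvPolynomial (Fin n) ℂ} (hp : p ∈ harmonicPoly n k) (hq : q ∈ harmonicPoly n l) :
    ∫ ξ : Rn n, (w ‖ξ‖ : ℂ) * (sphereFT (fun θ => polyVal p (θ : Rn n)) ξ *
      starRingEnd ℂ (sphereFT (fun θ => polyVal q (θ : Rn n)) ξ)) = 0 := by
  have h0 : ∫ θ : UnitSphere n, polyVal p (θ : Rn n) * starRingEnd ℂ (polyVal q (θ : Rn n))
        ∂(sphereMeasure n) = 0 := by
    simp_rw [← polyVal_conjPoly]
    exact integral_harmonic_mul_eq_zero (by omega) hkl hp (conjPoly_mem_harmonicPoly hq)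
  have h := integral_radial_mul_angular (n := n) (by omega)
    (fun r => (-Complex.I) ^ k * starRingEnd ℂ ((-Complex.I) ^ l) *
      ((w r * besselProfile n k r * besselProfile n l r : ℝ) : ℂ))
    (fun x => polyVal p x * starRingEnd ℂ (polyVal q x))
  rw [h0, mul_zero] at h
  rw [← h]
  refine integral_congr_ae ?_
  filter_upwards [ae_ne_zero (n := n) (by omega)] with ξ hξ
  rw [sphereFT_harmonic hn hp hξ, sphereFT_harmonic hn hq hξ, map_mul, map_mul,
    Complex.conj_ofReal]
  push_cast
  ring

lemma one_mem_harmonicPoly : (1 : MvPolynomial (Fin n) ℂ) ∈ harmonicPoly n 0 := by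
  rw [mem_harmonicPoly, polyLap_apply]
  exact ⟨isHomogeneous_one _ _, by simp⟩

/-- Only the component of degree `0` of `q` contributes, by orthogonality of spherical harmonics of
different degrees. -/
lemma integral_weight_mul_sphereFT_one (hn : 2 ≤ n) {w : ℝ → ℝ}
    (hpos : ∀ r : ℝ, 0 < r → 0 < w r) (hwm : AEStronglyMeasurable (fun ξ : Rn n => w ‖ξ‖))
    (hint : ∀ k, Integrable (fun ξ : Rn n => w ‖ξ‖ * besselProfile n k ‖ξ‖ ^ 2))
    (q : MvPolynomial (Fin n) ℂ) :
    ∫ ξ : Rn n, (w ‖ξ‖ : ℂ) * (sphereFT (fun θ => polyVal q (θ : Rn n)) ξ *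
      starRingEnd ℂ (sphereFT (fun θ => polyVal 1 (θ : Rn n)) ξ)) =
    (((2 * Real.pi) ^ n * lambdaCoeff n w 0 : ℝ) : ℂ) *
      ∫ θ : UnitSphere n, polyVal q (θ : Rn n) ∂(sphereMeasure n) := by
  set s := sphereFT fun θ : UnitSphere n => polyVal 1 (θ : Rn n)
  set c := (((2 * Real.pi) ^ n * lambdaCoeff n w 0 : ℝ) : ℂ)
  let V : Submodule ℂ C(UnitSphere n, ℂ) :=
    { carrier := {f | Integrable (fun ξ : Rn n => (w ‖ξ‖ : ℂ) * (sphereFT f ξ *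
          starRingEnd ℂ (s ξ))) ∧
        ∫ ξ : Rn n, (w ‖ξ‖ : ℂ) * (sphereFT f ξ * starRingEnd ℂ (s ξ)) =
        c * ∫ θ, f θ ∂(sphereMeasure n)}
      add_mem' := by
        rintro f g ⟨hf1, hf⟩ ⟨hg1, hg⟩
        have e : ∀ ξ, (w ‖ξ‖ : ℂ) * (sphereFT (⇑(f + g)) ξ * starRingEnd ℂ (s ξ)) =
            (w ‖ξ‖ : ℂ) * (sphereFT f ξ * starRingEnd ℂ (s ξ)) +
            (w ‖ξ‖ : ℂ) * (sphereFT g ξ * starRingEnd ℂ (s ξ)) := fun ξ => by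
          have : sphereFT (⇑(f + g)) ξ = sphereFT f ξ + sphereFT g ξ :=
            sphereFT_add (integrable_of_continuous_sphere f.continuous)
              (integrable_of_continuous_sphere g.continuous) ξ
          rw [this]
          ring
        refine ⟨(hf1.add hg1).congr (.of_forall fun ξ => (e ξ).symm), ?_⟩
        simp_rw [e]
        rw [integral_add hf1 hg1, hf, hg, ← mul_add,
          ← integral_add (integrable_of_continuous_sphere f.continuous)
            (integrable_of_continuous_sphere g.continuous)]
        rfl
      zero_mem' := by simp [sphereFT]
      smul_mem' := by
        rintro d f ⟨hf1, hf⟩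
        have e : ∀ ξ, (w ‖ξ‖ : ℂ) * (sphereFT (⇑(d • f)) ξ * starRingEnd ℂ (s ξ)) =
            d * ((w ‖ξ‖ : ℂ) * (sphereFT f ξ * starRingEnd ℂ (s ξ))) := fun ξ => by
          have : sphereFT (⇑(d • f)) ξ = d * sphereFT f ξ := sphereFT_const_mul d f ξ
          rw [this]
          ring
        refine ⟨(hf1.const_mul d).congr (.of_forall fun ξ => (e ξ).symm), ?_⟩
        simp_rw [e]
        rw [integral_const_mul, hf, mul_left_comm, ← integral_const_mul d]
        rfl }
  have hV : polySphere n q ∈ V := by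
    refine (iSup_le fun k => ?_ : _ ≤ V) (polySphere_mem_iSup_all (by omega) q)
    rintro f ⟨p, hp, rfl⟩
    change Integrable (fun ξ : Rn n => (w ‖ξ‖ : ℂ) * (sphereFT (⇑(polySphere n p)) ξ *
          starRingEnd ℂ (s ξ))) ∧
        ∫ ξ : Rn n, (w ‖ξ‖ : ℂ) * (sphereFT (⇑(polySphere n p)) ξ * starRingEnd ℂ (s ξ)) =
        c * ∫ θ, polySphere n p θ ∂(sphereMeasure n)
    simp_rw [sphereFT_polySphere, polySphere_apply]
    refine ⟨integrable_weight_mul_sphereFT_mul hn hpos hwm hint p 1, ?_⟩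
    rcases eq_or_ne k 0 with rfl | hk
    · have h := integral_weight_mul_sphereFT_harmonic hn w hp one_mem_harmonicPoly
      simp only [polyVal_one, map_one, mul_one] at h
      simpa only [s, c, polyVal_one] using h
    · have h := integral_weight_mul_sphereFT_harmonic_of_ne hn w hk hp one_mem_harmonicPoly
      have h2 := integral_harmonic_mul_eq_zero (by omega) hk hp (one_mem_harmonicPoly (n := n))
      simp only [polyVal_one, mul_one] at h2
      rw [h2, mul_zero]
      exact h
  have h := hV.2
  change ∫ ξ : Rn n, (w ‖ξ‖ : ℂ) * (sphereFT (⇑(polySphere n q)) ξ * starRingEnd ℂ (s ξ)) =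
        c * ∫ θ, polySphere n q θ ∂(sphereMeasure n) at h
  simp_rw [sphereFT_polySphere, polySphere_apply] at h
  exact h

end
end

noncomputable section

section
variable {n : ℕ}
open scoped Pointwise

/-! ### Null sets of chords and measure of spherical caps -/

lemma measurePreserving_polar :
    MeasurePreserving (homeomorphUnitSphereProd (Rn n)).symm
      ((sphereMeasure n).prod (Measure.volumeIoiPow (n - 1)))
      ((volume : Measure (Rn n)).comap Subtype.val) := by
  have h := (volume : Measure (Rn n)).measurePreserving_homeomorphUnitSphereProd
  rw [finrank_euclideanSpace_fin] at h
  exact h.symm (homeomorphUnitSphereProd (Rn n)).toMeasurableEquiv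

lemma ae_prod_of_ae {Q : Rn n → Prop} (h : ∀ᵐ x : Rn n, Q x) :
    ∀ᵐ z ∂((sphereMeasure n).prod (Measure.volumeIoiPow (n - 1))), Q ((z.2 : ℝ) • (z.1 : Rn n)) := by
  have h1 : ∀ᵐ x : ({0}ᶜ : Set (Rn n)) ∂((volume : Measure (Rn n)).comap Subtype.val), Q x := by
    rw [← ae_restrict_iff_subtype (measurableSet_singleton _).compl]
    exact ae_restrict_of_ae h
  filter_upwards [measurePreserving_polar.quasiMeasurePreserving.ae h1] with z hz
  simpa using hz

lemma ae_Ioi_of_ae_norm (hn : 1 ≤ n) {P : ℝ → Prop} (h : ∀ᵐ x : Rn n, P ‖x‖) :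
    ∀ᵐ r ∂(volume.restrict (Set.Ioi (0 : ℝ))), P r := by
  have : Nonempty (Fin n) := ⟨⟨0, hn⟩⟩
  have hne : (sphereMeasure n) ≠ 0 := Measure.toSphere_ne_zero _
  have : NeBot (ae (sphereMeasure n)) := ae_neBot.2 hne
  obtain ⟨θ, hθ⟩ := (Measure.ae_ae_of_ae_prod (ae_prod_of_ae h)).exists
  rw [Measure.volumeIoiPow, ae_withDensity_iff' (by fun_prop)] at hθ
  rw [ae_restrict_iff_subtype measurableSet_Ioi]
  filter_upwards [hθ] with r hr
  have hr0 : (0 : ℝ) < r := r.2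
  have h1 := hr (ENNReal.ofReal_pos.2 (by positivity)).ne'
  rwa [norm_smul, mem_sphere_zero_iff_norm.1 θ.2, mul_one, Real.norm_of_nonneg hr0.le] at h1

lemma ae_sphere_of_ae_direction {Q : Rn n → Prop}
    (h : ∀ᵐ x : Rn n, Q (‖x‖⁻¹ • x)) : ∀ᵐ θ : UnitSphere n ∂(sphereMeasure n), Q θ := by
  have hne : Measure.volumeIoiPow (n - 1) ≠ 0 := by
    intro h0
    have h1 := Measure.volumeIoiPow_apply_Iio (n - 1) ⟨1, Set.mem_Ioi.2 one_pos⟩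
    rw [h0] at h1
    simp at h1
    linarith [((n - 1).cast_nonneg : (0 : ℝ) ≤ _)]
  have : NeBot (ae (Measure.volumeIoiPow (n - 1))) := ae_neBot.2 hne
  filter_upwards [Measure.ae_ae_of_ae_prod (ae_prod_of_ae h)] with θ hθ
  obtain ⟨r, hr⟩ := hθ.exists
  have hr0 : (0 : ℝ) < r := r.2
  rwa [norm_smul, mem_sphere_zero_iff_norm.1 θ.2, mul_one, Real.norm_of_nonneg hr0.le, smul_smul,
    inv_mul_cancel₀ hr0.ne', one_smul] at hr

/-- A null set of distances is not met, for almost every direction, by the distance to a fixed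
point of the sphere. Along a line parallel to `θ'` this distance is a function of the
parameter which has a differentiable inverse. -/
lemma ae_norm_direction_sub (hn : 2 ≤ n) {P : ℝ → Prop} (hP : MeasurableSet {r | P r})
    (h : ∀ᵐ r ∂(volume.restrict (Set.Ioi (0 : ℝ))), P r) (e : UnitSphere n) :
    ∀ᵐ x : Rn n, P ‖‖x‖⁻¹ • x - (e : Rn n)‖ := by
  have he : ‖(e : Rn n)‖ = 1 := mem_sphere_zero_iff_norm.1 e.2
  set L : ℝ →ₗ[ℝ] Rn n := LinearMap.toSpanSingleton ℝ (Rn n) e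
  set V : Submodule ℝ (Rn n) := ℝ ∙ (e : Rn n)
  have hV : V ≠ ⊤ := by
    intro hV
    have h1 := finrank_span_le_card (R := ℝ) ({(e : Rn n)} : Set (Rn n))
    change Module.finrank ℝ V ≤ _ at h1
    rw [hV, finrank_top, finrank_euclideanSpace_fin] at h1
    simp at h1
    omega
  have hVm : MeasurableSet (V : Set (Rn n)) := V.closed_of_finiteDimensional.measurableSet
  have hm : Measurable fun x : Rn n => ‖‖x‖⁻¹ • x - (e : Rn n)‖ := by fun_prop
  have hs : MeasurableSet ({x : Rn n | P ‖‖x‖⁻¹ • x - (e : Rn n)‖} ∪ V) :=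
    (hm hP).union hVm
  have key : ∀ y : Rn n, ∀ᵐ t : ℝ, y + L t ∈ {x : Rn n | P ‖‖x‖⁻¹ • x - (e : Rn n)‖} ∪ (V : Set (Rn n)) := by
    intro y
    by_cases hy : y ∈ V
    · refine .of_forall fun t => Or.inr ?_
      exact V.add_mem hy (V.smul_mem t (Submodule.mem_span_singleton_self _))
    set a := inner ℝ y (e : Rn n)
    have hb2 : 0 < ‖y‖ ^ 2 - a ^ 2 := by
      have h1 : ‖y - a • (e : Rn n)‖ ^ 2 = ‖y‖ ^ 2 - a ^ 2 := by
        rw [norm_sub_sq_real, inner_smul_right, norm_smul, he, mul_one, Real.norm_eq_abs, sq_abs]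
        ring
      rw [← h1]
      have : y - a • (e : Rn n) ≠ 0 := fun h0 => hy (by
        rw [sub_eq_zero.1 h0]
        exact V.smul_mem a (Submodule.mem_span_singleton_self _))
      positivity
    set b := √(‖y‖ ^ 2 - a ^ 2)
    have hb : 0 < b := Real.sqrt_pos.2 hb2
    have hbb : b ^ 2 = ‖y‖ ^ 2 - a ^ 2 := Real.sq_sqrt hb2.le
    -- the inverse of the distance function along the line
    set ψ : ℝ → ℝ := fun ρ => b * (1 - ρ ^ 2 / 2) / √(1 - (1 - ρ ^ 2 / 2) ^ 2) - a
    set B : Set ℝ := {ρ | ¬ P ρ} ∩ Set.Ioo 0 2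
    have hB : volume B = 0 := by
      have h2 : volume ({ρ | ¬ P ρ} ∩ Set.Ioi (0 : ℝ)) = 0 := by
        rw [← Measure.restrict_apply (by simpa [Set.compl_ofPred] using hP.compl)]
        exact h
      exact measure_mono_null (Set.inter_subset_inter_right _ Set.Ioo_subset_Ioi_self) h2
    have hpos : ∀ ρ ∈ Set.Ioo (0 : ℝ) 2, 0 < 1 - (1 - ρ ^ 2 / 2) ^ 2 := fun ρ hρ => by
      have h3 : 0 < ρ ^ 2 * (4 - ρ ^ 2) := mul_pos (by have := hρ.1; positivity) (by nlinarith [hρ.1, hρ.2])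
      nlinarith
    have hψ : DifferentiableOn ℝ ψ B := fun ρ hρ => by
      have h3 := hpos ρ hρ.2
      have h4 : DifferentiableAt ℝ (fun ρ : ℝ => √(1 - (1 - ρ ^ 2 / 2) ^ 2)) ρ :=
        DifferentiableAt.sqrt (by fun_prop) h3.ne'
      have h5 : √(1 - (1 - ρ ^ 2 / 2) ^ 2) ≠ 0 := (Real.sqrt_pos.2 h3).ne'
      exact (DifferentiableAt.sub_const (DifferentiableAt.div (by fun_prop) h4 h5) a).differentiableWithinAt
    have hψB := addHaar_image_eq_zero_of_differentiableOn_of_addHaar_eq_zero volume hψ hB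
    refine measure_mono_null (fun t ht => ?_) hψB
    have ht1 : ¬ P ‖‖y + L t‖⁻¹ • (y + L t) - (e : Rn n)‖ := fun h' => ht (Or.inl h')
    set x := y + L t
    set l := ‖x‖
    have hLt : L t = t • (e : Rn n) := LinearMap.toSpanSingleton_apply ..
    have hl2 : l ^ 2 = b ^ 2 + (a + t) ^ 2 := by
      simp only [l, x]
      rw [hLt, norm_add_sq_real, inner_smul_right, norm_smul, he, mul_one, Real.norm_eq_abs, sq_abs,
        hbb]
      change ‖y‖ ^ 2 + 2 * (t * a) + t ^ 2 = _
      ring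
    have hl : 0 < l := by
      have : l ≠ 0 := fun h0 => by
        rw [h0] at hl2
        nlinarith [sq_nonneg (a + t), pow_pos hb 2]
      exact lt_of_le_of_ne (norm_nonneg _) this.symm
    have hxe : inner ℝ x (e : Rn n) = a + t := by
      simp only [x]
      rw [hLt, inner_add_left, inner_smul_left, real_inner_self_eq_norm_sq, he]
      simp [a]
    set ρ := ‖l⁻¹ • x - (e : Rn n)‖
    have hρ2 : ρ ^ 2 = 2 - 2 * ((a + t) / l) := by
      simp only [ρ]
      rw [norm_sub_sq_real, inner_smul_left, hxe, norm_smul, norm_inv, Real.norm_of_nonneg hl.le,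
        he]
      change (l⁻¹ * l) ^ 2 - _ + _ = _
      rw [inv_mul_cancel₀ hl.ne']
      simp
      ring
    have hu : 1 - ρ ^ 2 / 2 = (a + t) / l := by rw [hρ2]; ring
    have h1u : 1 - ((a + t) / l) ^ 2 = (b / l) ^ 2 := by
      field_simp
      linarith
    have hbl : 0 < b / l := div_pos hb hl
    have hρ0 : 0 ≤ ρ := norm_nonneg _
    have habs : ((a + t) / l) ^ 2 < 1 := by nlinarith [pow_pos hbl 2]
    have h6 := abs_lt.1 ((sq_lt_one_iff_abs_lt_one _).1 habs)
    refine ⟨ρ, ⟨ht1, ?_, ?_⟩, ?_⟩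
    · refine lt_of_le_of_ne hρ0 fun h0 => ?_
      rw [← h0] at hρ2
      linarith [h6.2]
    · nlinarith [h6.1]
    · simp only [ψ]
      rw [hu, h1u, Real.sqrt_sq hbl.le]
      field_simp
      ring
  have h1 := ae_mem_of_ae_add_linearMap_mem L volume volume hs key
  have h2 : ∀ᵐ x : Rn n, x ∉ V := by
    have := Measure.addHaar_submodule (volume : Measure (Rn n)) V hV
    exact compl_mem_ae_iff.2 this
  filter_upwards [h1, h2] with x hx1 hx2
  exact hx1.resolve_right hx2

/-- A property of the norm which holds almost everywhere in `ℝⁿ` holds for almost all chords of the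
sphere. -/
lemma ae_norm_sub_sphere (hn : 2 ≤ n) {P : ℝ → Prop} (hP : MeasurableSet {r | P r})
    (h : ∀ᵐ x : Rn n, P ‖x‖) : ∀ᵐ z : UnitSphere n × UnitSphere n
      ∂((sphereMeasure n).prod (sphereMeasure n)), P ‖(z.1 : Rn n) - (z.2 : Rn n)‖ := by
  have hn1 : 1 ≤ n := by omega
  have h1 := ae_Ioi_of_ae_norm hn1 h
  have hm : MeasurableSet {z : UnitSphere n × UnitSphere n | P ‖(z.1 : Rn n) - (z.2 : Rn n)‖} := by
    have : Continuous fun z : UnitSphere n × UnitSphere n => ‖(z.1 : Rn n) - (z.2 : Rn n)‖ := by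
      fun_prop
    exact this.measurable hP
  rw [Measure.ae_prod_iff_ae_ae hm]
  refine .of_forall fun θ => ?_
  have h2 := ae_sphere_of_ae_direction (Q := fun x => P ‖x - (θ : Rn n)‖) (ae_norm_direction_sub hn hP h1 θ)
  filter_upwards [h2] with θ' hθ'
  rwa [norm_sub_rev]

/-- A spherical cap of radius `δ` has measure `O(δ^{n-1})`: the cone over it is covered by `O(δ⁻¹)` balls
of radius `2δ`. -/
lemma exists_sphereMeasure_cap_le (hn : 1 ≤ n) : ∃ C : ℝ, 0 ≤ C ∧ ∀ (e : UnitSphere n) (δ : ℝ),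
    0 < δ → δ ≤ 1 → (sphereMeasure n).real {θ | ‖(θ : Rn n) - (e : Rn n)‖ < δ} ≤ C * δ ^ (n - 1) := by
  set v := (volume : Measure (Rn n)).real (Metric.closedBall 0 1)
  have hv : 0 ≤ v := measureReal_nonneg
  refine ⟨n * (3 * 2 ^ n * v), by positivity, fun e δ hδ hδ1 => ?_⟩
  have he : ‖(e : Rn n)‖ = 1 := mem_sphere_zero_iff_norm.1 e.2
  set A : Set (UnitSphere n) := {θ | ‖(θ : Rn n) - (e : Rn n)‖ < δ}
  have hA : MeasurableSet A := (isOpen_lt (by fun_prop) continuous_const).measurableSet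
  set m := ⌈δ⁻¹⌉₊
  have hm0 : 0 < m := Nat.ceil_pos.2 (by positivity)
  have hm1 : δ⁻¹ ≤ m := Nat.le_ceil _
  have hm2 : (m : ℝ) < δ⁻¹ + 1 := Nat.ceil_lt_add_one (by positivity)
  have hmpos : (0 : ℝ) < m := by exact_mod_cast hm0
  have hminv : (m : ℝ)⁻¹ ≤ δ := inv_le_of_inv_le₀ hδ hm1
  have hsub : Set.Ioo (0 : ℝ) 1 • ((↑) '' A : Set (Rn n)) ⊆
      ⋃ i ∈ Finset.range (m + 1), Metric.closedBall (((i : ℝ) / m) • (e : Rn n)) (2 * δ) := by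
    rintro _ ⟨r, hr, _, ⟨θ, hθ, rfl⟩, rfl⟩
    have hi : ⌊r * m⌋₊ ≤ m := Nat.floor_le_of_le (by nlinarith [hr.2])
    simp only [Set.mem_iUnion]
    refine ⟨⌊r * m⌋₊, Finset.mem_range.2 (by omega), ?_⟩
    rw [Metric.mem_closedBall, dist_eq_norm]
    have h1 : |r - (⌊r * m⌋₊ : ℝ) / m| ≤ δ := by
      have h2 : (⌊r * m⌋₊ : ℝ) ≤ r * m := Nat.floor_le (by have := hr.1; positivity)
      have h3 : r * m < ⌊r * m⌋₊ + 1 := Nat.lt_floor_add_one _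
      have h4 : r - (⌊r * m⌋₊ : ℝ) / m = (r * m - ⌊r * m⌋₊) * (m : ℝ)⁻¹ := by field_simp
      rw [h4, abs_of_nonneg (mul_nonneg (by linarith) (by positivity))]
      refine le_trans ?_ hminv
      exact mul_le_of_le_one_left (by positivity) (by linarith)
    have h5 : r • (θ : Rn n) - ((⌊r * m⌋₊ : ℝ) / m) • (e : Rn n) =
        r • ((θ : Rn n) - e) + (r - (⌊r * m⌋₊ : ℝ) / m) • (e : Rn n) := by
      rw [smul_sub, sub_smul]; abel
    have hθ' : ‖(θ : Rn n) - (e : Rn n)‖ < δ := hθ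
    calc _ ≤ ‖r • ((θ : Rn n) - (e : Rn n))‖ + ‖(r - (⌊r * m⌋₊ : ℝ) / m) • (e : Rn n)‖ := by
          change ‖r • (θ : Rn n) - ((⌊r * m⌋₊ : ℝ) / m) • (e : Rn n)‖ ≤ _
          rw [h5]; exact norm_add_le _ _
      _ ≤ 2 * δ := by
          rw [norm_smul, norm_smul, he, mul_one, Real.norm_of_nonneg hr.1.le, Real.norm_eq_abs]
          nlinarith [hr.1, hr.2, norm_nonneg ((θ : Rn n) - (e : Rn n))]
  have h1 : (sphereMeasure n).real A =
      n * (volume : Measure (Rn n)).real (Set.Ioo (0 : ℝ) 1 • ((↑) '' A : Set (Rn n))) := by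
    rw [measureReal_def, Measure.toSphere_apply' _ hA, finrank_euclideanSpace_fin,
      ENNReal.toReal_mul, ENNReal.toReal_natCast, measureReal_def]
  have h2 : (volume : Measure (Rn n)).real (Set.Ioo (0 : ℝ) 1 • ((↑) '' A : Set (Rn n))) ≤
      (m + 1) * ((2 * δ) ^ n * v) := by
    refine (measureReal_mono hsub ?_).trans ((measureReal_biUnion_finset_le _ _).trans ?_)
    · exact ((measure_biUnion_finset_le _ _).trans_lt
        (ENNReal.sum_lt_top.2 fun i _ => measure_closedBall_lt_top)).ne
    · simp_rw [Measure.addHaar_real_closedBall' (volume : Measure (Rn n)) _ (by positivity : 0 ≤ 2 * δ),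
        finrank_euclideanSpace_fin]
      rw [Finset.sum_const, Finset.card_range, nsmul_eq_mul]
      push_cast
      rfl
  rw [h1, mul_assoc]
  refine mul_le_mul_of_nonneg_left (h2.trans ?_) (Nat.cast_nonneg _)
  have h3 : (m : ℝ) + 1 ≤ 3 * δ⁻¹ := by
    have : 1 ≤ δ⁻¹ := (one_le_inv₀ hδ).2 hδ1
    linarith
  have h4 : δ⁻¹ * δ ^ n = δ ^ (n - 1) := by
    obtain ⟨k, rfl⟩ : ∃ k, n = k + 1 := ⟨n - 1, by omega⟩
    rw [pow_succ', inv_mul_cancel_left₀ hδ.ne', Nat.add_sub_cancel]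
  calc ((m : ℝ) + 1) * ((2 * δ) ^ n * v) ≤ 3 * δ⁻¹ * ((2 * δ) ^ n * v) := by gcongr
    _ = 3 * 2 ^ n * v * (δ⁻¹ * δ ^ n) := by rw [mul_pow]; ring
    _ = _ := by rw [h4]

/-! ### Lebesgue differentiation along the smoothing kernels -/

lemma integral_scaledBump {ε : ℝ} (hε : 0 < ε) (x₀ : Rn n) : ∫ x, scaledBump ε x₀ x = 1 := by
  have h := fourierInt_scaledBump hε x₀ 0
  simp only [fourierInt, inner_zero_right, Complex.ofReal_zero, mul_zero, Complex.exp_zero, mul_one,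
    smul_zero, bumpFT_zero] at h
  rw [integral_complex_ofReal] at h
  exact_mod_cast h

lemma tendsto_one_div_add_nhdsGT : Tendsto (fun j : ℕ => 1 / ((j : ℝ) + 1)) atTop (𝓝[>] 0) :=
  tendsto_nhdsWithin_iff.2 ⟨tendsto_one_div_add_atTop_nhds_zero_nat,
    .of_forall fun j => Set.mem_Ioi.2 (by positivity)⟩

lemma ae_tendsto_integral_mul_scaledBump_of_locallyIntegrable {f : Rn n → ℝ}
    (hf : LocallyIntegrable f) : ∀ᵐ x : Rn n,
      Tendsto (fun j : ℕ => ∫ y, f y * scaledBump (1 / ((j : ℝ) + 1)) x y) atTop (𝓝 (f x)) := by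
  obtain ⟨C, hC⟩ := exists_bump_le (n := n)
  set v := (volume : Measure (Rn n)).real (Metric.closedBall 0 1)
  filter_upwards [IsUnifLocDoublingMeasure.ae_tendsto_average_norm_sub volume hf 1] with x hx
  have h1 := hx (l := atTop) (fun _ : ℕ => x) (fun j : ℕ => 1 / ((j : ℝ) + 1))
    tendsto_one_div_add_nhdsGT (.of_forall fun j => Metric.mem_closedBall_self (by positivity))
  rw [tendsto_iff_norm_sub_tendsto_zero]
  have h2 := h1.const_mul (C * v)
  rw [mul_zero] at h2
  refine squeeze_zero (fun _ => norm_nonneg _) (fun j => ?_) h2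
  set ε : ℝ := 1 / ((j : ℝ) + 1)
  have hε : 0 < ε := by positivity
  have hbc := (contDiff_scaledBump ε x).continuous
  have hbs := hasCompactSupport_scaledBump hε x
  have hbi : Integrable (scaledBump ε x) := hbc.integrable_of_hasCompactSupport hbs
  have hfi : Integrable fun y => f y * scaledBump ε x y := by
    have := hf.integrable_smul_left_of_hasCompactSupport hbc hbs
    simpa [mul_comm] using this
  have h3 : (∫ y, f y * scaledBump ε x y) - f x = ∫ y, (f y - f x) * scaledBump ε x y := by
    simp_rw [sub_mul]
    rw [integral_sub hfi (hbi.const_mul _), integral_const_mul, integral_scaledBump hε, mul_one]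
  have hfb : IntegrableOn (fun y => ‖f y - f x‖) (Metric.closedBall x ε) :=
    ((hf.integrableOn_isCompact (isCompact_closedBall x ε)).sub
      (integrableOn_const (measure_closedBall_lt_top.ne))).norm
  have h4 : ∫ y, ‖(f y - f x) * scaledBump ε x y‖ ≤
      ∫ y in Metric.closedBall x ε, C * (ε ^ n)⁻¹ * ‖f y - f x‖ := by
    rw [← setIntegral_eq_integral_of_forall_compl_eq_zero (s := Metric.closedBall x ε)]
    · refine integral_mono_of_nonneg (.of_forall fun y => norm_nonneg _) (hfb.const_mul _)
        (.of_forall fun y => ?_)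
      simp only
      rw [norm_mul, mul_comm, Real.norm_of_nonneg (scaledBump_nonneg hε _ _)]
      refine mul_le_mul_of_nonneg_right ?_ (norm_nonneg _)
      rw [scaledBump, mul_comm]
      exact mul_le_mul_of_nonneg_right (hC _) (by positivity)
    · intro y hy
      rw [scaledBump_eq_zero hε hy, mul_zero, norm_zero]
  have hvol : (volume : Measure (Rn n)).real (Metric.closedBall x ε) = ε ^ n * v := by
    rw [Measure.addHaar_real_closedBall' _ _ hε.le, finrank_euclideanSpace_fin]
  have h5 : ∫ y in Metric.closedBall x ε, ‖f y - f x‖ =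
      ε ^ n * v * ⨍ y in Metric.closedBall x ε, ‖f y - f x‖ := by
    have hvp : (volume : Measure (Rn n)).real (Metric.closedBall x ε) ≠ 0 :=
      (ENNReal.toReal_pos (Metric.measure_closedBall_pos _ _ hε).ne'
        measure_closedBall_lt_top.ne).ne'
    rw [setAverage_eq, smul_eq_mul, ← hvol, mul_inv_cancel_left₀ hvp]
  rw [h3]
  refine (norm_integral_le_integral_norm _).trans (h4.trans_eq ?_)
  rw [integral_const_mul, h5]
  field_simp

/-- Lebesgue differentiation for functions which need not be integrable near the origin. -/
lemma ae_tendsto_integral_mul_scaledBump (hn : 1 ≤ n) {f : Rn n → ℝ}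
    (hf : LocallyIntegrableOn f {x : Rn n | x ≠ 0}) : ∀ᵐ x : Rn n,
      Tendsto (fun j : ℕ => ∫ y, f y * scaledBump (1 / ((j : ℝ) + 1)) x y) atTop (𝓝 (f x)) := by
  have hopen : IsOpen {x : Rn n | x ≠ 0} := isOpen_ne
  set s : ℕ → Set (Rn n) := fun m => {x | 1 / ((m : ℝ) + 1) ≤ ‖x‖}
  have hs : ∀ m, IsClosed (s m) := fun m => isClosed_le continuous_const continuous_norm
  have hloc : ∀ m, LocallyIntegrable ((s m).indicator f) := fun m => by
    rw [locallyIntegrable_iff]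
    intro K hK
    rw [IntegrableOn, integrable_indicator_iff (hs m).measurableSet, IntegrableOn,
      Measure.restrict_restrict (hs m).measurableSet]
    refine hf.integrableOn_compact_subset (fun x hx => ?_) (hK.inter_left (hs m))
    have h1 : 1 / ((m : ℝ) + 1) ≤ ‖x‖ := hx.1
    exact norm_pos_iff.1 (lt_of_lt_of_le (by positivity) h1)
  have h := ae_all_iff.2 fun m => ae_tendsto_integral_mul_scaledBump_of_locallyIntegrable (hloc m)
  filter_upwards [h, ae_ne_zero hn] with x hx hx0
  have hxp : 0 < ‖x‖ / 2 := by have := norm_pos_iff.2 hx0; positivity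
  obtain ⟨m, hm⟩ := exists_nat_one_div_lt hxp
  have hxs : x ∈ s m := by change 1 / ((m : ℝ) + 1) ≤ ‖x‖; linarith
  have h1 := hx m
  rw [Set.indicator_of_mem hxs] at h1
  refine h1.congr' ?_
  filter_upwards [tendsto_one_div_add_atTop_nhds_zero_nat.eventually (gt_mem_nhds hxp)] with j hj
  refine integral_congr_ae (.of_forall fun y => ?_)
  simp only
  by_cases hy : y ∈ Metric.closedBall x (1 / ((j : ℝ) + 1))
  · have : y ∈ s m := by
      change 1 / ((m : ℝ) + 1) ≤ ‖y‖
      rw [Metric.mem_closedBall, dist_eq_norm] at hy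
      have := norm_sub_norm_le x y
      rw [norm_sub_rev] at this
      linarith
    rw [Set.indicator_of_mem this]
  · rw [scaledBump_eq_zero (by positivity) hy, mul_zero, mul_zero]

end
end

noncomputable section

section
variable {n : ℕ}
open MvPolynomial

/-! ### Strict maximality of `λ₀` -/

lemma exists_harmonicPoly_ne_zero (hn : 2 ≤ n) (k : ℕ) :
    ∃ p ∈ harmonicPoly n k, ∃ θ : UnitSphere n, polyVal p (θ : Rn n) ≠ 0 := by
  set i : Fin n := ⟨0, by omega⟩
  set j : Fin n := ⟨1, by omega⟩
  have hij : i ≠ j := by simp [i, j]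
  set l : MvPolynomial (Fin n) ℂ := X i + C Complex.I * X j
  have hl : l.IsHomogeneous 1 := (isHomogeneous_X _ _).add (isHomogeneous_C_mul_X _ _)
  have hd : ∀ m : Fin n, pderiv m l = C ((if m = i then 1 else 0) + Complex.I * if m = j then 1 else 0) :=
    fun m => by
      simp only [l, map_add, pderiv_C_mul, pderiv_X, Pi.single_apply, map_mul]
      simp only [eq_comm (a := m)]
      split_ifs <;> simp
  refine ⟨l ^ k, ?_, ⟨EuclideanSpace.single i 1, by simp⟩, ?_⟩
  · rw [mem_harmonicPoly]
    refine ⟨by simpa using hl.pow k, ?_⟩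
    have h2 : ∀ m, pderiv m (pderiv m (l ^ k)) = (k : MvPolynomial (Fin n) ℂ) *
        (((k - 1 : ℕ) : MvPolynomial (Fin n) ℂ) * l ^ (k - 1 - 1)) * (pderiv m l) ^ 2 := fun m => by
      rw [pderiv_pow, pderiv_mul, hd, pderiv_C, mul_zero, add_zero, ← hd, pderiv_mul, pderiv_pow,
        Derivation.map_natCast]
      ring
    rw [polyLap_apply, Finset.sum_congr rfl fun m _ => h2 m, ← Finset.mul_sum]
    have h3 : ∑ m, (pderiv m l) ^ 2 = 0 := by
      have h4 : ∀ m, (pderiv m l) ^ 2 = C ((if m = i then 1 else 0) - if m = j then 1 else 0) :=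
        fun m => by
          rw [hd, ← C_pow]
          congr 1
          by_cases hmi : m = i
          · subst hmi; simp [hij]
          · by_cases hmj : m = j
            · subst hmj; simp [hij.symm]
            · simp [hmi, hmj]
      simp_rw [h4]
      rw [← map_sum]
      simp
    rw [h3, mul_zero]
  · simp [polyVal, l, hij.symm]

lemma exists_norm_polyVal_sub_le (p : MvPolynomial (Fin n) ℂ) :
    ∃ L : ℝ, 0 ≤ L ∧ ∀ θ θ' : UnitSphere n,
      ‖polyVal p (θ : Rn n) - polyVal p (θ' : Rn n)‖ ≤ L * ‖(θ : Rn n) - (θ' : Rn n)‖ := by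
  have hc := contDiff_polyVal p
  have hcd : Continuous (fderiv ℝ (polyVal p)) := hc.continuous_fderiv one_ne_zero
  obtain ⟨L, hL⟩ := (isCompact_closedBall (0 : Rn n) 1).exists_bound_of_continuousOn hcd.continuousOn
  refine ⟨|L|, abs_nonneg _, fun θ θ' => ?_⟩
  refine (convex_closedBall (0 : Rn n) 1).norm_image_sub_le_of_norm_fderiv_le (𝕜 := ℝ)
    (fun x _ => (hc.differentiable one_ne_zero).differentiableAt)
    (fun x hx => (hL x hx).trans (le_abs_self _)) ?_ ?_
  · exact Metric.sphere_subset_closedBall θ'.2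
  · exact Metric.sphere_subset_closedBall θ.2

lemma exists_prod_cap_le (hn : 1 ≤ n) : ∃ C : ℝ, 0 ≤ C ∧ ∀ δ : ℝ, 0 < δ → δ ≤ 1 →
    ((sphereMeasure n).prod (sphereMeasure n)).real
      {z | ‖(z.1 : Rn n) - (z.2 : Rn n)‖ < δ} ≤ C * δ ^ (n - 1) := by
  obtain ⟨C, hC, h⟩ := exists_sphereMeasure_cap_le hn
  refine ⟨C * (sphereMeasure n).real Set.univ, by positivity, fun δ hδ hδ1 => ?_⟩
  have hm : MeasurableSet {z : UnitSphere n × UnitSphere n | ‖(z.1 : Rn n) - (z.2 : Rn n)‖ < δ} :=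
    (isOpen_lt (by fun_prop) continuous_const).measurableSet
  rw [measureReal_def, Measure.prod_apply_symm hm]
  refine ENNReal.toReal_le_of_le_ofReal (by positivity) ?_
  calc _ ≤ ∫⁻ _ : UnitSphere n, ENNReal.ofReal (C * δ ^ (n - 1)) ∂(sphereMeasure n) := by
        refine lintegral_mono fun θ => ?_
        rw [ENNReal.le_ofReal_iff_toReal_le (measure_ne_top _ _) (by positivity)]
        exact h θ δ hδ hδ1
    _ = _ := by
        rw [lintegral_const, mul_right_comm, ENNReal.ofReal_mul (p := C * δ ^ (n - 1)) (by positivity),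
          measureReal_def, ENNReal.ofReal_toReal (measure_ne_top _ _)]

/-- The kernel `|f(θ) - f(θ')|²` and its pairing with `ŵ`, in the limit of vanishing smoothing. -/
lemma tendsto_integral_norm_sub_sq_mul_fourierInt (hn : 2 ≤ n) {w : ℝ → ℝ}
    (hpos : ∀ r : ℝ, 0 < r → 0 < w r) {N : ℕ}
    (hw : Integrable (fun ξ : Rn n => w ‖ξ‖ * ((1 + ‖ξ‖) ^ N)⁻¹))
    (hint : ∀ k, Integrable (fun ξ : Rn n => w ‖ξ‖ * besselProfile n k ‖ξ‖ ^ 2))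
    {k : ℕ} {p : MvPolynomial (Fin n) ℂ} (hp : p ∈ harmonicPoly n k) :
    Tendsto (fun j : ℕ => ∫ z : UnitSphere n × UnitSphere n,
        ((‖polyVal p (z.1 : Rn n) - polyVal p (z.2 : Rn n)‖ ^ 2 : ℝ) : ℂ) *
          fourierInt (mollWeight w (1 / ((j : ℝ) + 1))) ((z.1 : Rn n) - (z.2 : Rn n))
            ∂((sphereMeasure n).prod (sphereMeasure n)))
      atTop (𝓝 ((2 * (2 * Real.pi) ^ n * (lambdaCoeff n w 0 - lambdaCoeff n w k) *
        ∫ θ : UnitSphere n, ‖polyVal p (θ : Rn n)‖ ^ 2 ∂(sphereMeasure n) : ℝ) : ℂ)) := by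
  have hwm := aestronglyMeasurable_weight hw
  obtain ⟨D, -, hD⟩ := exists_integral_mollWeight_le (n := n) (by omega) hpos hw
  set c : ℝ := ∫ θ : UnitSphere n, ‖polyVal p (θ : Rn n)‖ ^ 2 ∂(sphereMeasure n)
  set pb := conjPoly p
  set q := p * pb
  have hpb : pb ∈ harmonicPoly n k := conjPoly_mem_harmonicPoly hp
  have hq : ∀ x : Rn n, polyVal q x = ((‖polyVal p x‖ ^ 2 : ℝ) : ℂ) := fun x => by
    rw [polyVal_mul, polyVal_conjPoly, Complex.mul_conj, Complex.normSq_eq_norm_sq]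
  set Q : MvPolynomial (Fin n) ℂ → MvPolynomial (Fin n) ℂ → Rn n → ℂ := fun a b ξ =>
    sphereFT (fun θ => polyVal a (θ : Rn n)) ξ *
      starRingEnd ℂ (sphereFT (fun θ => polyVal b (θ : Rn n)) ξ)
  have hQi : ∀ a b, Integrable fun ξ => (w ‖ξ‖ : ℂ) * Q a b ξ := fun a b =>
    integrable_weight_mul_sphereFT_mul hn hpos hwm hint a b
  have hQc : ∀ a b, Continuous (Q a b) := fun a b => (continuous_sphereFT_polyVal a).mul
    (Complex.continuous_conj.comp (continuous_sphereFT_polyVal b))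
  have hε : ∀ k : ℕ, 0 < 1 / ((k : ℝ) + 1) ∧ 1 / ((k : ℝ) + 1) ≤ 1 := fun k =>
    ⟨by positivity, by rw [div_le_one (by positivity)]; linarith [(k.cast_nonneg : (0 : ℝ) ≤ k)]⟩
  -- each elementary pairing converges by dominated convergence
  have hlim : ∀ a b, Tendsto (fun j : ℕ => ∫ z : UnitSphere n × UnitSphere n,
      (polyVal a (z.1 : Rn n) * starRingEnd ℂ (polyVal b (z.2 : Rn n))) *
        fourierInt (mollWeight w (1 / ((j : ℝ) + 1))) ((z.1 : Rn n) - (z.2 : Rn n))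
          ∂((sphereMeasure n).prod (sphereMeasure n))) atTop
      (𝓝 (∫ ξ, (w ‖ξ‖ : ℂ) * Q a b ξ)) := fun a b => by
    have e : ∀ j : ℕ, ∫ z : UnitSphere n × UnitSphere n,
      (polyVal a (z.1 : Rn n) * starRingEnd ℂ (polyVal b (z.2 : Rn n))) *
        fourierInt (mollWeight w (1 / ((j : ℝ) + 1))) ((z.1 : Rn n) - (z.2 : Rn n))
          ∂((sphereMeasure n).prod (sphereMeasure n)) =
        ∫ ξ, mollWeight w (1 / ((j : ℝ) + 1)) ξ * Q a b ξ := fun j =>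
      integral_prod_mul_fourierInt (hD _ (hε j).1 (hε j).2).1
        (integrable_of_continuous_sphere (continuous_polyVal_sphere a))
        (integrable_of_continuous_sphere (continuous_polyVal_sphere b))
    simp_rw [e]
    refine tendsto_integral_of_dominated_convergence (fun ξ => ‖(w ‖ξ‖ : ℂ) * Q a b ξ‖)
      (fun j => ((hD _ (hε j).1 (hε j).2).1.1.mul (hQc a b).aestronglyMeasurable)) (hQi a b).norm
      (fun j => .of_forall fun ξ => ?_) (.of_forall fun ξ => ?_)
    · rw [mollWeight, mul_right_comm, norm_mul]
      exact mul_le_of_le_one_right (norm_nonneg _) (norm_bumpFT_le _)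
    · have := ((tendsto_bumpFT_smul ξ).const_mul (w ‖ξ‖ : ℂ)).mul_const (Q a b ξ)
      rwa [mul_one] at this
  have hint' : ∀ a b : MvPolynomial (Fin n) ℂ, ∀ j : ℕ, Integrable
      (fun z : UnitSphere n × UnitSphere n =>
      (polyVal a (z.1 : Rn n) * starRingEnd ℂ (polyVal b (z.2 : Rn n))) *
        fourierInt (mollWeight w (1 / ((j : ℝ) + 1))) ((z.1 : Rn n) - (z.2 : Rn n)))
      ((sphereMeasure n).prod (sphereMeasure n)) := fun a b j =>
    integrable_prod_of_continuous ((((continuous_polyVal_sphere a).comp continuous_fst).mul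
      (Complex.continuous_conj.comp ((continuous_polyVal_sphere b).comp continuous_snd))).mul
      (continuous_sub_fourierInt (hD _ (hε j).1 (hε j).2).1))
  have hL := (((hlim q 1).add (hlim 1 q)).sub (hlim p p)).sub (hlim pb pb)
  have hq1 : ∫ θ : UnitSphere n, polyVal q (θ : Rn n) ∂(sphereMeasure n) = (c : ℂ) := by
    simp_rw [hq]
    exact integral_complex_ofReal
  have v1 : ∫ ξ, (w ‖ξ‖ : ℂ) * Q q 1 ξ = (((2 * Real.pi) ^ n * lambdaCoeff n w 0 : ℝ) : ℂ) * c := by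
    rw [← hq1]
    exact integral_weight_mul_sphereFT_one hn hpos hwm hint q
  have v2 : ∫ ξ, (w ‖ξ‖ : ℂ) * Q 1 q ξ = (((2 * Real.pi) ^ n * lambdaCoeff n w 0 : ℝ) : ℂ) * c := by
    have e : ∀ ξ, (w ‖ξ‖ : ℂ) * Q 1 q ξ = starRingEnd ℂ ((w ‖ξ‖ : ℂ) * Q q 1 ξ) := fun ξ => by
      simp only [Q, map_mul, Complex.conj_ofReal, Complex.conj_conj]
      ring
    simp_rw [e]
    rw [integral_conj, v1, map_mul, Complex.conj_ofReal, Complex.conj_ofReal]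
  have v3 : ∫ ξ, (w ‖ξ‖ : ℂ) * Q p p ξ = (((2 * Real.pi) ^ n * lambdaCoeff n w k : ℝ) : ℂ) * c := by
    rw [← hq1]
    refine (integral_weight_mul_sphereFT_harmonic hn w hp hp).trans ?_
    simp_rw [← polyVal_conjPoly, ← polyVal_mul]
    rfl
  have v4 : ∫ ξ, (w ‖ξ‖ : ℂ) * Q pb pb ξ =
      (((2 * Real.pi) ^ n * lambdaCoeff n w k : ℝ) : ℂ) * c := by
    rw [← hq1]
    refine (integral_weight_mul_sphereFT_harmonic hn w hpb hpb).trans ?_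
    congr 1
    refine integral_congr_ae (.of_forall fun θ => ?_)
    simp only [pb, q, polyVal_mul, polyVal_conjPoly, Complex.conj_conj]
    ring
  rw [v1, v2, v3, v4] at hL
  have hval : (((2 * Real.pi) ^ n * lambdaCoeff n w 0 : ℝ) : ℂ) * c +
      (((2 * Real.pi) ^ n * lambdaCoeff n w 0 : ℝ) : ℂ) * c -
      (((2 * Real.pi) ^ n * lambdaCoeff n w k : ℝ) : ℂ) * c -
      (((2 * Real.pi) ^ n * lambdaCoeff n w k : ℝ) : ℂ) * c =
      ((2 * (2 * Real.pi) ^ n * (lambdaCoeff n w 0 - lambdaCoeff n w k) * c : ℝ) : ℂ) := by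
    push_cast
    ring
  rw [hval] at hL
  refine hL.congr fun j => ?_
  rw [← integral_add (hint' q 1 j) (hint' 1 q j)]
  refine (congrArg (· - _) (integral_sub ((hint' q 1 j).add (hint' 1 q j))
    (hint' p p j)).symm).trans ?_
  refine (integral_sub (((hint' q 1 j).add (hint' 1 q j)).sub (hint' p p j))
    (hint' pb pb j)).symm.trans ?_
  refine integral_congr_ae (.of_forall fun z => ?_)
  simp only [Pi.add_apply, Pi.sub_apply, polyVal_one, map_one, one_mul, mul_one]
  rw [← Complex.normSq_eq_norm_sq, Complex.normSq_eq_conj_mul_self]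
  simp only [q, pb, polyVal_mul, polyVal_conjPoly, map_mul, map_sub, Complex.conj_conj]
  ring

/-- After smoothing at scale `1/(j+1)` and letting `j → ∞`, `ŵ` stays bounded below by a positive
constant at almost every point; as `ŵ` is radial this is a condition on the norm only. -/
lemma ae_exists_eventually_le_fourierInt (hn : 2 ≤ n) (w : ℝ → ℝ)
    {Φ : Rn n → ℝ} (hΦ0 : ∀ x, x ≠ 0 → 0 < Φ x)
    (hΦl : LocallyIntegrableOn Φ {x : Rn n | x ≠ 0})
    (hΦ : ∀ φ : 𝓢(Rn n, ℂ), HasCompactSupport φ → (0 : Rn n) ∉ tsupport φ →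
      ∫ ξ, (w ‖ξ‖ : ℂ) * fourierInt φ ξ = ∫ x, (Φ x : ℂ) * φ x) :
    ∀ᵐ x : Rn n, ∃ m : ℕ, ∀ᶠ j : ℕ in atTop,
      1 / ((m : ℝ) + 1) ≤ (fourierInt (mollWeight w (1 / ((j : ℝ) + 1))) x).re := by
  filter_upwards [ae_tendsto_integral_mul_scaledBump (by omega) hΦl,
    ae_ne_zero (n := n) (by omega)] with x hx hx0
  have hΦx := hΦ0 x hx0
  obtain ⟨m, hm⟩ := exists_nat_one_div_lt hΦx
  refine ⟨m, ?_⟩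
  have hxp : 0 < ‖x‖ / 2 := by have := norm_pos_iff.2 hx0; positivity
  filter_upwards [hx.eventually (lt_mem_nhds hm),
    tendsto_one_div_add_atTop_nhds_zero_nat.eventually (gt_mem_nhds hxp)] with j h1 h2
  rw [fourierInt_mollWeight hΦ (by positivity) (by linarith), Complex.ofReal_re]
  exact h1.le

/-- `λ_k < λ₀` for `k ≥ 1`: the kernel `|f(θ) - f(θ')|²` is nonnegative and vanishes on the diagonal,
and its pairing with the positive function `ŵ` is `2 (2π)^n (λ₀ - λ_k) ‖f‖²`. -/
lemma lambdaCoeff_lt_lambdaCoeff_zero (hn : 2 ≤ n) {w : ℝ → ℝ}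
    (hpos : ∀ r : ℝ, 0 < r → 0 < w r)
    (hw : Integrable (fun ξ : Rn n => w ‖ξ‖ * ((1 + ‖ξ‖) ^ (n - 1))⁻¹))
    (hint : ∀ k, Integrable (fun ξ : Rn n => w ‖ξ‖ * besselProfile n k ‖ξ‖ ^ 2))
    {Φ : Rn n → ℝ} (hΦ0 : ∀ x, x ≠ 0 → 0 < Φ x)
    (hΦl : LocallyIntegrableOn Φ {x : Rn n | x ≠ 0})
    (hΦ : ∀ φ : 𝓢(Rn n, ℂ), HasCompactSupport φ → (0 : Rn n) ∉ tsupport φ →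
      ∫ ξ, (w ‖ξ‖ : ℂ) * fourierInt φ ξ = ∫ x, (Φ x : ℂ) * φ x)
    {k : ℕ} (hk : k ≠ 0) : lambdaCoeff n w k < lambdaCoeff n w 0 := by
  have hn1 : 1 ≤ n := by omega
  have : Nonempty (Fin n) := ⟨⟨0, hn1⟩⟩
  by_contra! hle
  obtain ⟨p, hp, θ₀, hθ₀⟩ := exists_harmonicPoly_ne_zero hn k
  set μ := (sphereMeasure n).prod (sphereMeasure n)
  set F : UnitSphere n × UnitSphere n → ℝ := fun z =>
    ‖polyVal p (z.1 : Rn n) - polyVal p (z.2 : Rn n)‖ ^ 2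
  set A : ℕ → Rn n → ℂ := fun j => fourierInt (mollWeight w (1 / ((j : ℝ) + 1)))
  have hFc : Continuous F := ((((continuous_polyVal_sphere p).comp continuous_fst).sub
    ((continuous_polyVal_sphere p).comp continuous_snd)).norm).pow 2
  have hF0 : ∀ z, 0 ≤ F z := fun z => sq_nonneg _
  have hε : ∀ k : ℕ, 0 < 1 / ((k : ℝ) + 1) ∧ 1 / ((k : ℝ) + 1) ≤ 1 := fun k =>
    ⟨by positivity, by rw [div_le_one (by positivity)]; linarith [(k.cast_nonneg : (0 : ℝ) ≤ k)]⟩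
  obtain ⟨D, hD0, hD⟩ := exists_integral_mollWeight_le hn1 hpos hw
  have hlim := tendsto_integral_norm_sub_sq_mul_fourierInt hn hpos hw hint hp
  have hAc : ∀ j, Continuous fun z : UnitSphere n × UnitSphere n =>
      A j ((z.1 : Rn n) - (z.2 : Rn n)) := fun j =>
    continuous_sub_fourierInt (hD _ (hε j).1 (hε j).2).1
  set H : ℕ → UnitSphere n × UnitSphere n → ℝ := fun j z =>
    F z * (A j ((z.1 : Rn n) - (z.2 : Rn n))).re
  have hHc : ∀ j, Continuous (H j) := fun j => hFc.mul (Complex.continuous_re.comp (hAc j))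
  have hHi : ∀ j, Integrable (H j) μ := fun j =>
    (hHc j).integrable_of_hasCompactSupport (HasCompactSupport.of_compactSpace _)
  have hlimH : Tendsto (fun j => ∫ z, H j z ∂μ) atTop
      (𝓝 (2 * (2 * Real.pi) ^ n * (lambdaCoeff n w 0 - lambdaCoeff n w k) *
        ∫ θ : UnitSphere n, ‖polyVal p (θ : Rn n)‖ ^ 2 ∂(sphereMeasure n))) := by
    have h1 := (Complex.continuous_re.tendsto _).comp hlim
    rw [Complex.ofReal_re] at h1
    refine h1.congr fun j => ?_
    have h2 : Integrable (fun z : UnitSphere n × UnitSphere n => ((F z : ℝ) : ℂ) *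
        A j ((z.1 : Rn n) - (z.2 : Rn n))) μ := integrable_prod_of_continuous
      ((Complex.continuous_ofReal.comp hFc).mul (hAc j))
    have h3 := integral_re h2
    simp only [RCLike.re_eq_complex_re, Complex.re_ofReal_mul] at h3
    exact h3.symm
  set near : ℕ → Set (UnitSphere n × UnitSphere n) := fun j =>
    {z | ‖(z.1 : Rn n) - (z.2 : Rn n)‖ < 2 * (1 / ((j : ℝ) + 1))}
  have hnm : ∀ j, MeasurableSet (near j) := fun j =>
    (isOpen_lt (by fun_prop) continuous_const).measurableSet
  -- the part close to the diagonal is negligible: there `F = O(ε²)`, the smoothed transform is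
  -- `O(ε^{-(n-1)})`, and the region has measure `O(ε^{n-1})`
  have hnear : Tendsto (fun j => ∫ z in near j, H j z ∂μ) atTop (𝓝 0) := by
    obtain ⟨L, hL0, hL⟩ := exists_norm_polyVal_sub_le p
    obtain ⟨C, hC0, hC⟩ := exists_prod_cap_le hn1
    have h1 : Tendsto (fun j : ℕ => 4 * L ^ 2 * D * C * 2 ^ (n - 1) * (1 / ((j : ℝ) + 1)) ^ 2) atTop
        (𝓝 0) := by
      have := (tendsto_one_div_add_atTop_nhds_zero_nat.pow 2).const_mul (4 * L ^ 2 * D * C * 2 ^ (n - 1))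
      simpa using this
    refine squeeze_zero_norm' ?_ h1
    filter_upwards [eventually_ge_atTop 1] with j hj
    set ε : ℝ := 1 / ((j : ℝ) + 1)
    have hε0 : 0 < ε := (hε j).1
    have hε2 : 2 * ε ≤ 1 := by
      have : (1 : ℝ) ≤ j := by exact_mod_cast hj
      simp only [ε]
      rw [mul_one_div, div_le_one (by positivity)]
      linarith
    have hb : ∀ z ∈ near j, ‖H j z‖ ≤ (L * (2 * ε)) ^ 2 * (D * (ε ^ (n - 1))⁻¹) := fun z hz => by
      have hz' : ‖(z.1 : Rn n) - (z.2 : Rn n)‖ < 2 * ε := hz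
      rw [norm_mul, Real.norm_of_nonneg (hF0 z), Real.norm_eq_abs]
      refine mul_le_mul ?_ ?_ (abs_nonneg _) (by positivity)
      · refine pow_le_pow_left₀ (norm_nonneg _) ((hL _ _).trans ?_) 2
        gcongr
      · exact (Complex.abs_re_le_norm _).trans ((norm_fourierInt_le _ _).trans (hD _ (hε j).1 (hε j).2).2)
    refine (norm_setIntegral_le_of_norm_le_const (measure_lt_top _ _) hb).trans ?_
    refine (mul_le_mul_of_nonneg_left (hC _ (by positivity) hε2) (by positivity)).trans_eq ?_
    rw [mul_pow 2 ε (n - 1)]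
    field_simp
    ring
  -- the remaining part is nonnegative
  set G : ℕ → UnitSphere n × UnitSphere n → ℝ := fun j => (near j)ᶜ.indicator (H j)
  have hG0 : ∀ j z, 0 ≤ G j z := fun j z => by
    refine Set.indicator_apply_nonneg fun hz => mul_nonneg (hF0 z) ?_
    have hz' : 2 * (1 / ((j : ℝ) + 1)) ≤ ‖(z.1 : Rn n) - (z.2 : Rn n)‖ := not_lt.1 hz
    obtain ⟨t, ht, h⟩ := fourierInt_mollWeight_nonneg hΦ0 hΦ (hε j).1 hz'
    simp only [A]
    rw [h, Complex.ofReal_re]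
    exact ht
  have hGi : ∀ j, Integrable (G j) μ := fun j => (hHi j).indicator (hnm j).compl
  have hGlim : Tendsto (fun j => ENNReal.ofReal (∫ z, G j z ∂μ)) atTop (𝓝 0) := by
    have h1 : ∀ j, ∫ z, G j z ∂μ = (∫ z, H j z ∂μ) - ∫ z in near j, H j z ∂μ := fun j => by
      rw [integral_indicator (hnm j).compl, ← integral_add_compl (hnm j) (hHi j)]
      ring
    have h2 := hlimH.sub hnear
    simp_rw [← h1] at h2
    have h3 := ENNReal.tendsto_ofReal h2
    rwa [ENNReal.ofReal_of_nonpos] at h3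
    rw [sub_zero]
    refine mul_nonpos_of_nonpos_of_nonneg (mul_nonpos_of_nonneg_of_nonpos (by positivity)
      (by linarith)) (integral_nonneg fun θ => sq_nonneg _)
  -- Fatou's lemma: if `λ_k ≥ λ₀` then the limit inferior vanishes almost everywhere
  have hfatou : ∫⁻ z, liminf (fun j => ENNReal.ofReal (G j z)) atTop ∂μ = 0 := by
    refine le_antisymm ((lintegral_liminf_le' fun j =>
      (hGi j).1.aemeasurable.ennreal_ofReal).trans ?_) (zero_le)
    simp_rw [← ofReal_integral_eq_lintegral_ofReal (hGi _) (.of_forall (hG0 _))]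
    rw [hGlim.liminf_eq]
  rw [lintegral_eq_zero_iff (Measurable.liminf fun j =>
    ((hHc j).measurable.indicator (hnm j).compl).ennreal_ofReal)] at hfatou
  -- almost every pair of points sees a positive value of `ŵ`
  set P : ℝ → Prop := fun r => ∃ m : ℕ, ∀ᶠ j : ℕ in atTop,
    1 / ((m : ℝ) + 1) ≤ (A j (r • (θ₀ : Rn n))).re
  have hθn : ‖(θ₀ : Rn n)‖ = 1 := mem_sphere_zero_iff_norm.1 θ₀.2
  have hArad : ∀ j x, A j (‖x‖ • (θ₀ : Rn n)) = A j x := fun j x =>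
    fourierInt_radial (fun _ _ h => mollWeight_radial w _ h) (by
      rw [norm_smul, norm_norm, hθn, mul_one])
  have hPm : MeasurableSet {r | P r} := by
    have h1 : {r | P r} = ⋃ m : ℕ, ⋃ J : ℕ, ⋂ j : ℕ, ⋂ _ : J ≤ j,
        {r : ℝ | 1 / ((m : ℝ) + 1) ≤ (A j (r • (θ₀ : Rn n))).re} := by
      ext r
      simp [P, eventually_atTop]
    rw [h1]
    refine MeasurableSet.iUnion fun m => MeasurableSet.iUnion fun J => MeasurableSet.iInter fun j =>
      MeasurableSet.iInter fun _ => (isClosed_le continuous_const ?_).measurableSet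
    exact Complex.continuous_re.comp ((continuous_fourierInt (hD _ (hε j).1 (hε j).2).1).comp
      (by fun_prop))
  have hP : ∀ᵐ x : Rn n, P ‖x‖ := by
    filter_upwards [ae_exists_eventually_le_fourierInt hn w hΦ0 hΦl hΦ] with x hx
    simp only [P, hArad]
    exact hx
  have hne : ∀ᵐ x : Rn n, 0 < ‖x‖ := by
    filter_upwards [ae_ne_zero hn1] with x hx
    exact norm_pos_iff.2 hx
  have hF : F =ᵐ[μ] fun _ => 0 := by
    filter_upwards [hfatou, ae_norm_sub_sphere hn hPm hP,
      ae_norm_sub_sphere hn measurableSet_Ioi hne] with z h1 h2 h3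
    obtain ⟨m, hm⟩ := h2
    by_contra hFz
    have hFz' : 0 < F z := lt_of_le_of_ne (hF0 z) (Ne.symm hFz)
    have h4 : ENNReal.ofReal (F z * (1 / ((m : ℝ) + 1))) ≤
        liminf (fun j => ENNReal.ofReal (G j z)) atTop := by
      refine le_liminf_of_le (by isBoundedDefault) ?_
      have h3' : 0 < ‖(z.1 : Rn n) - (z.2 : Rn n)‖ / 2 := half_pos h3
      filter_upwards [hm, tendsto_one_div_add_atTop_nhds_zero_nat.eventually (gt_mem_nhds h3')]
        with j h5 h6
      have h7 : z ∈ (near j)ᶜ := by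
        change ¬ ‖(z.1 : Rn n) - (z.2 : Rn n)‖ < 2 * (1 / ((j : ℝ) + 1))
        linarith
      simp only [G]
      rw [Set.indicator_of_mem h7]
      rw [hArad] at h5
      exact ENNReal.ofReal_le_ofReal (mul_le_mul_of_nonneg_left h5 (hF0 z))
    rw [h1] at h4
    have h5 : 0 < ENNReal.ofReal (F z * (1 / ((m : ℝ) + 1))) := ENNReal.ofReal_pos.2 (by positivity)
    exact absurd h4 (not_le.2 h5)
  have hF' : F = fun _ => 0 := Continuous.ae_eq_iff_eq μ hFc continuous_const |>.1 hF
  have hconst : ∀ θ : UnitSphere n, polyVal p (θ : Rn n) = polyVal p (θ₀ : Rn n) := fun θ => by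
    have h1 : F (θ, θ₀) = 0 := congrFun hF' (θ, θ₀)
    exact sub_eq_zero.1 (norm_eq_zero.1 (pow_eq_zero_iff two_ne_zero |>.1 h1))
  have h1 := integral_harmonic_mul_eq_zero hn1 hk hp (one_mem_harmonicPoly (n := n))
  simp only [hconst, polyVal_one, mul_one] at h1
  rw [integral_const, smul_eq_zero] at h1
  rcases h1 with h1 | h1
  · have : (sphereMeasure n).real Set.univ ≠ 0 := by
      rw [measureReal_ne_zero_iff]
      exact fun h0 => Measure.toSphere_ne_zero (volume : Measure (Rn n)) (Measure.measure_univ_eq_zero.1 h0)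
    exact this h1
  · exact hθ₀ h1

end
end

noncomputable section

/-! ### Spectral decomposition and stability of an operator norm inequality -/

section
variable {X H : Type*} [NormedAddCommGroup X] [InnerProductSpace ℂ X]
  [NormedAddCommGroup H] [InnerProductSpace ℂ H]

lemma infDist_diff_zero {W : Submodule ℂ X} [CompleteSpace W] (hW : W ≠ ⊥) (g : X) :
    Metric.infDist g {x | x ≠ 0 ∧ x ∈ W} = ‖g - W.starProjection g‖ := by
  obtain ⟨x, hx, hx0⟩ := Submodule.exists_mem_ne_zero_of_ne_bot hW
  have hne : {x | x ≠ 0 ∧ x ∈ W}.Nonempty := ⟨x, hx0, hx⟩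
  refine le_antisymm ?_ ?_
  · have hcl : W.starProjection g ∈ closure {x | x ≠ 0 ∧ x ∈ W} := by
      by_cases h : W.starProjection g = 0
      · rw [h]
        have h1 : Tendsto (fun k : ℕ => ((1 / ((k : ℝ) + 1) : ℝ) : ℂ) • x) atTop
            (𝓝 (((0 : ℝ) : ℂ) • x)) :=
          ((Complex.continuous_ofReal.tendsto _).comp
            tendsto_one_div_add_atTop_nhds_zero_nat).smul_const x
        rw [Complex.ofReal_zero, zero_smul] at h1
        refine mem_closure_of_tendsto h1 (.of_forall fun k => ⟨smul_ne_zero ?_ hx0, W.smul_mem _ hx⟩)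
        have : (0 : ℝ) < 1 / ((k : ℝ) + 1) := by positivity
        exact_mod_cast this.ne'
      · exact subset_closure ⟨h, Submodule.starProjection_apply_mem _ _⟩
    rw [← Metric.infDist_closure, ← dist_eq_norm]
    exact Metric.infDist_le_dist_of_mem hcl
  · rw [Metric.le_infDist hne]
    rintro y ⟨-, hy⟩
    rw [dist_eq_norm, Submodule.starProjection_minimal]
    exact ciInf_le ⟨0, by rintro _ ⟨w, rfl⟩; exact norm_nonneg _⟩ (⟨y, hy⟩ : W)

lemma norm_sq_of_mem_eigen {ι : Type*} {U : ι → Submodule ℂ X} {S : X →L[ℂ] H} {μ : ι → ℝ}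
    (hS : ∀ i, ∀ x ∈ U i, ∀ y, inner ℂ (S x) (S y) = (μ i : ℂ) * inner ℂ x y) {i : ι} {x : X}
    (hx : x ∈ U i) : ‖S x‖ ^ 2 = μ i * ‖x‖ ^ 2 := by
  have h := congrArg Complex.re (hS i x hx x)
  rwa [Complex.re_ofReal_mul, ← RCLike.re_eq_complex_re, inner_self_eq_norm_sq,
    inner_self_eq_norm_sq] at h

variable [CompleteSpace X] {ι : Type*} {U : ι → Submodule ℂ X} [∀ i, CompleteSpace (U i)]

lemma hasSum_starProjection
    (hU : OrthogonalFamily ℂ (fun i => U i) fun i => (U i).subtypeₗᵢ)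
    (hUt : (⨆ i, U i).topologicalClosure = ⊤) (g : X) :
    HasSum (fun i => (U i).starProjection g) g := by
  classical
  have hV := IsHilbertSum.mkInternal (𝕜 := ℂ) U hU hUt.ge
  have h1 := hV.hasSum_linearIsometryEquiv_symm (hV.linearIsometryEquiv g)
  rw [LinearIsometryEquiv.symm_apply_apply] at h1
  refine h1.congr_fun fun i => ?_
  have h2 := h1.mapL (U i).starProjection
  refine h2.unique ?_
  have h3 : ∀ j, j ≠ i → (U i).starProjection ((U j).subtypeₗᵢ (hV.linearIsometryEquiv g j)) = 0 :=
    fun j hj => by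
      rw [Submodule.starProjection_apply_eq_zero_iff, Submodule.mem_orthogonal]
      exact fun u hu => hU hj.symm ⟨u, hu⟩ (hV.linearIsometryEquiv g j)
  convert! hasSum_single i h3 using 1
  exact (Submodule.starProjection_eq_self_iff.2 (hV.linearIsometryEquiv g i).2).symm

lemma hasSum_mul_norm_starProjection_sq
    (hU : OrthogonalFamily ℂ (fun i => U i) fun i => (U i).subtypeₗᵢ)
    (hUt : (⨆ i, U i).topologicalClosure = ⊤) {S : X →L[ℂ] H} {μ : ι → ℝ}
    (hS : ∀ i, ∀ x ∈ U i, ∀ y, inner ℂ (S x) (S y) = (μ i : ℂ) * inner ℂ x y) (g : X) :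
    HasSum (fun i => μ i * ‖(U i).starProjection g‖ ^ 2) (‖S g‖ ^ 2) := by
  have h1 := ((hasSum_starProjection hU hUt g).mapL S).mapL (innerSL ℂ (S g))
  have h2 := h1.mapL Complex.reCLM
  have e : ∀ i, Complex.reCLM (innerSL ℂ (S g) (S ((U i).starProjection g))) =
      μ i * ‖(U i).starProjection g‖ ^ 2 := fun i => by
    rw [innerSL_apply_apply, Complex.reCLM_apply, ← RCLike.re_eq_complex_re, inner_re_symm,
      hS i _ (Submodule.starProjection_apply_mem _ _), RCLike.re_eq_complex_re,
      Complex.re_ofReal_mul]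
    congr 1
    have h3 := Submodule.inner_starProjection_left_eq_right (U i) ((U i).starProjection g) g
    rw [Submodule.starProjection_eq_self_iff.2 (Submodule.starProjection_apply_mem _ g)] at h3
    rw [h3, ← RCLike.re_eq_complex_re, inner_self_eq_norm_sq]
  simp_rw [e] at h2
  convert! h2 using 1
  rw [innerSL_apply_apply, Complex.reCLM_apply, ← RCLike.re_eq_complex_re, inner_self_eq_norm_sq]

lemma hasSum_norm_starProjection_sq
    (hU : OrthogonalFamily ℂ (fun i => U i) fun i => (U i).subtypeₗᵢ)
    (hUt : (⨆ i, U i).topologicalClosure = ⊤) (g : X) :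
    HasSum (fun i => ‖(U i).starProjection g‖ ^ 2) (‖g‖ ^ 2) := by
  have h := hasSum_mul_norm_starProjection_sq hU hUt (S := ContinuousLinearMap.id ℂ X)
    (μ := fun _ => 1) (fun i x _ y => by simp) g
  simpa using h

variable {S : X →L[ℂ] H} {μ : ι → ℝ} {o : ι}

/-- The operator norm is attained on the eigenspace of the largest eigenvalue. -/
lemma norm_sq_eq_of_eigen
    (hU : OrthogonalFamily ℂ (fun i => U i) fun i => (U i).subtypeₗᵢ)
    (hUt : (⨆ i, U i).topologicalClosure = ⊤)
    (hS : ∀ i, ∀ x ∈ U i, ∀ y, inner ℂ (S x) (S y) = (μ i : ℂ) * inner ℂ x y)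
    (h0 : 0 ≤ μ o) (hμ : ∀ i, i ≠ o → μ i < μ o) (ho : U o ≠ ⊥) : ‖S‖ ^ 2 = μ o := by
  have hle : ∀ i, μ i ≤ μ o := fun i => by
    rcases eq_or_ne i o with rfl | h
    · exact le_rfl
    · exact (hμ i h).le
  refine le_antisymm ?_ ?_
  · have h1 : ‖S‖ ≤ √(μ o) := S.opNorm_le_bound (Real.sqrt_nonneg _) fun g => by
      refine le_of_sq_le_sq ?_ (by positivity)
      rw [mul_pow, Real.sq_sqrt h0]
      exact hasSum_le (fun i => mul_le_mul_of_nonneg_right (hle i) (sq_nonneg _))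
        (hasSum_mul_norm_starProjection_sq hU hUt hS g)
        ((hasSum_norm_starProjection_sq hU hUt g).mul_left (μ o))
    calc ‖S‖ ^ 2 ≤ √(μ o) ^ 2 := by gcongr
      _ = μ o := Real.sq_sqrt h0
  · obtain ⟨x, hx, hx0⟩ := Submodule.exists_mem_ne_zero_of_ne_bot ho
    have h2 := norm_sq_of_mem_eigen hS hx
    have h3 : ‖S x‖ ^ 2 ≤ (‖S‖ * ‖x‖) ^ 2 := by gcongr; exact S.le_opNorm x
    rw [mul_pow, h2] at h3
    exact le_of_mul_le_mul_right h3 (by have := norm_pos_iff.2 hx0; positivity)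

/-- The extremisers are the nonzero elements of the top eigenspace. -/
lemma norm_eq_iff_mem_of_eigen
    (hU : OrthogonalFamily ℂ (fun i => U i) fun i => (U i).subtypeₗᵢ)
    (hUt : (⨆ i, U i).topologicalClosure = ⊤)
    (hS : ∀ i, ∀ x ∈ U i, ∀ y, inner ℂ (S x) (S y) = (μ i : ℂ) * inner ℂ x y)
    (h0 : 0 ≤ μ o) (hμ : ∀ i, i ≠ o → μ i < μ o) (ho : U o ≠ ⊥) (g : X) :
    ‖S g‖ = ‖S‖ * ‖g‖ ↔ g ∈ U o := by
  have hn := norm_sq_eq_of_eigen hU hUt hS h0 hμ ho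
  rw [← sq_eq_sq₀ (norm_nonneg _) (by positivity), mul_pow, hn]
  have h1 := hasSum_mul_norm_starProjection_sq hU hUt hS g
  have h2 := ((hasSum_norm_starProjection_sq hU hUt g).mul_left (μ o)).sub h1
  constructor
  · intro h
    rw [h, sub_self, hasSum_zero_iff_of_nonneg] at h2
    · have h3 : ∀ i, i ≠ o → (U i).starProjection g = 0 := fun i hi => by
        have h4 := congrFun h2 i
        simp only [Pi.zero_apply] at h4
        rw [← sub_mul] at h4
        rcases mul_eq_zero.1 h4 with h5 | h5
        · linarith [hμ i hi]
        · simpa using h5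
      have h4 := (hasSum_starProjection hU hUt g).unique (hasSum_single o h3)
      rw [h4]
      exact Submodule.starProjection_apply_mem _ _
    · intro i
      rw [← sub_mul]
      rcases eq_or_ne i o with rfl | hi
      · simp
      · exact mul_nonneg (by linarith [hμ i hi]) (sq_nonneg _)
  · intro h
    exact norm_sq_of_mem_eigen hS h

/-- The gap between the deficit and a multiple of the squared distance to the extremisers, as a sum
over the spectral components. -/
lemma hasSum_deficit_sub [DecidableEq ι]
    (hU : OrthogonalFamily ℂ (fun i => U i) fun i => (U i).subtypeₗᵢ)
    (hUt : (⨆ i, U i).topologicalClosure = ⊤)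
    (hS : ∀ i, ∀ x ∈ U i, ∀ y, inner ℂ (S x) (S y) = (μ i : ℂ) * inner ℂ x y)
    (h0 : 0 ≤ μ o) (hμ : ∀ i, i ≠ o → μ i < μ o) (ho : U o ≠ ⊥) (s : ℝ) (g : X) :
    HasSum (fun i => if i = o then 0 else (s - μ i) * ‖(U i).starProjection g‖ ^ 2)
      (‖S‖ ^ 2 * ‖g‖ ^ 2 - ‖S g‖ ^ 2 -
        (μ o - s) * Metric.infDist g {x | x ≠ 0 ∧ ‖S x‖ = ‖S‖ * ‖x‖} ^ 2) := by
  have hset : {x | x ≠ 0 ∧ ‖S x‖ = ‖S‖ * ‖x‖} = {x | x ≠ 0 ∧ x ∈ U o} := by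
    ext x
    simp only [Set.mem_ofPred_eq, norm_eq_iff_mem_of_eigen hU hUt hS h0 hμ ho]
  rw [hset, infDist_diff_zero ho, norm_sq_eq_of_eigen hU hUt hS h0 hμ ho]
  have h1 := hasSum_mul_norm_starProjection_sq hU hUt hS g
  have h2 := hasSum_norm_starProjection_sq hU hUt g
  have h3 : ‖g - (U o).starProjection g‖ ^ 2 = ‖g‖ ^ 2 - ‖(U o).starProjection g‖ ^ 2 := by
    have := Submodule.norm_sq_eq_add_norm_sq_starProjection g (U o)
    rw [Submodule.starProjection_orthogonal_val] at this
    linarith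
  have h4 := ((h2.mul_left s).sub h1).add
    (hasSum_ite_eq o ((μ o - s) * ‖(U o).starProjection g‖ ^ 2))
  rw [h3]
  convert! h4 using 1
  · ext i
    by_cases hi : i = o
    · subst hi; simp; ring
    · simp [hi]; ring
  · ring

/-- The stability inequality, with its cases of equality. -/
lemma stability_of_eigen [DecidableEq ι]
    (hU : OrthogonalFamily ℂ (fun i => U i) fun i => (U i).subtypeₗᵢ)
    (hUt : (⨆ i, U i).topologicalClosure = ⊤)
    (hS : ∀ i, ∀ x ∈ U i, ∀ y, inner ℂ (S x) (S y) = (μ i : ℂ) * inner ℂ x y)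
    (h0 : 0 ≤ μ o) (hμ : ∀ i, i ≠ o → μ i < μ o) (ho : U o ≠ ⊥) {s : ℝ}
    (hs : ∀ i, i ≠ o → μ i ≤ s) (g : X) :
    (μ o - s) * Metric.infDist g {x | x ≠ 0 ∧ ‖S x‖ = ‖S‖ * ‖x‖} ^ 2 ≤
        ‖S‖ ^ 2 * ‖g‖ ^ 2 - ‖S g‖ ^ 2 ∧
      (‖S‖ ^ 2 * ‖g‖ ^ 2 - ‖S g‖ ^ 2 =
          (μ o - s) * Metric.infDist g {x | x ≠ 0 ∧ ‖S x‖ = ‖S‖ * ‖x‖} ^ 2 ↔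
        ∀ i, i ≠ o → μ i ≠ s → (U i).starProjection g = 0) := by
  have h := hasSum_deficit_sub hU hUt hS h0 hμ ho s g
  have hn : ∀ i, 0 ≤ if i = o then 0 else (s - μ i) * ‖(U i).starProjection g‖ ^ 2 := fun i => by
    split_ifs with hi
    · exact le_rfl
    · exact mul_nonneg (by linarith [hs i hi]) (sq_nonneg _)
  refine ⟨by linarith [h.nonneg hn], ?_⟩
  rw [← sub_eq_zero]
  constructor
  · intro h1 i hi hsi
    rw [h1, hasSum_zero_iff_of_nonneg hn] at h
    have h2 := congrFun h i
    simp only [if_neg hi, Pi.zero_apply] at h2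
    rcases mul_eq_zero.1 h2 with h3 | h3
    · exact absurd (sub_eq_zero.1 h3).symm hsi
    · simpa using h3
  · intro h1
    refine h.unique ?_
    convert! hasSum_zero using 2 with i
    split_ifs with hi
    · rfl
    · by_cases hsi : μ i = s
      · rw [hsi, sub_self, zero_mul]
      · simp [h1 i hi hsi]

/-- On a single eigenspace orthogonal to the extremisers, deficit and distance are explicit. -/
lemma deficit_of_mem_eigen
    (hU : OrthogonalFamily ℂ (fun i => U i) fun i => (U i).subtypeₗᵢ)
    (hUt : (⨆ i, U i).topologicalClosure = ⊤)
    (hS : ∀ i, ∀ x ∈ U i, ∀ y, inner ℂ (S x) (S y) = (μ i : ℂ) * inner ℂ x y)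
    (h0 : 0 ≤ μ o) (hμ : ∀ i, i ≠ o → μ i < μ o) (ho : U o ≠ ⊥) {i : ι} (hi : i ≠ o) {g : X}
    (hg : g ∈ U i) :
    ‖S‖ ^ 2 * ‖g‖ ^ 2 - ‖S g‖ ^ 2 = (μ o - μ i) * ‖g‖ ^ 2 ∧
      Metric.infDist g {x | x ≠ 0 ∧ ‖S x‖ = ‖S‖ * ‖x‖} ^ 2 = ‖g‖ ^ 2 := by
  have hset : {x | x ≠ 0 ∧ ‖S x‖ = ‖S‖ * ‖x‖} = {x | x ≠ 0 ∧ x ∈ U o} := by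
    ext x
    simp only [Set.mem_ofPred_eq, norm_eq_iff_mem_of_eigen hU hUt hS h0 hμ ho]
  rw [hset, infDist_diff_zero ho, norm_sq_eq_of_eigen hU hUt hS h0 hμ ho]
  have h1 : (U o).starProjection g = 0 := by
    rw [Submodule.starProjection_apply_eq_zero_iff, Submodule.mem_orthogonal]
    exact fun u hu => hU hi.symm ⟨u, hu⟩ ⟨g, hg⟩
  have h3 := norm_sq_of_mem_eigen hS hg
  rw [h1, sub_zero, h3]
  exact ⟨by ring, rfl⟩

variable [CompleteSpace H]

/-- The eigenspaces of `S† S`: its kernel and the images under `S†` of the eigenspaces of `S S†`. -/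
def eigenFamily (S : X →L[ℂ] H) (V : ℕ → Submodule ℂ H) : Option ℕ → Submodule ℂ X
  | none => LinearMap.ker S.toLinearMap
  | some k => (V k).map (ContinuousLinearMap.adjoint S).toLinearMap

/-- The eigenvalues of `S† S`. -/
def eigenValue (c : ℕ → ℝ) : Option ℕ → ℝ
  | none => 0
  | some k => c k

instance (S : X →L[ℂ] H) (V : ℕ → Submodule ℂ H) [∀ k, FiniteDimensional ℂ (V k)]
    (i : Option ℕ) : CompleteSpace (eigenFamily S V i) := by
  cases i with
  | none => exact S.isClosed_ker.completeSpace_coe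
  | some k => exact FiniteDimensional.complete ℂ ((V k).map (ContinuousLinearMap.adjoint S).toLinearMap)

lemma inner_eigenFamily {V : ℕ → Submodule ℂ H} {c : ℕ → ℝ}
    (hS : ∀ k, ∀ f ∈ V k, S (ContinuousLinearMap.adjoint S f) = (c k : ℂ) • f) (i : Option ℕ) :
    ∀ x ∈ eigenFamily S V i, ∀ y, inner ℂ (S x) (S y) = (eigenValue c i : ℂ) * inner ℂ x y := by
  intro x hx y
  cases i with
  | none =>
    have : S x = 0 := hx
    simp [this, eigenValue]
  | some k =>
    obtain ⟨f, hf, rfl⟩ := hx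
    have h1 : (ContinuousLinearMap.adjoint S).toLinearMap f = ContinuousLinearMap.adjoint S f := rfl
    rw [h1, hS k f hf, inner_smul_left, Complex.conj_ofReal, eigenValue,
      ContinuousLinearMap.adjoint_inner_left]

lemma orthogonalFamily_eigenFamily {V : ℕ → Submodule ℂ H} {c : ℕ → ℝ}
    (hV : ∀ k l, k ≠ l → ∀ f ∈ V k, ∀ g ∈ V l, inner ℂ f g = 0)
    (hS : ∀ k, ∀ f ∈ V k, S (ContinuousLinearMap.adjoint S f) = (c k : ℂ) • f) :
    OrthogonalFamily ℂ (fun i => eigenFamily S V i) fun i => (eigenFamily S V i).subtypeₗᵢ := by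
  rintro i j hij ⟨x, hx⟩ ⟨y, hy⟩
  change inner ℂ x y = 0
  cases i with
  | none =>
    cases j with
    | none => exact absurd rfl hij
    | some l =>
      obtain ⟨f, hf, rfl⟩ := hy
      have hx' : S x = 0 := hx
      change inner ℂ x (ContinuousLinearMap.adjoint S f) = 0
      rw [ContinuousLinearMap.adjoint_inner_right, hx', inner_zero_left]
  | some k =>
    obtain ⟨f, hf, rfl⟩ := hx
    change inner ℂ (ContinuousLinearMap.adjoint S f) y = 0
    rw [ContinuousLinearMap.adjoint_inner_left]
    cases j with
    | none =>
      have hy' : S y = 0 := hy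
      rw [hy', inner_zero_right]
    | some l =>
      obtain ⟨g, hg, rfl⟩ := hy
      change inner ℂ f (S (ContinuousLinearMap.adjoint S g)) = 0
      rw [hS l g hg, inner_smul_right, hV k l (fun h => hij (by rw [h])) f hf g hg, mul_zero]

lemma topologicalClosure_iSup_eigenFamily {V : ℕ → Submodule ℂ H}
    (hVt : (⨆ k, V k).topologicalClosure = ⊤) :
    (⨆ i, eigenFamily S V i).topologicalClosure = ⊤ := by
  rw [Submodule.topologicalClosure_eq_top_iff, eq_bot_iff]
  intro x hx
  have h1 : ∀ i, ∀ y ∈ eigenFamily S V i, inner ℂ y x = 0 := fun i y hy =>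
    (Submodule.mem_orthogonal _ _).1 hx y (Submodule.mem_iSup_of_mem i hy)
  have h2 : S x ∈ (⨆ k, V k)ᗮ := by
    rw [Submodule.mem_orthogonal]
    have : (⨆ k, V k) ≤ (ℂ ∙ S x)ᗮ := iSup_le fun k f hf => by
      rw [Submodule.mem_orthogonal_singleton_iff_inner_left]
      rw [← ContinuousLinearMap.adjoint_inner_left]
      exact h1 (some k) _ ⟨f, hf, rfl⟩
    intro f hf
    exact (Submodule.mem_orthogonal_singleton_iff_inner_left).1 (this hf)
  rw [Submodule.topologicalClosure_eq_top_iff.1 hVt, Submodule.mem_bot] at h2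
  have h3 := h1 none x h2
  rw [Submodule.mem_bot]
  exact inner_self_eq_zero.1 h3

lemma eigenFamily_some_ne_bot {V : ℕ → Submodule ℂ H} {c : ℕ → ℝ} {k : ℕ}
    (hS : ∀ f ∈ V k, S (ContinuousLinearMap.adjoint S f) = (c k : ℂ) • f) (hc : c k ≠ 0)
    (hV : V k ≠ ⊥) : eigenFamily S V (some k) ≠ ⊥ := by
  obtain ⟨f, hf, hf0⟩ := Submodule.exists_mem_ne_zero_of_ne_bot hV
  intro h
  have h1 : ContinuousLinearMap.adjoint S f ∈ eigenFamily S V (some k) := ⟨f, hf, rfl⟩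
  rw [h, Submodule.mem_bot] at h1
  have h2 := hS f hf
  rw [h1, map_zero] at h2
  exact smul_ne_zero (by exact_mod_cast hc) hf0 h2.symm

end
end

noncomputable section

section
variable {n : ℕ}
open MvPolynomial

/-! ### The adjoint of the sphere trace -/

lemma ae_comp_smul {c : ℝ} (hc : c ≠ 0) {P : Rn n → Prop} (h : ∀ᵐ x : Rn n, P x) :
    ∀ᵐ x : Rn n, P (c • x) := by
  have hq : Measure.QuasiMeasurePreserving (fun x : Rn n => c • x) volume volume :=
    ⟨by fun_prop, by
      rw [Measure.map_addHaar_smul volume hc]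
      exact Measure.smul_absolutelyContinuous⟩
  exact hq.ae h

lemma two_pi_ne_zero : (2 * Real.pi : ℝ) ≠ 0 := by positivity

/-- The function `w(2π|η|)^{1/2} f̂(2πη)`, where `f̂` is the Fourier transform of the measure `f dσ`. -/
def weightedExt (w : ℝ → ℝ) (f : UnitSphere n → ℂ) (η : Rn n) : ℂ :=
  (Real.sqrt (w ‖(2 * Real.pi) • η‖) : ℂ) * sphereFT f ((2 * Real.pi) • η)

/-- The properties of the weight which enter the construction of the sphere trace: the weight is
positive with polynomial growth, the numbers `λ_k` are finite, and `λ₀` is the largest one. -/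
structure AdmissibleWeight (n : ℕ) (w : ℝ → ℝ) : Prop where
  two_le : 2 ≤ n
  pos : ∀ r : ℝ, 0 < r → 0 < w r
  growth : ∃ N : ℕ, Integrable (fun ξ : Rn n => w ‖ξ‖ * ((1 + ‖ξ‖) ^ N)⁻¹)
  integrable : ∀ k, Integrable (fun ξ : Rn n => w ‖ξ‖ * besselProfile n k ‖ξ‖ ^ 2)
  lt : ∀ k, k ≠ 0 → lambdaCoeff n w k < lambdaCoeff n w 0

variable {w : ℝ → ℝ}

lemma AdmissibleWeight.aestronglyMeasurable (hw : AdmissibleWeight n w) :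
    AEStronglyMeasurable (fun ξ : Rn n => w ‖ξ‖) :=
  let ⟨_, h⟩ := hw.growth
  aestronglyMeasurable_weight h

lemma AdmissibleWeight.le (hw : AdmissibleWeight n w) (k : ℕ) :
    lambdaCoeff n w k ≤ lambdaCoeff n w 0 := by
  rcases eq_or_ne k 0 with rfl | hk
  · exact le_rfl
  · exact (hw.lt k hk).le

lemma AdmissibleWeight.lambdaCoeff_pos (hw : AdmissibleWeight n w) (k : ℕ) :
    0 < lambdaCoeff n w k := by
  have hn := hw.two_le
  have hi := (integrable_weight_mul_besselProfile_iff hn w k).1 (hw.integrable k)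
  have hnn : ∀ r ∈ Set.Ioi (0 : ℝ), 0 ≤ lambdaIntegrand n w k r := fun r hr =>
    mul_nonneg (mul_nonneg (sq_nonneg _) (le_of_lt hr)) (hw.pos r hr).le
  obtain ⟨δ, hδ, h⟩ := exists_besselJ_pos (besselOrder_nonneg hn k)
  rw [lambdaCoeff, setIntegral_pos_iff_support_of_nonneg_ae
    (ae_restrict_of_forall_mem measurableSet_Ioi hnn) hi]
  have hsub : Set.Ioo 0 δ ⊆ Function.support (lambdaIntegrand n w k) ∩ Set.Ioi 0 := fun r hr => by
    refine ⟨?_, hr.1⟩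
    have h1 := h r hr.1 hr.2
    have h2 := hw.pos r hr.1
    have h3 := hr.1
    exact (mul_pos (mul_pos (by positivity) h3) h2).ne'
  refine lt_of_lt_of_le ?_ (measure_mono hsub)
  simp [hδ]

lemma integral_comp_two_pi_smul {E : Type*} [NormedAddCommGroup E] [NormedSpace ℝ E]
    (f : Rn n → E) : ∫ η, f ((2 * Real.pi) • η) = ((2 * Real.pi) ^ n)⁻¹ • ∫ ξ, f ξ := by
  rw [Measure.integral_comp_smul_of_nonneg _ _ _ (hR := by positivity), finrank_euclideanSpace_fin]

lemma AdmissibleWeight.aestronglyMeasurable_sqrt (hw : AdmissibleWeight n w) :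
    AEStronglyMeasurable (fun ξ : Rn n => (Real.sqrt (w ‖ξ‖) : ℂ)) :=
  (Complex.continuous_ofReal.comp Real.continuous_sqrt).comp_aestronglyMeasurable
    hw.aestronglyMeasurable

lemma AEStronglyMeasurable.comp_two_pi_smul {f : Rn n → ℂ} (hf : AEStronglyMeasurable f) :
    AEStronglyMeasurable fun η : Rn n => f ((2 * Real.pi) • η) := by
  have hq : Measure.QuasiMeasurePreserving (fun x : Rn n => (2 * Real.pi) • x) volume volume :=
    ⟨by fun_prop, by
      rw [Measure.map_addHaar_smul volume two_pi_ne_zero]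
      exact Measure.smul_absolutelyContinuous⟩
  exact hf.comp_quasiMeasurePreserving hq

lemma AdmissibleWeight.memLp_weightedExt (hw : AdmissibleWeight n w) (q : MvPolynomial (Fin n) ℂ) :
    MemLp (weightedExt w fun θ : UnitSphere n => polyVal q (θ : Rn n)) 2 volume := by
  have hm : AEStronglyMeasurable fun ξ : Rn n => (Real.sqrt (w ‖ξ‖) : ℂ) *
      sphereFT (fun θ : UnitSphere n => polyVal q (θ : Rn n)) ξ :=
    hw.aestronglyMeasurable_sqrt.mul (continuous_sphereFT_polyVal q).aestronglyMeasurable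
  refine (memLp_two_iff_integrable_sq_norm (AEStronglyMeasurable.comp_two_pi_smul hm)).2 ?_
  have h1 := integrable_weight_mul_sphereFT_sq hw.two_le hw.pos hw.aestronglyMeasurable
    hw.integrable q
  have h2 := (integrable_comp_smul_iff volume _ two_pi_ne_zero).2 h1
  refine h2.congr ?_
  filter_upwards [ae_comp_smul two_pi_ne_zero
    (ae_weight_pos (n := n) (by have := hw.two_le; omega) hw.pos)] with η hη
  change _ = ‖(Real.sqrt (w ‖(2 * Real.pi) • η‖) : ℂ) * sphereFT _ ((2 * Real.pi) • η)‖ ^ 2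
  rw [norm_mul, mul_pow, Complex.norm_real, Real.norm_of_nonneg (Real.sqrt_nonneg _),
    Real.sq_sqrt hη.le]

lemma weightedExt_add (p q : MvPolynomial (Fin n) ℂ) (η : Rn n) :
    weightedExt w (fun θ : UnitSphere n => polyVal (p + q) (θ : Rn n)) η =
      weightedExt w (fun θ : UnitSphere n => polyVal p (θ : Rn n)) η +
      weightedExt w (fun θ : UnitSphere n => polyVal q (θ : Rn n)) η := by
  simp only [weightedExt, polyVal_add]
  rw [sphereFT_add (integrable_of_continuous_sphere (continuous_polyVal_sphere p))
    (integrable_of_continuous_sphere (continuous_polyVal_sphere q)), mul_add]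

lemma weightedExt_smul (c : ℂ) (q : MvPolynomial (Fin n) ℂ) (η : Rn n) :
    weightedExt w (fun θ : UnitSphere n => polyVal (c • q) (θ : Rn n)) η =
      c * weightedExt w (fun θ : UnitSphere n => polyVal q (θ : Rn n)) η := by
  simp only [weightedExt, polyVal_smul]
  rw [sphereFT_const_mul, mul_left_comm]

/-- The map sending a polynomial `q` to the class of `w(2π|η|)^{1/2} q̂(2πη)`, where `q̂` is the
Fourier transform of `q dσ`. -/
def polyExt (hw : AdmissibleWeight n w) : MvPolynomial (Fin n) ℂ →ₗ[ℂ] L2Space n where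
  toFun q := (hw.memLp_weightedExt q).toLp
  map_add' p q := by
    rw [← MemLp.toLp_add]
    exact MemLp.toLp_congr _ _ (.of_forall fun η => weightedExt_add p q η)
  map_smul' c q := by
    rw [RingHom.id_apply, ← MemLp.toLp_const_smul]
    exact MemLp.toLp_congr _ _ (.of_forall fun η => weightedExt_smul c q η)

lemma polyExt_coe (hw : AdmissibleWeight n w) (q : MvPolynomial (Fin n) ℂ) :
    polyExt hw q =ᵐ[volume] weightedExt w fun θ : UnitSphere n => polyVal q (θ : Rn n) :=
  (hw.memLp_weightedExt q).coeFn_toLp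

lemma inner_polyExt (hw : AdmissibleWeight n w) (p q : MvPolynomial (Fin n) ℂ) :
    inner ℂ (polyExt hw p) (polyExt hw q) = (((2 * Real.pi) ^ n : ℝ) : ℂ)⁻¹ *
      ∫ ξ : Rn n, (w ‖ξ‖ : ℂ) * (sphereFT (fun θ => polyVal q (θ : Rn n)) ξ *
        starRingEnd ℂ (sphereFT (fun θ => polyVal p (θ : Rn n)) ξ)) := by
  have h := integral_comp_two_pi_smul fun ξ : Rn n =>
    (w ‖ξ‖ : ℂ) * (sphereFT (fun θ : UnitSphere n => polyVal q (θ : Rn n)) ξ *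
        starRingEnd ℂ (sphereFT (fun θ : UnitSphere n => polyVal p (θ : Rn n)) ξ))
  rw [Complex.real_smul, Complex.ofReal_inv] at h
  rw [← h, L2.inner_def]
  refine integral_congr_ae ?_
  filter_upwards [polyExt_coe hw p, polyExt_coe hw q, ae_comp_smul two_pi_ne_zero
    (ae_weight_pos (n := n) (by have := hw.two_le; omega) hw.pos)] with η h1 h2 h3
  rw [h1, h2, RCLike.inner_apply, weightedExt, weightedExt, map_mul, Complex.conj_ofReal]
  have h4 : (Real.sqrt (w ‖(2 * Real.pi) • η‖) : ℂ) * (Real.sqrt (w ‖(2 * Real.pi) • η‖) : ℂ) =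
      (w ‖(2 * Real.pi) • η‖ : ℂ) := by
    rw [← Complex.ofReal_mul, Real.mul_self_sqrt h3.le]
  rw [← h4]
  ring

/-- The map `f ↦ w(2π|η|)^{1/2} f̂(2πη)` is diagonal on spherical harmonics, with `⟨Tf, Tg⟩ = λ_k ⟨f, g⟩`
in degree `k`. -/
lemma inner_polyExt_harmonic (hw : AdmissibleWeight n w) {k l : ℕ} {p q : MvPolynomial (Fin n) ℂ}
    (hp : p ∈ harmonicPoly n k) (hq : q ∈ harmonicPoly n l) :
    inner ℂ (polyExt hw p) (polyExt hw q) =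
      (lambdaCoeff n w k : ℂ) * inner ℂ (polyLp n p) (polyLp n q) := by
  have hn := hw.two_le
  rw [inner_polyExt]
  rcases eq_or_ne k l with rfl | hkl
  · rw [integral_weight_mul_sphereFT_harmonic hn w hq hp, inner_polyLp]
    have h2 : (((2 * Real.pi) ^ n : ℝ) : ℂ) ≠ 0 := by
      exact_mod_cast pow_ne_zero n two_pi_ne_zero
    rw [Complex.ofReal_mul, ← mul_assoc, ← mul_assoc, inv_mul_cancel₀ h2, one_mul]
    congr 1
    refine integral_congr_ae (.of_forall fun θ => ?_)
    simp only
    rw [mul_comm]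
  · rw [integral_weight_mul_sphereFT_harmonic_of_ne hn w hkl.symm hq hp,
      inner_harmonicLp_eq_zero (by omega) hkl ⟨p, hp, rfl⟩ ⟨q, hq, rfl⟩, mul_zero, mul_zero]

lemma norm_sum_sq_of_pairwise_orthogonal {E ι : Type*} [NormedAddCommGroup E]
    [InnerProductSpace ℂ E] (s : Finset ι) (x : ι → E)
    (h : ∀ i j, i ≠ j → inner ℂ (x i) (x j) = 0) : ‖∑ i ∈ s, x i‖ ^ 2 = ∑ i ∈ s, ‖x i‖ ^ 2 := by
  have h1 : inner ℂ (∑ i ∈ s, x i) (∑ i ∈ s, x i) = ∑ i ∈ s, inner ℂ (x i) (x i) := by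
    rw [sum_inner]
    refine Finset.sum_congr rfl fun i hi => ?_
    rw [inner_sum]
    exact Finset.sum_eq_single i (fun j _ hj => h i j hj.symm) fun h2 => absurd hi h2
  have h2 := congrArg RCLike.re h1
  rw [map_sum] at h2
  simpa only [inner_self_eq_norm_sq] using h2

lemma exists_sum_harmonic (hn : 1 ≤ n) (q : MvPolynomial (Fin n) ℂ) :
    ∃ (s : Finset ℕ) (p : ℕ → MvPolynomial (Fin n) ℂ), (∀ k, p k ∈ harmonicPoly n k) ∧
      polySphere n q = polySphere n (∑ k ∈ s, p k) := by
  obtain ⟨f, hf, hsum⟩ := (Submodule.mem_iSup_iff_exists_finsupp _ _).1 (polySphere_mem_iSup_all hn q)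
  choose p hp hpf using hf
  refine ⟨f.support, p, hp, ?_⟩
  rw [map_sum, ← hsum]
  exact Finset.sum_congr rfl fun k _ => (hpf k).symm

/-- As `λ₀` is the largest of the `λ_k`, the diagonal form gives the bound `‖Tf‖² ≤ λ₀ ‖f‖²` for
polynomials, hence an extension to `L²(𝕊ⁿ⁻¹)` by density. -/
lemma norm_polyExt_le (hw : AdmissibleWeight n w) (q : MvPolynomial (Fin n) ℂ) :
    ‖polyExt hw q‖ ≤ √(lambdaCoeff n w 0) * ‖polyLp n q‖ := by
  have hn1 : 1 ≤ n := by have := hw.two_le; omega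
  obtain ⟨s, p, hp, hq⟩ := exists_sum_harmonic hn1 q
  have e1 : polyLp n q = ∑ k ∈ s, polyLp n (p k) := by
    rw [← map_sum]
    exact congrArg (ContinuousMap.toLp (E := ℂ) 2 (sphereMeasure n) ℂ) hq
  have e2 : polyExt hw q = ∑ k ∈ s, polyExt hw (p k) := by
    rw [← map_sum]
    refine MemLp.toLp_congr (hw.memLp_weightedExt q) (hw.memLp_weightedExt (∑ k ∈ s, p k))
      (.of_forall fun η => ?_)
    rw [weightedExt, weightedExt, ← sphereFT_polySphere, ← sphereFT_polySphere, hq]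
  have h0 := (hw.lambdaCoeff_pos 0).le
  have hk : ∀ k, ‖polyExt hw (p k)‖ ^ 2 = lambdaCoeff n w k * ‖polyLp n (p k)‖ ^ 2 := fun k => by
    have h := congrArg Complex.re (inner_polyExt_harmonic hw (hp k) (hp k))
    rwa [Complex.re_ofReal_mul, ← RCLike.re_eq_complex_re, inner_self_eq_norm_sq,
      inner_self_eq_norm_sq] at h
  refine le_of_sq_le_sq ?_ (by positivity)
  rw [mul_pow, Real.sq_sqrt h0, e1, e2, norm_sum_sq_of_pairwise_orthogonal s _ fun i j hij => ?_,
    norm_sum_sq_of_pairwise_orthogonal s _ fun i j hij => ?_, Finset.mul_sum]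
  · refine Finset.sum_le_sum fun k _ => ?_
    rw [hk]
    exact mul_le_mul_of_nonneg_right (hw.le k) (sq_nonneg _)
  · exact inner_harmonicLp_eq_zero hn1 hij ⟨_, hp i, rfl⟩ ⟨_, hp j, rfl⟩
  · rw [inner_polyExt_harmonic hw (hp i) (hp j),
      inner_harmonicLp_eq_zero hn1 hij ⟨_, hp i, rfl⟩ ⟨_, hp j, rfl⟩, mul_zero]

lemma denseRange_polyLp (hn : 1 ≤ n) : DenseRange (polyLp n) := by
  have h := topologicalClosure_iSup_harmonicLp hn
  have hle : (⨆ k, harmonicLp n k) ≤ LinearMap.range (polyLp n) :=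
    iSup_le fun k => by
      rintro _ ⟨p, -, rfl⟩
      exact ⟨p, rfl⟩
  have h2 := Submodule.topologicalClosure_mono hle
  rw [h, top_le_iff] at h2
  exact (Submodule.dense_iff_topologicalClosure_eq_top.2 h2)

/-- The extension operator `f ↦ w(2π|η|)^{1/2} f̂(2πη)` from `L²(𝕊ⁿ⁻¹)` to `L²(ℝⁿ)`. -/
def extOp (hw : AdmissibleWeight n w) : L2Sphere n →L[ℂ] L2Space n :=
  (polyExt hw).extendOfNorm (polyLp n)

lemma extOp_polyLp (hw : AdmissibleWeight n w) (q : MvPolynomial (Fin n) ℂ) :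
    extOp hw (polyLp n q) = polyExt hw q :=
  LinearMap.extendOfNorm_eq (denseRange_polyLp (by have := hw.two_le; omega))
    ⟨_, norm_polyExt_le hw⟩ q

lemma adjoint_extOp_extOp (hw : AdmissibleWeight n w) {k : ℕ} {f : L2Sphere n}
    (hf : f ∈ harmonicLp n k) : ContinuousLinearMap.adjoint (extOp hw) (extOp hw f) =
      (lambdaCoeff n w k : ℂ) • f := by
  have hn1 : 1 ≤ n := by have := hw.two_le; omega
  rw [← sub_eq_zero]
  have h : ContinuousLinearMap.adjoint (extOp hw) (extOp hw f) - (lambdaCoeff n w k : ℂ) • f ∈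
      (⨆ k, harmonicLp n k)ᗮ := by
    have hle : (⨆ k, harmonicLp n k) ≤
        (ℂ ∙ (ContinuousLinearMap.adjoint (extOp hw) (extOp hw f) -
          (lambdaCoeff n w k : ℂ) • f))ᗮ := iSup_le fun l => by
      rintro _ ⟨q, hq, rfl⟩
      obtain ⟨p, hp, rfl⟩ := hf
      rw [Submodule.mem_orthogonal_singleton_iff_inner_right, inner_sub_left, inner_smul_left,
        ContinuousLinearMap.adjoint_inner_left, extOp_polyLp, extOp_polyLp,
        inner_polyExt_harmonic hw hp hq, Complex.conj_ofReal, sub_self]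
    rw [Submodule.mem_orthogonal]
    exact fun u hu => (Submodule.mem_orthogonal_singleton_iff_inner_left).1 (hle hu)
  rw [Submodule.topologicalClosure_eq_top_iff.1 (topologicalClosure_iSup_harmonicLp hn1),
    Submodule.mem_bot] at h
  exact h

/-- The Fourier transform on `L²(ℝⁿ)` as a continuous linear map. -/
def fourierCLM (n : ℕ) : L2Space n →L[ℂ] L2Space n :=
  (Lp.fourierTransformₗᵢ (Rn n) ℂ).toContinuousLinearEquiv.toContinuousLinearMap

lemma fourierCLM_apply (g : L2Space n) : fourierCLM n g = Lp.fourierTransformₗᵢ (Rn n) ℂ g := rfl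

/-- The sphere trace, as the adjoint of the extension operator. -/
def sphereTrace (hw : AdmissibleWeight n w) : L2Space n →L[ℂ] L2Sphere n :=
  ContinuousLinearMap.adjoint (extOp hw) ∘L fourierCLM n

lemma fourier_adjoint_sphereTrace (hw : AdmissibleWeight n w) (f : L2Sphere n) :
    Lp.fourierTransformₗᵢ (Rn n) ℂ (ContinuousLinearMap.adjoint (sphereTrace hw) f) =
      extOp hw f := by
  refine ext_inner_right ℂ fun h => ?_
  obtain ⟨g, rfl⟩ := (Lp.fourierTransformₗᵢ (Rn n) ℂ).surjective h
  rw [LinearIsometryEquiv.inner_map_map, ContinuousLinearMap.adjoint_inner_left, sphereTrace,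
    ContinuousLinearMap.comp_apply, ContinuousLinearMap.adjoint_inner_right, fourierCLM_apply]

lemma sphereTrace_adjoint (hw : AdmissibleWeight n w) {k : ℕ} {f : L2Sphere n}
    (hf : f ∈ harmonicLp n k) :
    sphereTrace hw (ContinuousLinearMap.adjoint (sphereTrace hw) f) =
      (lambdaCoeff n w k : ℂ) • f := by
  rw [← adjoint_extOp_extOp hw hf, ← fourier_adjoint_sphereTrace]
  rfl

end
end

noncomputable section

section
variable {n : ℕ} {w : ℝ → ℝ}
open MvPolynomial

/-! ### The sphere trace as a restriction, and its uniqueness -/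

lemma multiplierOp_eq_fourierInt (w : ℝ → ℝ) (g : L2Space n) (x : Rn n) :
    multiplierOp w g x = ((2 * Real.pi : ℝ) ^ n : ℂ)⁻¹ * fourierInt (symbolMul w g) (-x) := by
  rw [multiplierOp, fourierInt]
  congr 2
  ext ξ
  rw [inner_neg_right, real_inner_comm]
  push_cast
  ring_nf

lemma continuous_multiplierOp {g : L2Space n} (hg : Integrable (symbolMul w g)) :
    Continuous (multiplierOp w g) := by
  have h : multiplierOp w g = fun x =>
      ((2 * Real.pi : ℝ) ^ n : ℂ)⁻¹ * fourierInt (symbolMul w g) (-x) :=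
    funext (multiplierOp_eq_fourierInt w g)
  rw [h]
  exact continuous_const.mul ((continuous_fourierInt hg).comp continuous_neg)

lemma integral_conj_mul_multiplierOp {g : L2Space n} (hg : Integrable (symbolMul w g))
    (q : MvPolynomial (Fin n) ℂ) :
    ∫ θ : UnitSphere n, starRingEnd ℂ (polyVal q (θ : Rn n)) * multiplierOp w g (θ : Rn n)
        ∂(sphereMeasure n) =
      ((2 * Real.pi : ℝ) ^ n : ℂ)⁻¹ * ∫ ξ, symbolMul w g ξ *
        starRingEnd ℂ (sphereFT (fun θ : UnitSphere n => polyVal q (θ : Rn n)) ξ) := by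
  have hq : Integrable (fun θ : UnitSphere n => starRingEnd ℂ (polyVal q (θ : Rn n)))
      (sphereMeasure n) := integrable_of_continuous_sphere
    (Complex.continuous_conj.comp (continuous_polyVal_sphere q))
  have hF : Integrable (fun z : UnitSphere n × Rn n =>
      (starRingEnd ℂ (polyVal q (z.1 : Rn n)) * symbolMul w g z.2) *
        Complex.exp (-Complex.I * ((inner ℝ (z.2 : Rn n) (-(z.1 : Rn n)) : ℝ) : ℂ)))
      ((sphereMeasure n).prod volume) :=
    integrable_mul_exp (hq.mul_prod hg) (Continuous.aestronglyMeasurable (by fun_prop))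
  calc _ = ∫ θ : UnitSphere n, ((2 * Real.pi : ℝ) ^ n : ℂ)⁻¹ * (∫ ξ : Rn n,
        (starRingEnd ℂ (polyVal q (θ : Rn n)) * symbolMul w g ξ) *
          Complex.exp (-Complex.I * ((inner ℝ ξ (-(θ : Rn n)) : ℝ) : ℂ))) ∂(sphereMeasure n) := by
        refine integral_congr_ae (.of_forall fun θ => ?_)
        simp only
        rw [multiplierOp_eq_fourierInt, fourierInt, mul_left_comm, ← integral_const_mul]
        simp only [mul_assoc]
    _ = _ := by
        rw [integral_const_mul, integral_integral_swap hF]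
        congr 2; ext ξ
        rw [sphereFT, ← integral_conj, ← integral_const_mul]
        refine integral_congr_ae (.of_forall fun θ => ?_)
        simp only
        rw [map_mul, conj_exp_neg_I_mul, inner_neg_right, real_inner_comm]
        push_cast
        ring_nf

/-- The pairing of the sphere trace with a polynomial, on the Fourier side. The factor `(2π)^{-n}` comes
from the dilation `ξ = 2πη` between the two normalizations of the Fourier transform. -/
lemma inner_polyLp_sphereTrace (hw : AdmissibleWeight n w) (g : L2Space n)
    (q : MvPolynomial (Fin n) ℂ) :
    inner ℂ (polyLp n q) (sphereTrace hw g) = ((2 * Real.pi : ℝ) ^ n : ℂ)⁻¹ *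
      ∫ ξ, symbolMul w g ξ *
        starRingEnd ℂ (sphereFT (fun θ : UnitSphere n => polyVal q (θ : Rn n)) ξ) := by
  have h := integral_comp_two_pi_smul fun ξ : Rn n => symbolMul w g ξ *
        starRingEnd ℂ (sphereFT (fun θ : UnitSphere n => polyVal q (θ : Rn n)) ξ)
  rw [Complex.real_smul, Complex.ofReal_inv, Complex.ofReal_pow] at h
  rw [← h, sphereTrace, ContinuousLinearMap.comp_apply, ContinuousLinearMap.adjoint_inner_right,
    extOp_polyLp, L2.inner_def]
  refine integral_congr_ae ?_
  filter_upwards [polyExt_coe hw q] with η h1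
  rw [h1, RCLike.inner_apply, weightedExt, map_mul, Complex.conj_ofReal, symbolMul, fourierL2,
    inv_smul_smul₀ two_pi_ne_zero, fourierCLM_apply]
  ring

/-- When the symbol side is integrable, the inversion integral is continuous, and Fubini shows that its
restriction has the same pairings with polynomials as the abstractly defined trace. -/
lemma isSphereTrace_sphereTrace (hw : AdmissibleWeight n w) : IsSphereTrace w (sphereTrace hw) := by
  intro g hg
  have hn1 : 1 ≤ n := by have := hw.two_le; omega
  set f : C(UnitSphere n, ℂ) :=
    ⟨fun θ => multiplierOp w g (θ : Rn n), (continuous_multiplierOp hg).comp continuous_subtype_val⟩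
  have hf := ContinuousMap.coeFn_toLp (E := ℂ) (p := 2) (𝕜 := ℂ) (sphereMeasure n) f
  have he : sphereTrace hw g = ContinuousMap.toLp (E := ℂ) 2 (sphereMeasure n) ℂ f := by
    refine (denseRange_polyLp hn1).eq_of_inner_right (𝕜 := ℂ) ?_
    intro q
    rw [inner_polyLp_sphereTrace, ← integral_conj_mul_multiplierOp hg, L2.inner_def]
    refine integral_congr_ae ?_
    filter_upwards [hf, polyLp_coe q] with θ h1 h2
    rw [h1, h2, RCLike.inner_apply, mul_comm]
    rfl
  rw [he]
  exact hf

/-- Integrability follows from `√w ≤ w + 1` and the polynomial growth of the weight. -/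
lemma integrable_weight_mul_schwartz (hw : AdmissibleWeight n w) (φ : 𝓢(Rn n, ℂ)) :
    Integrable fun ξ : Rn n => (Real.sqrt (w ‖ξ‖) : ℂ) * φ ((2 * Real.pi)⁻¹ • ξ) := by
  obtain ⟨N, hN⟩ := hw.growth
  set m := max N (n + 1)
  obtain ⟨C, hC⟩ : ∃ C : ℝ, ∀ x, (1 + ‖x‖) ^ m * ‖φ x‖ ≤ C :=
    ⟨_, fun x => by
      simpa only [norm_iteratedFDeriv_zero] using
        SchwartzMap.one_add_le_sup_seminorm_apply (𝕜 := ℂ) (m := (m, 0)) le_rfl le_rfl φ x⟩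
  have hC0 : 0 ≤ C := le_trans (by positivity) (hC 0)
  have hpi : 1 ≤ 2 * Real.pi := by nlinarith [Real.pi_gt_three]
  have hi : Integrable fun ξ : Rn n => ((1 + ‖ξ‖) ^ (n + 1))⁻¹ := by
    have h := integrable_one_add_norm (E := Rn n) (μ := volume) (r := (n + 1 : ℕ))
      (by rw [finrank_euclideanSpace_fin]; exact_mod_cast n.lt_succ_self)
    refine h.congr (.of_forall fun ξ => ?_)
    simp only
    rw [Real.rpow_neg (by positivity), Real.rpow_natCast]
  refine ((hN.add hi).const_mul (C * (2 * Real.pi) ^ m)).mono'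
    (hw.aestronglyMeasurable_sqrt.mul (by fun_prop)) ?_
  filter_upwards [ae_weight_pos (n := n) (by have := hw.two_le; omega) hw.pos] with ξ hξ
  have hs : √(w ‖ξ‖) ≤ w ‖ξ‖ + 1 := Real.sqrt_le_iff.2 ⟨by positivity, by nlinarith⟩
  have hφ : ‖φ ((2 * Real.pi)⁻¹ • ξ)‖ ≤ C * (2 * Real.pi) ^ m * ((1 + ‖ξ‖) ^ m)⁻¹ := by
    have h1 := hC ((2 * Real.pi)⁻¹ • ξ)
    have h2 : 1 + ‖ξ‖ ≤ 2 * Real.pi * (1 + ‖(2 * Real.pi)⁻¹ • ξ‖) := by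
      rw [norm_smul, norm_inv, Real.norm_of_nonneg (by positivity), mul_add, mul_one,
        mul_inv_cancel_left₀ two_pi_ne_zero]
      linarith
    have h3 := pow_le_pow_left₀ (by positivity) h2 m
    rw [mul_pow] at h3
    rw [← div_eq_mul_inv, le_div_iff₀ (by positivity)]
    calc _ ≤ ‖φ ((2 * Real.pi)⁻¹ • ξ)‖ *
          ((2 * Real.pi) ^ m * (1 + ‖(2 * Real.pi)⁻¹ • ξ‖) ^ m) := by gcongr
      _ = ((1 + ‖(2 * Real.pi)⁻¹ • ξ‖) ^ m * ‖φ ((2 * Real.pi)⁻¹ • ξ)‖) * (2 * Real.pi) ^ m := by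
        ring
      _ ≤ _ := by gcongr
  have h1 : (1 : ℝ) ≤ 1 + ‖ξ‖ := by linarith [norm_nonneg ξ]
  have hmN : ((1 + ‖ξ‖) ^ m)⁻¹ ≤ ((1 + ‖ξ‖) ^ N)⁻¹ :=
    inv_anti₀ (by positivity) (pow_le_pow_right₀ h1 (le_max_left _ _))
  have hmn : ((1 + ‖ξ‖) ^ m)⁻¹ ≤ ((1 + ‖ξ‖) ^ (n + 1))⁻¹ :=
    inv_anti₀ (by positivity) (pow_le_pow_right₀ h1 (le_max_right _ _))
  rw [norm_mul, Complex.norm_real, Real.norm_of_nonneg (Real.sqrt_nonneg _)]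
  calc _ ≤ (w ‖ξ‖ + 1) * (C * (2 * Real.pi) ^ m * ((1 + ‖ξ‖) ^ m)⁻¹) := by gcongr
    _ = C * (2 * Real.pi) ^ m * (w ‖ξ‖ * ((1 + ‖ξ‖) ^ m)⁻¹ + ((1 + ‖ξ‖) ^ m)⁻¹) := by ring
    _ ≤ C * (2 * Real.pi) ^ m * (w ‖ξ‖ * ((1 + ‖ξ‖) ^ N)⁻¹ + ((1 + ‖ξ‖) ^ (n + 1))⁻¹) := by
      gcongr

/-- Two sphere traces agree on the functions whose Fourier transform is a Schwartz function, and these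
are dense. -/
lemma IsSphereTrace.unique (hw : AdmissibleWeight n w) {S T : L2Space n →L[ℂ] L2Sphere n}
    (hS : IsSphereTrace w S) (hT : IsSphereTrace w T) : S = T := by
  set F := Lp.fourierTransformₗᵢ (Rn n) ℂ
  have hd : DenseRange fun φ : 𝓢(Rn n, ℂ) =>
      F.symm (SchwartzMap.toLpCLM ℂ ℂ 2 (volume : Measure (Rn n)) φ) :=
    F.symm.surjective.denseRange.comp
      (SchwartzMap.denseRange_toLpCLM ENNReal.ofNat_ne_top) F.symm.continuous
  refine ContinuousLinearMap.coeFn_injective (hd.equalizer S.continuous T.continuous ?_)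
  ext1 φ
  have hg : Integrable (symbolMul w
      (F.symm (SchwartzMap.toLpCLM ℂ ℂ 2 (volume : Measure (Rn n)) φ))) := by
    refine (integrable_weight_mul_schwartz hw φ).congr ?_
    filter_upwards [ae_comp_smul (inv_ne_zero two_pi_ne_zero)
      (SchwartzMap.coeFn_toLp φ 2 (volume : Measure (Rn n)))] with ξ hξ
    rw [symbolMul, fourierL2, LinearIsometryEquiv.apply_symm_apply, ← hξ]
    rfl
  exact Lp.ext ((hS _ hg).trans (hT _ hg).symm)

/-! ### Fourier transforms of the eigenfunctions -/

lemma fourierL2_adjoint_polyLp (hw : AdmissibleWeight n w) (q : MvPolynomial (Fin n) ℂ) :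
    fourierL2 (ContinuousLinearMap.adjoint (sphereTrace hw) (polyLp n q)) =ᵐ[volume]
      fun ξ => (Real.sqrt (w ‖ξ‖) : ℂ) * sphereFT (fun θ => polyVal q (θ : Rn n)) ξ := by
  filter_upwards [ae_comp_smul (inv_ne_zero two_pi_ne_zero) (polyExt_coe hw q)] with ξ hξ
  rw [fourierL2, fourier_adjoint_sphereTrace, extOp_polyLp, hξ, weightedExt,
    smul_inv_smul₀ two_pi_ne_zero]

lemma fourierL2_add (f g : L2Space n) :
    fourierL2 (f + g) =ᵐ[volume] fun ξ => fourierL2 f ξ + fourierL2 g ξ := by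
  filter_upwards [ae_comp_smul (inv_ne_zero two_pi_ne_zero)
    (Lp.coeFn_add (Lp.fourierTransformₗᵢ (Rn n) ℂ f) (Lp.fourierTransformₗᵢ (Rn n) ℂ g))] with ξ hξ
  rw [fourierL2, map_add, hξ]
  rfl

lemma fourierL2_sub (f g : L2Space n) :
    fourierL2 (f - g) =ᵐ[volume] fun ξ => fourierL2 f ξ - fourierL2 g ξ := by
  filter_upwards [ae_comp_smul (inv_ne_zero two_pi_ne_zero)
    (Lp.coeFn_sub (Lp.fourierTransformₗᵢ (Rn n) ℂ f) (Lp.fourierTransformₗᵢ (Rn n) ℂ g))] with ξ hξ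
  rw [fourierL2, map_sub, hξ]
  rfl

lemma fourierL2_zero : fourierL2 (0 : L2Space n) =ᵐ[volume] fun _ => 0 := by
  filter_upwards [ae_comp_smul (inv_ne_zero two_pi_ne_zero)
    (Lp.coeFn_zero ℂ 2 (volume : Measure (Rn n)))] with ξ hξ
  rw [fourierL2, map_zero, hξ]
  rfl

lemma fourierL2_sum {ι : Type*} (s : Finset ι) (x : ι → L2Space n) :
    fourierL2 (∑ i ∈ s, x i) =ᵐ[volume] fun ξ => ∑ i ∈ s, fourierL2 (x i) ξ := by
  classical
  induction s using Finset.induction_on with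
  | empty => simpa using fourierL2_zero
  | insert i s hi ih =>
    rw [Finset.sum_insert hi]
    filter_upwards [fourierL2_add (x i) (∑ i ∈ s, x i), ih] with ξ h1 h2
    rw [h1, h2, Finset.sum_insert hi]

/-- The dilation factor in Plancherel's identity for the non-unitary normalization. -/
lemma eLpNorm_fourierL2 : ∃ K : ENNReal, K ≠ 0 ∧ K ≠ ⊤ ∧
    ∀ g : L2Space n, eLpNorm (fourierL2 g) 2 volume = K * ‖g‖ₑ := by
  have hc : (2 * Real.pi)⁻¹ ≠ 0 := inv_ne_zero two_pi_ne_zero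
  refine ⟨ENNReal.ofReal |(((2 * Real.pi)⁻¹) ^ n)⁻¹| ^ (1 / (2 : ENNReal)).toReal, ?_, ?_,
    fun g => ?_⟩
  · refine (ENNReal.rpow_pos ?_ ENNReal.ofReal_ne_top).ne'
    rw [ENNReal.ofReal_pos]
    positivity
  · exact ENNReal.rpow_ne_top_of_nonneg ENNReal.toReal_nonneg ENNReal.ofReal_ne_top
  · set f : L2Space n := Lp.fourierTransformₗᵢ (Rn n) ℂ g
    have hf : ‖f‖ₑ = ‖g‖ₑ := by
      rw [← ofReal_norm, ← ofReal_norm, LinearIsometryEquiv.norm_map]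
    have hmap : Measure.map (fun x : Rn n => (2 * Real.pi)⁻¹ • x) volume =
        ENNReal.ofReal |(((2 * Real.pi)⁻¹) ^ n)⁻¹| • (volume : Measure (Rn n)) := by
      rw [Measure.map_addHaar_smul volume hc, finrank_euclideanSpace_fin]
    have h := eLpNorm_map_measure (p := 2) (μ := (volume : Measure (Rn n))) (g := f)
      (f := fun x : Rn n => (2 * Real.pi)⁻¹ • x) (by
        rw [hmap]
        exact (Lp.aestronglyMeasurable f).mono_ac Measure.smul_absolutelyContinuous) (by fun_prop)
    rw [hmap, eLpNorm_smul_measure_of_ne_top (by simp)] at h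
    rw [← hf, Lp.enorm_def]
    exact h.symm

end
end

noncomputable section

section
variable {n : ℕ} {w : ℝ → ℝ}
open MvPolynomial

/-! ### Bessel expansions and the eigenspaces of the sphere trace -/

/-- The function `w(|ξ|)^{1/2} |ξ|^{-(n-2)/2} Y(ξ/|ξ|) J_{(n-2)/2+k}(|ξ|)`. -/
def besselTerm (w : ℝ → ℝ) (k : ℕ) (Y : Rn n → ℂ) (ξ : Rn n) : ℂ :=
  ((Real.sqrt (w ‖ξ‖) / ‖ξ‖ ^ (((n : ℝ) - 2) / 2) : ℝ) : ℂ) *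
    (Y (‖ξ‖⁻¹ • ξ) * (besselJ (besselOrder n k) ‖ξ‖ : ℂ))

lemma besselExpansion_eq_sum (w : ℝ → ℝ) (c : ℂ) (Y : ℕ → Rn n → ℂ) (s : Finset ℕ) (ξ : Rn n) :
    besselExpansion w c Y s ξ =
      besselTerm w 0 (fun _ => c) ξ + ∑ k ∈ s, besselTerm w k (Y k) ξ := by
  simp only [besselExpansion, besselTerm]
  rw [mul_add, Finset.mul_sum]

/-- The eigenspaces of `S† S`, where `S` is the sphere trace. -/
abbrev traceEigen (hw : AdmissibleWeight n w) : Option ℕ → Submodule ℂ (L2Space n) :=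
  eigenFamily (sphereTrace hw) (harmonicLp n)

lemma fourierL2_adjoint_harmonic (hw : AdmissibleWeight n w) {k : ℕ}
    {p : MvPolynomial (Fin n) ℂ} (hp : p ∈ harmonicPoly n k) :
    fourierL2 (ContinuousLinearMap.adjoint (sphereTrace hw) (polyLp n p)) =ᵐ[volume]
      besselTerm w k fun ξ =>
        ((-Complex.I) ^ k * (((2 * Real.pi) ^ ((n : ℝ) / 2) : ℝ) : ℂ)) * polyVal p ξ := by
  have hn := hw.two_le
  filter_upwards [fourierL2_adjoint_polyLp hw p, ae_ne_zero (n := n) (by omega)] with ξ h1 h2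
  rw [h1, sphereFT_harmonic hn hp h2, besselTerm, besselProfile, div_eq_mul_inv]
  push_cast
  ring

lemma exists_harmonicPoly_of_mem_traceEigen (hw : AdmissibleWeight n w) {k : ℕ} {x : L2Space n}
    (hx : x ∈ traceEigen hw (some k)) :
    ∃ p ∈ harmonicPoly n k, fourierL2 x =ᵐ[volume] besselTerm w k (polyVal p) := by
  obtain ⟨_, ⟨p, hp, rfl⟩, rfl⟩ := hx
  refine ⟨((-Complex.I) ^ k * (((2 * Real.pi) ^ ((n : ℝ) / 2) : ℝ) : ℂ)) • p,
    Submodule.smul_mem _ _ hp, (fourierL2_adjoint_harmonic hw hp).trans (.of_forall fun ξ => ?_)⟩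
  simp only [besselTerm, polyVal_smul]

lemma exists_mem_traceEigen_of_harmonicPoly (hw : AdmissibleWeight n w) {k : ℕ}
    {p : MvPolynomial (Fin n) ℂ} (hp : p ∈ harmonicPoly n k) :
    ∃ x ∈ traceEigen hw (some k), fourierL2 x =ᵐ[volume] besselTerm w k (polyVal p) := by
  set a : ℂ := (-Complex.I) ^ k * (((2 * Real.pi) ^ ((n : ℝ) / 2) : ℝ) : ℂ)
  have ha : a ≠ 0 := by
    refine mul_ne_zero (pow_ne_zero _ (neg_ne_zero.2 Complex.I_ne_zero)) ?_
    have : (0 : ℝ) < (2 * Real.pi) ^ ((n : ℝ) / 2) := by positivity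
    exact_mod_cast this.ne'
  have hp' : a⁻¹ • p ∈ harmonicPoly n k := Submodule.smul_mem _ _ hp
  refine ⟨_, ⟨polyLp n (a⁻¹ • p), ⟨_, hp', rfl⟩, rfl⟩,
    (fourierL2_adjoint_harmonic hw hp').trans (.of_forall fun ξ => ?_)⟩
  simp only [besselTerm, polyVal_smul]
  change _ * (a * (a⁻¹ * _) * _) = _
  rw [mul_inv_cancel_left₀ ha]

lemma isSphericalHarmonic_polyVal {k : ℕ} {p : MvPolynomial (Fin n) ℂ}
    (hp : p ∈ harmonicPoly n k) : IsSphericalHarmonic k (polyVal p) := by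
  rw [mem_harmonicPoly, polyLap_apply] at hp
  exact ⟨p, hp.1, hp.2, fun _ _ => rfl⟩

lemma IsSphericalHarmonic.exists_mem_traceEigen (hw : AdmissibleWeight n w) {k : ℕ}
    {Y : Rn n → ℂ} (hY : IsSphericalHarmonic k Y) :
    ∃ x ∈ traceEigen hw (some k), fourierL2 x =ᵐ[volume] besselTerm w k Y := by
  obtain ⟨p, hp, hp0, h⟩ := hY
  obtain ⟨x, hx, hxp⟩ := exists_mem_traceEigen_of_harmonicPoly hw
    (mem_harmonicPoly.2 ⟨hp, by rw [polyLap_apply, hp0]⟩)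
  refine ⟨x, hx, ?_⟩
  filter_upwards [hxp, ae_ne_zero (n := n) (by have := hw.two_le; omega)] with ξ h1 h2
  rw [h1, besselTerm, besselTerm, h]
  · rfl
  · rw [mem_sphere_zero_iff_norm, norm_smul, norm_inv, norm_norm,
      inv_mul_cancel₀ (norm_ne_zero_iff.2 h2)]

/-- By Plancherel, a Bessel expansion of `ĝ` is an expansion of `g` into eigenfunctions. -/
lemma hasBesselExpansion_iff_hasSum {K : Set ℕ} {g x₀ : L2Space n} {c : ℂ} {Y : ℕ → Rn n → ℂ}
    {x : ℕ → L2Space n} (h0 : fourierL2 x₀ =ᵐ[volume] besselTerm w 0 fun _ => c)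
    (hx : ∀ k ∈ K, fourierL2 (x k) =ᵐ[volume] besselTerm w k (Y k)) :
    HasBesselExpansion w K g c Y ↔ HasSum (fun k : K => x k) (g - x₀) := by
  obtain ⟨A, hA0, hAt, hA⟩ := eLpNorm_fourierL2 (n := n)
  have he : ∀ s : Finset K, eLpNorm (fun ξ => fourierL2 g ξ -
      besselExpansion w c Y (s.map (Function.Embedding.subtype _)) ξ) 2 volume =
        A * ‖(g - x₀) - ∑ k ∈ s, x k‖ₑ := fun s => by
    rw [← hA]
    refine eLpNorm_congr_ae ?_
    have hs : ∀ᵐ ξ : Rn n, ∀ k ∈ s, fourierL2 (x k) ξ = besselTerm w k (Y k) ξ :=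
      (ae_ball_iff s.countable_toSet).2 fun k _ => hx k k.2
    filter_upwards [fourierL2_sub (g - x₀) (∑ k ∈ s, x k), fourierL2_sub g x₀,
      fourierL2_sum s (fun k : K => x k), h0, hs] with ξ h1 h2 h3 h4 h5
    rw [h1, h2, h3, h4, besselExpansion_eq_sum, Finset.sum_map, Finset.sum_congr rfl h5, sub_sub]
    rfl
  rw [HasBesselExpansion]
  simp_rw [he]
  rw [HasSum, SummationFilter.unconditional_filter, tendsto_iff_norm_sub_tendsto_zero]
  have h1 : Tendsto (fun s : Finset K => A * ‖(g - x₀) - ∑ k ∈ s, x k‖ₑ) atTop (𝓝 0) ↔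
      Tendsto (fun s : Finset K => ‖(g - x₀) - ∑ k ∈ s, x k‖ₑ) atTop (𝓝 0) := by
    refine ⟨fun h => ?_, fun h => ?_⟩
    · have h2 := ENNReal.Tendsto.const_mul (a := A⁻¹) h (Or.inr (ENNReal.inv_ne_top.2 hA0))
      rw [mul_zero] at h2
      refine h2.congr fun s => ?_
      rw [← mul_assoc, ENNReal.inv_mul_cancel hA0 hAt, one_mul]
    · have h2 := ENNReal.Tendsto.const_mul (a := A) h (Or.inr hAt)
      rwa [mul_zero] at h2
  rw [h1, ← ENNReal.tendsto_toReal_iff (fun _ => enorm_ne_top) ENNReal.zero_ne_top]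
  simp_rw [toReal_enorm, ENNReal.toReal_zero]
  refine tendsto_congr fun s => ?_
  rw [norm_sub_rev]

/-! ### Stability for the sphere trace -/

lemma harmonicLp_ne_bot (hn : 2 ≤ n) (k : ℕ) : harmonicLp n k ≠ ⊥ := by
  obtain ⟨p, hp, θ, hθ⟩ := exists_harmonicPoly_ne_zero hn k
  intro h
  have h1 : polyLp n p ∈ harmonicLp n k := ⟨p, hp, rfl⟩
  rw [h, Submodule.mem_bot] at h1
  have h2 : polySphere n p = 0 := ContinuousMap.toLp_injective (E := ℂ) (𝕜 := ℂ) (p := 2)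
    (sphereMeasure n) (h1.trans (map_zero (ContinuousMap.toLp (E := ℂ) 2 (sphereMeasure n) ℂ)).symm)
  refine hθ ?_
  rw [← polySphere_apply, h2, ContinuousMap.zero_apply]

lemma orthogonalFamily_traceEigen (hw : AdmissibleWeight n w) :
    OrthogonalFamily ℂ (fun i => traceEigen hw i) fun i => (traceEigen hw i).subtypeₗᵢ :=
  orthogonalFamily_eigenFamily (c := lambdaCoeff n w)
    (fun _ _ hkl _ hf _ hg => inner_harmonicLp_eq_zero (by have := hw.two_le; omega) hkl hf hg)
    fun _ _ hf => sphereTrace_adjoint hw hf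

lemma topologicalClosure_iSup_traceEigen (hw : AdmissibleWeight n w) :
    (⨆ i, traceEigen hw i).topologicalClosure = ⊤ :=
  topologicalClosure_iSup_eigenFamily
    (topologicalClosure_iSup_harmonicLp (by have := hw.two_le; omega))

lemma inner_traceEigen (hw : AdmissibleWeight n w) : ∀ i, ∀ x ∈ traceEigen hw i, ∀ y,
    inner ℂ (sphereTrace hw x) (sphereTrace hw y) =
      (eigenValue (lambdaCoeff n w) i : ℂ) * inner ℂ x y :=
  inner_eigenFamily fun _ _ hf => sphereTrace_adjoint hw hf

lemma traceEigen_some_ne_bot (hw : AdmissibleWeight n w) (k : ℕ) : traceEigen hw (some k) ≠ ⊥ :=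
  eigenFamily_some_ne_bot (c := lambdaCoeff n w) (fun _ hf => sphereTrace_adjoint hw hf)
    (hw.lambdaCoeff_pos k).ne' (harmonicLp_ne_bot hw.two_le k)

lemma AdmissibleWeight.bddAbove (hw : AdmissibleWeight n w) :
    BddAbove (lambdaCoeff n w '' Set.Ici 1) :=
  ⟨lambdaCoeff n w 0, by rintro _ ⟨k, -, rfl⟩; exact hw.le k⟩

lemma AdmissibleWeight.le_lambdaStar (hw : AdmissibleWeight n w) {k : ℕ} (hk : 1 ≤ k) :
    lambdaCoeff n w k ≤ lambdaStar n w :=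
  le_csSup hw.bddAbove ⟨k, hk, rfl⟩

lemma AdmissibleWeight.lambdaStar_pos (hw : AdmissibleWeight n w) : 0 < lambdaStar n w :=
  (hw.lambdaCoeff_pos 1).trans_le (hw.le_lambdaStar le_rfl)

lemma AdmissibleWeight.eigenValue_lt (hw : AdmissibleWeight n w) (i : Option ℕ)
    (hi : i ≠ some 0) :
    eigenValue (lambdaCoeff n w) i < eigenValue (lambdaCoeff n w) (some 0) := by
  cases i with
  | none => exact hw.lambdaCoeff_pos 0
  | some k => exact hw.lt k fun h => hi (congrArg some h)

lemma AdmissibleWeight.eigenValue_le (hw : AdmissibleWeight n w) (i : Option ℕ)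
    (hi : i ≠ some 0) : eigenValue (lambdaCoeff n w) i ≤ lambdaStar n w := by
  cases i with
  | none => exact hw.lambdaStar_pos.le
  | some k => exact hw.le_lambdaStar (Nat.one_le_iff_ne_zero.2 fun h => hi (congrArg some h))

lemma AdmissibleWeight.eigenValue_eq_iff (hw : AdmissibleWeight n w) (i : Option ℕ)
    (hi : i ≠ some 0) : eigenValue (lambdaCoeff n w) i = lambdaStar n w ↔
      ∃ k ∈ attainingSet n w, some k = i := by
  cases i with
  | none => exact ⟨fun h => absurd h hw.lambdaStar_pos.ne, by rintro ⟨k, -, hk⟩; cases hk⟩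
  | some k =>
    refine ⟨fun h => ⟨k, ⟨Nat.one_le_iff_ne_zero.2 fun h => hi (congrArg some h), h⟩, rfl⟩, ?_⟩
    rintro ⟨l, hl, hlk⟩
    rw [← hlk]
    exact hl.2

/-- The stability inequality, and its cases of equality in terms of the eigenspaces. -/
lemma stability_sphereTrace (hw : AdmissibleWeight n w) (g : L2Space n) :
    stabilityConst n w * distSq (sphereTrace hw) g ≤ deficit (sphereTrace hw) g ∧
      (deficit (sphereTrace hw) g = stabilityConst n w * distSq (sphereTrace hw) g ↔
        ∀ i, i ≠ some 0 → (¬ ∃ k ∈ attainingSet n w, some k = i) →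
          (traceEigen hw i).starProjection g = 0) := by
  have h := stability_of_eigen (orthogonalFamily_traceEigen hw)
    (topologicalClosure_iSup_traceEigen hw) (inner_traceEigen hw) (o := some 0)
    (hw.lambdaCoeff_pos 0).le hw.eigenValue_lt (traceEigen_some_ne_bot hw 0) hw.eigenValue_le g
  refine ⟨h.1, h.2.trans (forall₂_congr fun i hi => ?_)⟩
  rw [Ne, hw.eigenValue_eq_iff i hi]

lemma mem_extremisers_iff (hw : AdmissibleWeight n w) (g : L2Space n) :
    g ∈ extremisers (sphereTrace hw) ↔ g ≠ 0 ∧ g ∈ traceEigen hw (some 0) :=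
  and_congr_right fun _ => norm_eq_iff_mem_of_eigen (orthogonalFamily_traceEigen hw)
    (topologicalClosure_iSup_traceEigen hw) (inner_traceEigen hw) (o := some 0)
    (hw.lambdaCoeff_pos 0).le hw.eigenValue_lt (traceEigen_some_ne_bot hw 0) g

lemma extremisers_sphereTrace_nonempty (hw : AdmissibleWeight n w) :
    (extremisers (sphereTrace hw)).Nonempty := by
  obtain ⟨x, hx, hx0⟩ := Submodule.exists_mem_ne_zero_of_ne_bot (traceEigen_some_ne_bot hw 0)
  exact ⟨x, (mem_extremisers_iff hw x).2 ⟨hx0, hx⟩⟩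

lemma deficit_distSq_of_mem_traceEigen (hw : AdmissibleWeight n w) {k : ℕ} (hk : 1 ≤ k)
    {g : L2Space n} (hg : g ∈ traceEigen hw (some k)) :
    deficit (sphereTrace hw) g = (lambdaCoeff n w 0 - lambdaCoeff n w k) * ‖g‖ ^ 2 ∧
      distSq (sphereTrace hw) g = ‖g‖ ^ 2 :=
  deficit_of_mem_eigen (orthogonalFamily_traceEigen hw)
    (topologicalClosure_iSup_traceEigen hw) (inner_traceEigen hw) (o := some 0)
    (hw.lambdaCoeff_pos 0).le hw.eigenValue_lt (traceEigen_some_ne_bot hw 0)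
    (fun h => by rw [Option.some_inj] at h; omega) hg

/-- Testing with spherical harmonics of degree `k` bounds every admissible constant by
`λ₀ - λ_k`. -/
lemma StabilityInequality.le (hw : AdmissibleWeight n w) {C : ℝ}
    (h : StabilityInequality (sphereTrace hw) C) : C ≤ stabilityConst n w := by
  have h1 : lambdaStar n w ≤ lambdaCoeff n w 0 - C := by
    refine csSup_le ⟨_, 1, Set.self_mem_Ici, rfl⟩ ?_
    rintro _ ⟨k, hk, rfl⟩
    obtain ⟨g, hg, hg0⟩ := Submodule.exists_mem_ne_zero_of_ne_bot (traceEigen_some_ne_bot hw k)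
    have h2 := h g
    rw [(deficit_distSq_of_mem_traceEigen hw hk hg).1,
      (deficit_distSq_of_mem_traceEigen hw hk hg).2] at h2
    have h3 : 0 < ‖g‖ ^ 2 := by positivity
    linarith [le_of_mul_le_mul_right h2 h3]
  rw [stabilityConst]
  linarith

lemma exists_stability_eq_iff (hw : AdmissibleWeight n w) (hC : 0 < stabilityConst n w) :
    (∃ g : L2Space n, 0 < distSq (sphereTrace hw) g ∧
      deficit (sphereTrace hw) g = stabilityConst n w * distSq (sphereTrace hw) g) ↔
        (attainingSet n w).Nonempty := by
  constructor
  · rintro ⟨g, hg, he⟩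
    by_contra hK
    have h1 := (stability_sphereTrace hw g).2.1 he
    have hs := hasSum_starProjection (orthogonalFamily_traceEigen hw)
      (topologicalClosure_iSup_traceEigen hw) g
    have h2 := hs.unique (hasSum_single (some 0) fun i hi => h1 i hi
      fun ⟨k, hk, _⟩ => hK ⟨k, hk⟩)
    have h3 : g ∈ traceEigen hw (some 0) := by
      rw [h2]
      exact Submodule.starProjection_apply_mem _ _
    have h4 : ‖sphereTrace hw g‖ = ‖sphereTrace hw‖ * ‖g‖ := by
      rcases eq_or_ne g 0 with rfl | hg0
      · simp
      · exact ((mem_extremisers_iff hw g).2 ⟨hg0, h3⟩).2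
    rw [deficit, h4, mul_pow, sub_self] at he
    exact (mul_pos hC hg).ne he
  · rintro ⟨k, hk⟩
    obtain ⟨g, hg, hg0⟩ := Submodule.exists_mem_ne_zero_of_ne_bot (traceEigen_some_ne_bot hw k)
    obtain ⟨h1, h2⟩ := deficit_distSq_of_mem_traceEigen hw hk.1 hg
    refine ⟨g, ?_, ?_⟩
    · rw [h2]
      positivity
    · rw [h1, h2, hk.2, stabilityConst]

/-- Equality holds if and only if `g` lies in the closed span of the eigenspaces of degree `0` and of
the degrees in `𝒦(w)`. Their elements have Fourier transforms
`w(|ξ|)^{1/2} |ξ|^{-(n-2)/2} Y_k(ξ/|ξ|) J_{(n-2)/2+k}(|ξ|)`, constants being the spherical harmonics of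
degree `0`. -/
lemma stability_eq_iff_hasBesselExpansion (hw : AdmissibleWeight n w) (g : L2Space n) :
    deficit (sphereTrace hw) g = stabilityConst n w * distSq (sphereTrace hw) g ↔
      ∃ (c : ℂ) (Y : ℕ → Rn n → ℂ), (∀ k ∈ attainingSet n w, IsSphericalHarmonic k (Y k)) ∧
        HasBesselExpansion w (attainingSet n w) g c Y := by
  classical
  rw [(stability_sphereTrace hw g).2]
  have hinj : Function.Injective fun k : attainingSet n w => some (k : ℕ) :=
    (Option.some_injective ℕ).comp Subtype.val_injective
  constructor
  · intro h
    have hp := fun k => exists_harmonicPoly_of_mem_traceEigen hw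
      (Submodule.starProjection_apply_mem (traceEigen hw (some k)) g)
    choose p hp hpx using hp
    obtain ⟨c, hc⟩ := eq_C_of_isHomogeneous_zero (mem_harmonicPoly.1 (hp 0)).1
    have h0 : polyVal (p 0) = fun _ => c := funext fun x => by rw [hc, polyVal_C]
    refine ⟨c, fun k => polyVal (p k), fun k _ => isSphericalHarmonic_polyVal (hp k), ?_⟩
    rw [hasBesselExpansion_iff_hasSum (x := fun k => (traceEigen hw (some k)).starProjection g)
      (x₀ := (traceEigen hw (some 0)).starProjection g) (h0 ▸ hpx 0) fun k _ => hpx k]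
    have hs := (hasSum_starProjection (orthogonalFamily_traceEigen hw)
      (topologicalClosure_iSup_traceEigen hw) g).update (some 0) 0
    rw [zero_sub, neg_add_eq_sub, ← hinj.hasSum_iff] at hs
    · refine hs.congr_fun fun k => ?_
      have hk : (some (k : ℕ)) ≠ some 0 := fun h => by
        have := k.2.1
        rw [Option.some_inj] at h
        omega
      rw [Function.comp_apply, Function.update_of_ne hk]
    · intro i hi
      rcases eq_or_ne i (some 0) with rfl | hi0
      · exact Function.update_self _ _ _
      · rw [Function.update_of_ne hi0]
        exact h i hi0 fun ⟨k, hk, hki⟩ => hi ⟨⟨k, hk⟩, hki⟩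
  · rintro ⟨c, Y, hY, h⟩ i hi0 hi
    obtain ⟨x₀, hx₀, hx₀c⟩ := exists_mem_traceEigen_of_harmonicPoly hw
      (Submodule.smul_mem _ c (one_mem_harmonicPoly (n := n)))
    have hx : ∀ k, ∃ x, k ∈ attainingSet n w → x ∈ traceEigen hw (some k) ∧
        fourierL2 x =ᵐ[volume] besselTerm w k (Y k) := fun k => by
      by_cases hk : k ∈ attainingSet n w
      · obtain ⟨x, hx⟩ := (hY k hk).exists_mem_traceEigen hw
        exact ⟨x, fun _ => hx⟩
      · exact ⟨0, fun h => absurd h hk⟩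
    choose x hx using hx
    have h0 : polyVal (c • (1 : MvPolynomial (Fin n) ℂ)) = fun _ => c := funext fun y => by
      rw [polyVal_smul, polyVal_one, mul_one]
    rw [h0] at hx₀c
    rw [hasBesselExpansion_iff_hasSum hx₀c fun k hk => (hx k hk).2] at h
    have hort : ∀ j, j ≠ i → ∀ y ∈ traceEigen hw j, (traceEigen hw i).starProjection y = 0 :=
      fun j hj y hy => by
        rw [Submodule.starProjection_apply_eq_zero_iff, Submodule.mem_orthogonal]
        exact fun u hu => orthogonalFamily_traceEigen hw hj.symm ⟨u, hu⟩ ⟨y, hy⟩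
    have hs := h.mapL (traceEigen hw i).starProjection
    have h2 : ∀ k : attainingSet n w, (traceEigen hw i).starProjection (x k) = 0 := fun k =>
      hort (some k) (fun hk => hi ⟨k, k.2, hk⟩) _ (hx k k.2).1
    simp_rw [h2] at hs
    have h3 := hs.unique hasSum_zero
    rwa [map_sub, hort (some 0) hi0.symm x₀ hx₀, sub_zero] at h3

end
end

section
variable {n : ℕ} {w : ℝ → ℝ}

/-- The positivity of the Fourier transform of the weight yields the finiteness of all `λ_k` and
the strict maximality of `λ₀`. -/
lemma AdmissibleWeight.of_hasPositiveFourierTransform (hn : 2 ≤ n)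
    (hpos : ∀ r : ℝ, 0 < r → 0 < w r) (hw : HasPositiveFourierTransform n w)
    (hfin : IntegrableOn (lambdaIntegrand n w 0) (Set.Ioi (0 : ℝ))) : AdmissibleWeight n w := by
  obtain ⟨⟨N, hN⟩, Φ, hΦ0, hΦl, hΦ⟩ := hw
  have h0 := (integrable_weight_mul_besselProfile_iff hn w 0).2 hfin
  obtain ⟨R, hR, hE⟩ := exists_integrableOn_weight_mul_energy hn hpos hN hΦ0 hΦ h0
  have hint := integrable_weight_mul_besselProfile hn hpos hN hR hE
  have hW := integrable_weight_mul_inv_pow hn hpos hN h0 (hint 1)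
  exact ⟨hn, hpos, ⟨N, hN⟩, hint, fun k hk =>
    lambdaCoeff_lt_lambdaCoeff_zero hn hpos hW hint hΦ0 hΦl hΦ hk⟩

end

theorem theorem1p1 (n : ℕ) (hn : 2 ≤ n) (w : ℝ → ℝ)
    (hw_meas : AEMeasurable w (volume.restrict (Set.Ioi (0 : ℝ))))
    (hw_pos : ∀ r : ℝ, 0 < r → 0 < w r)
    (hw_fourier : HasPositiveFourierTransform n w)
    (hw_fin : IntegrableOn (lambdaIntegrand n w 0) (Set.Ioi (0 : ℝ))) :
    -- the quantities in the statement are well defined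
    (∀ k : ℕ, IntegrableOn (lambdaIntegrand n w k) (Set.Ioi (0 : ℝ))) ∧
    BddAbove (lambdaCoeff n w '' Set.Ici 1) ∧
    (∃! S : L2Space n →L[ℂ] L2Sphere n, IsSphereTrace w S) ∧
    ∀ S : L2Space n →L[ℂ] L2Sphere n, IsSphereTrace w S →
      (extremisers S).Nonempty ∧
      -- the stability inequality
      StabilityInequality S (stabilityConst n w) ∧
      (0 < stabilityConst n w →
        -- optimality of the constant
        (∀ C : ℝ, StabilityInequality S C → C ≤ stabilityConst n w) ∧
        -- existence of nontrivial cases of equality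
        ((∃ g : L2Space n, 0 < distSq S g ∧
            deficit S g = stabilityConst n w * distSq S g) ↔
          (attainingSet n w).Nonempty) ∧
        -- characterization of all cases of equality
        ((attainingSet n w).Nonempty → ∀ g : L2Space n,
          (deficit S g = stabilityConst n w * distSq S g ↔
            ∃ (c : ℂ) (Y : ℕ → Rn n → ℂ),
              (∀ k ∈ attainingSet n w, IsSphericalHarmonic k (Y k)) ∧
              HasBesselExpansion w (attainingSet n w) g c Y))) ∧
      -- failure in the degenerate case
      (stabilityConst n w = 0 → ∀ C : ℝ, 0 < C → ¬ StabilityInequality S C) := by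
  have hw := AdmissibleWeight.of_hasPositiveFourierTransform hn hw_pos hw_fourier hw_fin
  have hS := isSphereTrace_sphereTrace hw
  refine ⟨fun k => (integrable_weight_mul_besselProfile_iff hn w k).1 (hw.integrable k),
    hw.bddAbove, ⟨sphereTrace hw, hS, fun T hT => hT.unique hw hS⟩, fun S hS' => ?_⟩
  obtain rfl := hS'.unique hw hS
  exact ⟨extremisers_sphereTrace_nonempty hw, fun g => (stability_sphereTrace hw g).1,
    fun hC => ⟨fun C h => h.le hw, exists_stability_eq_iff hw hC,
      fun _ g => stability_eq_iff_hasBesselExpansion hw g⟩,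
    fun h0 C hC h => by linarith [h.le hw]⟩
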